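/- Let $R\in\mathbb{C}(x)$, seen as a map $\mathbb{P}^1\to\mathbb{P}^1$, where $\mathbb{P}^1=\mathbb{C}\cup\{\infty\}$. For a rational fraction $\mu\in\mathbb{C}(x)$, let $G_2(\mu)$ be the $\mathcal{D}$-Lie groupoid on $\mathbb{P}^1$ given by the equation $\mu(y)\,y_1+\frac{y_2}{y_1}-\mu(x)=0$ on the jets $(x,y,y_1,y_2)$, $y_1\neq 0$, of invertible maps. We say that $R$ is a solution of $G_2(\mu)$ if $R$ is not constant and $\mu(R(x))\,R'(x)+\frac{R''(x)}{R'(x)}=\mu(x)$ at every $x\in\mathbb{C}$ that is not a pole of $R$ or of $\mu$ and for which $R'(x)\ne 0$ and $R(x)$ is not a pole of $\mu$. We say that $R$ is the quotient of the dilation $z\mapsto\lambda z$ ($\lambda\in\mathbb{C}^*$) by a group $G$ through $\Psi$ if $G$ is a discrete group of affine maps $z\mapsto az+b$ of $\mathbb{C}$ and $\Psi:\mathbb{C}\to\mathbb{P}^1$ is a holomorphic map whose fibres are exactly the orbits of $G$ and which satisfies $R(\Psi(z))=\Psi(\lambda z)$ for all $z$. **(a)** If $R$ is not a homography (that is, if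 $\deg R\neq 1$), then there is a $\mu\in\mathbb{C}(x)$ such that $R$ is a solution of $G_2(\mu)$ if and only if $R$ is the quotient of a dilation of $\mathbb{C}$ by a discrete group of affine maps. **(b)** Let $R$ (of any degree) be the quotient of a dilation by $G$ through $\Psi$. Then there are an affine bijection $A$ of $\mathbb{C}$ and a homography $h$ such that, after replacing $\Psi$ by $h\circ\Psi\circ A$, $G$ by $A^{-1}GA$ and $R$ by $S=h\circ R\circ h^{-1}$, one is in one of the following seven cases. In each of them $G$ is the group of all maps $z\mapsto\varepsilon z+b$ with $\varepsilon^k=1$ and $b\in\Lambda$, and $S$ is a solution of $G_2(\mu)$ for the given $\mu$. Here $\wp$ is the Weierstrass function of $\Lambda$, with $(\wp')^2=4\wp^3-g_2\wp-g_3$, and $j=e^{2i\pi/3}$. 1. $\Lambda=\{0\}$, $k\ge 1$: $\Psi(z)=z^k$, $S(x)=ax$ with $a\neq0$, $\mu=0$. 2. $\Lambda=\mathbb{Z}$, $k=1$: $\Psi(z)=\exp(2i\pi z)$, $S(x)=x^n$ with $n\in\mathbb{Z}\setminus\{0\}$, $\mu(x)=-\frac1x$. 3. $\Lambda=\mathbb{Z}$,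 $k=2$: $\Psi(z)=\cos(2\pi z)$, $S=\pm T_n$ with $n\geq 1$ and $T_n$ the Chebyshev polynomial ($T_n(\cos w)=\cos nw$), $\mu(x)=-\frac{x}{x^2-1}$. 4. $\Lambda=\mathbb{Z}+\mathbb{Z}\tau$ with $\operatorname{Im}\tau>0$, $k=2$: $\Psi=\wp$, $\mu(x)=-\frac{6x^2-g_2/2}{4x^3-g_2x-g_3}$. 5. $\Lambda=\mathbb{Z}+\mathbb{Z}i$, $k=4$: $g_3=0$, $\Psi=\wp^2$, $\mu(x)=-\frac1{2x}-\frac{6x-g_2/2}{8x^2-2g_2x}$. 6. $\Lambda=\mathbb{Z}+\mathbb{Z}j$, $k=3$: $g_2=0$, $\Psi=\wp'$, $\mu(x)=-\frac{4x}{3(x^2+g_3)}$. 7. $\Lambda=\mathbb{Z}+\mathbb{Z}j$, $k=6$: $g_2=0$, $\Psi=\wp^3$, $\mu(x)=-\frac{2}{3x}-\frac{1}{2(x-g_3/4)}$. In cases 4 to 7, $S$ is a Lattès example: there are a lattice $\Lambda'\subset\mathbb{C}$, a complex number $a\neq 0$ with $a\Lambda'\subset\Lambda'$ and a nonconstant $\Lambda'$-periodic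 holomorphic map $p:\mathbb{C}\to\mathbb{P}^1$ with $S(p(z))=p(az)$ for all $z$. -/

import Mathlib

open Filter Topology OnePoint

noncomputable section

namespace DGroupoid

/-! ### Rational maps of the Riemann sphere -/

/-- The Riemann sphere `ℙ¹(ℂ) = ℂ ∪ {∞}`. -/
abbrev Sphere : Type := OnePoint ℂ

/-- The value of a rational fraction at a finite point (meaningful where the reduced denominator
does not vanish). -/
def val (R : RatFunc ℂ) (x : ℂ) : ℂ := R.eval (RingHom.id ℂ) x

/-- `x : ℂ` is not a pole of `R`. -/
def RegularAt (R : RatFunc ℂ) (x : ℂ) : Prop := R.denom.eval x ≠ 0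

/-- The self-map of the Riemann sphere given by a rational fraction. -/
def ratMap (R : RatFunc ℂ) : Sphere → Sphere
  | ∞ => if R.denom.natDegree < R.num.natDegree then ∞
      else ((R.num.coeff R.denom.natDegree / R.denom.coeff R.denom.natDegree : ℂ) : Sphere)
  | (x : ℂ) => if R.denom.eval x = 0 then ∞ else ((val R x : ℂ) : Sphere)

/-- The degree of a rational map. The homographies are the rational maps of degree one. -/
def degree (R : RatFunc ℂ) : ℕ := max R.num.natDegree R.denom.natDegree

/-! ### Jets of order two and the groupoid `G₂(μ)` -/

/-- Jets of order two of invertible maps, in the affine coordinate: `(x, y, y₁, y₂)`, `y₁ ≠ 0`. -/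
@[ext] structure Jet2 where
  x : ℂ
  y : ℂ
  y₁ : ℂ
  y₂ : ℂ
  y₁_ne : y₁ ≠ 0

namespace Jet2

/-- The jet of the identity. -/
def one (x : ℂ) : Jet2 := ⟨x, x, 1, 0, one_ne_zero⟩

/-- Composition of jets: first `g`, then `f` (meaningful when `g.y = f.x`). -/
def comp (f g : Jet2) : Jet2 :=
  ⟨g.x, f.y, f.y₁ * g.y₁, f.y₂ * g.y₁ ^ 2 + f.y₁ * g.y₂, mul_ne_zero f.y₁_ne g.y₁_ne⟩

/-- The inverse jet. -/
def symm (f : Jet2) : Jet2 :=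
  ⟨f.y, f.x, f.y₁⁻¹, - f.y₂ / f.y₁ ^ 3, inv_ne_zero f.y₁_ne⟩

/-- The jet at `x` of a function whose derivative at `x` is nonzero. -/
def ofFun (f : ℂ → ℂ) (x : ℂ) (h : deriv f x ≠ 0) : Jet2 :=
  ⟨x, f x, deriv f x, deriv (deriv f) x, h⟩

end Jet2

/-- The groupoid `G₂(μ)`: the invertible jets, with source and target outside the poles of `μ`,
which satisfy `μ(y) y₁ + y₂ / y₁ - μ(x) = 0`. -/
def G2 (μ : RatFunc ℂ) : Set Jet2 :=
  {j | RegularAt μ j.x ∧ RegularAt μ j.y ∧ val μ j.y * j.y₁ + j.y₂ / j.y₁ - val μ j.x = 0}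

theorem one_mem_G2 (μ : RatFunc ℂ) (x : ℂ) (hx : RegularAt μ x) : Jet2.one x ∈ G2 μ := by
  refine ⟨hx, hx, ?_⟩
  simp [Jet2.one]

theorem comp_mem_G2 (μ : RatFunc ℂ) (f g : Jet2) (hfg : g.y = f.x) (hf : f ∈ G2 μ)
    (hg : g ∈ G2 μ) : f.comp g ∈ G2 μ := by
  obtain ⟨_, hf2, hf3⟩ := hf
  obtain ⟨hg1, _, hg3⟩ := hg
  refine ⟨hg1, hf2, ?_⟩
  have h1 := f.y₁_ne
  have h2 := g.y₁_ne
  rw [hfg] at hg3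
  have e : (f.y₂ * g.y₁ ^ 2 + f.y₁ * g.y₂) / (f.y₁ * g.y₁)
      = f.y₂ / f.y₁ * g.y₁ + g.y₂ / g.y₁ := by field_simp
  simp only [Jet2.comp, e]
  linear_combination g.y₁ * hf3 + hg3

theorem symm_mem_G2 (μ : RatFunc ℂ) (f : Jet2) (hf : f ∈ G2 μ) : f.symm ∈ G2 μ := by
  obtain ⟨hf1, hf2, hf3⟩ := hf
  refine ⟨hf2, hf1, ?_⟩
  have h1 := f.y₁_ne
  have e : -f.y₂ / f.y₁ ^ 3 / f.y₁⁻¹ = - (f.y₂ / f.y₁) * f.y₁⁻¹ := by field_simp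
  have e' : val μ f.y = val μ f.y * f.y₁ * f.y₁⁻¹ := by field_simp
  simp only [Jet2.symm, e]
  linear_combination (-f.y₁⁻¹) * hf3 - e'

/-- `R` is a solution of `G₂(μ)`: it is not constant, and wherever its jet of order two is an
invertible jet, with source and target in `ℂ` and outside the poles of `μ`, this jet belongs
to `G₂(μ)`. -/
def IsSolutionG2 (μ R : RatFunc ℂ) : Prop :=
  (¬ ∃ c : ℂ, R = RatFunc.C c) ∧
  ∀ (x : ℂ) (h : deriv (val R) x ≠ 0),
    RegularAt R x → RegularAt μ x → RegularAt μ (val R x) → Jet2.ofFun (val R) x h ∈ G2 μ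

/-! ### Quotients of dilations -/

/-- Holomorphic maps from `ℂ` to the Riemann sphere. -/
def HolomorphicToSphere (f : ℂ → Sphere) : Prop :=
  ∀ z : ℂ, ∃ F : ℂ → ℂ, AnalyticAt ℂ F z ∧
    ((∀ᶠ w in 𝓝 z, f w = (F w : Sphere)) ∨
     (∀ᶠ w in 𝓝 z, f w = if F w = 0 then ∞ else (((F w)⁻¹ : ℂ) : Sphere)))

/-- A group of affine maps `z ↦ a z + b` of `ℂ` is discrete when its set of coefficients `(a, b)`
is a discrete subset of `ℂ × ℂ`. -/
def IsDiscreteGroup (G : Subgroup (ℂ ≃ᵃ[ℂ] ℂ)) : Prop :=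
  IsDiscrete {p : ℂ × ℂ | ∃ γ ∈ G, ∀ z, γ z = p.1 * z + p.2}

/-- `R` is the quotient of the dilation `z ↦ lam * z` of `ℂ` by the discrete group `G` of affine
maps, through `Ψ`: the fibres of the holomorphic map `Ψ : ℂ → ℙ¹` are the orbits of `G`
and `R ∘ Ψ = Ψ ∘ (lam * ·)`. -/
structure IsQuotientOfDilation (R : RatFunc ℂ) (lam : ℂ) (G : Subgroup (ℂ ≃ᵃ[ℂ] ℂ))
    (Ψ : ℂ → Sphere) : Prop where
  lam_ne_zero : lam ≠ 0
  discrete : IsDiscreteGroup G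
  holomorphic : HolomorphicToSphere Ψ
  fibres : ∀ z w : ℂ, Ψ z = Ψ w ↔ ∃ γ ∈ G, γ z = w
  semiconj : ∀ z : ℂ, ratMap R (Ψ z) = Ψ (lam * z)

/-! ### The list of quotients -/

/-- `G` is the group of all the maps `z ↦ ε z + b` with `ε ^ k = 1` and `b ∈ Λ`. -/
def IsRotationTranslationGroup (G : Subgroup (ℂ ≃ᵃ[ℂ] ℂ)) (Λ : Set ℂ) (k : ℕ) : Prop :=
  ∀ γ : ℂ ≃ᵃ[ℂ] ℂ, γ ∈ G ↔ ∃ ε b : ℂ, ε ^ k = 1 ∧ b ∈ Λ ∧ ∀ z, γ z = ε * z + b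

/-- A Lattès example: a rational map `S` with `S ∘ p = p ∘ (a * ·)` for an isogeny `z ↦ a z` of a
complex torus `ℂ / Λ` and a nonconstant elliptic function `p` for `Λ`. -/
def IsLattes (S : RatFunc ℂ) : Prop :=
  ∃ (L : PeriodPair) (a : ℂ) (p : ℂ → Sphere), a ≠ 0 ∧ (∀ b ∈ L.lattice, a * b ∈ L.lattice) ∧
    HolomorphicToSphere p ∧ (∃ z w, p z ≠ p w) ∧ (∀ b ∈ L.lattice, ∀ z, p (z + b) = p z) ∧
    ∀ z, ratMap S (p z) = p (a * z)

/-- A function on `ℂ` with poles at the points of the lattice, as a map to the sphere. -/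
def withPoles (L : PeriodPair) (f : ℂ → ℂ) (z : ℂ) : Sphere :=
  open Classical in if z ∈ L.lattice then ∞ else (f z : Sphere)

open RatFunc in
/-- The seven normal forms of a quotient `S` of a dilation by a discrete group `G` through `Ψ`,
each with a rational `μ` such that `S` is a solution of `G₂(μ)`. -/
inductive NormalForm (S : RatFunc ℂ) (G : Subgroup (ℂ ≃ᵃ[ℂ] ℂ)) (Ψ : ℂ → Sphere) : Prop
  | rotation (k : ℕ) (hk : 1 ≤ k)
      (hG : IsRotationTranslationGroup G {0} k)
      (hΨ : ∀ z, Ψ z = ((z ^ k : ℂ) : Sphere))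
      (hS : ∃ a : ℂ, a ≠ 0 ∧ S = C a * X)
      (hμ : IsSolutionG2 0 S)
  | exp
      (hG : IsRotationTranslationGroup G (Set.range ((↑) : ℤ → ℂ)) 1)
      (hΨ : ∀ z, Ψ z = (Complex.exp (2 * Real.pi * Complex.I * z) : Sphere))
      (hS : ∃ n : ℤ, n ≠ 0 ∧ S = X ^ n)
      (hμ : IsSolutionG2 (- 1 / X) S)
  | cos
      (hG : IsRotationTranslationGroup G (Set.range ((↑) : ℤ → ℂ)) 2)
      (hΨ : ∀ z, Ψ z = (Complex.cos (2 * Real.pi * z) : Sphere))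
      (hS : ∃ n : ℕ, 1 ≤ n ∧
        (S = algebraMap (Polynomial ℂ) (RatFunc ℂ) (Polynomial.Chebyshev.T ℂ n) ∨
         S = - algebraMap (Polynomial ℂ) (RatFunc ℂ) (Polynomial.Chebyshev.T ℂ n)))
      (hμ : IsSolutionG2 (- X / (X ^ 2 - 1)) S)
  | wp (L : PeriodPair) (h₁ : L.ω₁ = 1) (h₂ : 0 < L.ω₂.im)
      (hG : IsRotationTranslationGroup G L.lattice 2)
      (hΨ : ∀ z, Ψ z = withPoles L L.weierstrassP z)
      (hS : IsLattes S)
      (hμ : IsSolutionG2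
        (- (6 * X ^ 2 - C (L.g₂ / 2)) / (4 * X ^ 3 - C L.g₂ * X - C L.g₃)) S)
  | wp_sq (L : PeriodPair) (h₁ : L.ω₁ = 1) (h₂ : L.ω₂ = Complex.I) (hg : L.g₃ = 0)
      (hG : IsRotationTranslationGroup G L.lattice 4)
      (hΨ : ∀ z, Ψ z = withPoles L (fun u => L.weierstrassP u ^ 2) z)
      (hS : IsLattes S)
      (hμ : IsSolutionG2
        (- 1 / (2 * X) - (6 * X - C (L.g₂ / 2)) / (8 * X ^ 2 - 2 * C L.g₂ * X)) S)
  | wp_deriv (L : PeriodPair) (h₁ : L.ω₁ = 1)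
      (h₂ : L.ω₂ = Complex.exp (2 * Real.pi * Complex.I / 3)) (hg : L.g₂ = 0)
      (hG : IsRotationTranslationGroup G L.lattice 3)
      (hΨ : ∀ z, Ψ z = withPoles L L.derivWeierstrassP z)
      (hS : IsLattes S)
      (hμ : IsSolutionG2 (- (4 * X) / (3 * (X ^ 2 + C L.g₃))) S)
  | wp_cube (L : PeriodPair) (h₁ : L.ω₁ = 1)
      (h₂ : L.ω₂ = Complex.exp (2 * Real.pi * Complex.I / 3)) (hg : L.g₂ = 0)
      (hG : IsRotationTranslationGroup G L.lattice 6)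
      (hΨ : ∀ z, Ψ z = withPoles L (fun u => L.weierstrassP u ^ 3) z)
      (hS : IsLattes S)
      (hμ : IsSolutionG2 (- 2 / (3 * X) - 1 / (2 * (X - C (L.g₃ / 4)))) S)

end DGroupoid

end

/-! The form `μ` is the Christoffel symbol of a meromorphic affine structure on the sphere. With
`pull m f = m(f) f' + f''/f'`, a solution of `G₂(μ)` is a rational map `R` with `pull μ R = μ`, and
`pull_comp` makes pulling back functorial. A map pulling `μ` back to `0` is a flat parametrization,
and two flat parametrizations differ by an affine map.

From a solution of degree at least two to a quotient: the holomorphic fixed point formula gives a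
fixed point with multiplier one or of modulus greater than one (`exists_fixed_point`). Its backward
orbit is infinite, hence meets a point where `μ` is regular. Pushing `μ` forward from there by an
iterate of `R` makes it regular in a ramified coordinate `x₀ + s ^ n` (`exists_ramified_chart`). In
the developing coordinate the lift of `R` is a dilation. Multiplier one would force `R` to be the
identity, so the dilation is expanding, and the semiconjugacy extends to all of `ℂ`
(`exists_global_linearization`). Two points of a fibre of the resulting `Ψ` are exchanged by an
affine symmetry: this is clear at regular points, and the others follow by compactness because
symmetries are isometries (`exists_affine_of_eq`).

Classification: since `Ψ` is not constant, the elements of `G` are isometries. The crystallographic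
restriction lists the possible translations and rotations. The fibres then determine `Ψ` up to a
homography. When the translations have rank at most one, `Ψ` factors through `z ^ k`, `exp` or
`cos`, and an injective holomorphic map from the punctured plane to the sphere is a homography
(`exists_smul_eq_coe`). When they form a lattice, `Ψ` and the explicit elliptic function have poles
of the same order, and Liouville's theorem applies to a suitable combination
(`exists_smul_eq_withPoles`). A lattice without rotations cannot occur (`order_ne_one`).

In every case `μ` is `-Ψ'' / Ψ' ^ 2` written as a function of `Ψ`. The dilation preserves the flat
form, so the quotient map preserves `μ` (`isSolutionG2_of_semiconj`). Pulling this `μ` back by the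
normalizing homography proves the converse in the first assertion. -/

noncomputable section
namespace DGroupoid

/-! ### Homogeneous coordinates on the sphere -/

/-- The point of the sphere with homogeneous coordinates `[a : b]`. -/
def toSphere (a b : ℂ) : Sphere := if b = 0 then ∞ else ((a / b : ℂ) : Sphere)

theorem toSphere_one (a : ℂ) : toSphere a 1 = (a : Sphere) := by simp [toSphere]

theorem toSphere_zero (a : ℂ) : toSphere a 0 = ∞ := by simp [toSphere]

theorem toSphere_of_ne {a b : ℂ} (hb : b ≠ 0) : toSphere a b = ((a / b : ℂ) : Sphere) := by
  simp [toSphere, hb]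

theorem toSphere_one_left (b : ℂ) :
    toSphere 1 b = if b = 0 then ∞ else ((b⁻¹ : ℂ) : Sphere) := by
  simp [toSphere]

theorem exists_toSphere (x : Sphere) : ∃ a b : ℂ, (a ≠ 0 ∨ b ≠ 0) ∧ x = toSphere a b := by
  induction x using OnePoint.rec with
  | infty => exact ⟨1, 0, by simp, (toSphere_zero 1).symm⟩
  | coe x => exact ⟨x, 1, by simp, (toSphere_one x).symm⟩

theorem toSphere_eq_iff {a b c d : ℂ} (h₁ : a ≠ 0 ∨ b ≠ 0) (h₂ : c ≠ 0 ∨ d ≠ 0) :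
    toSphere a b = toSphere c d ↔ a * d = b * c := by
  unfold toSphere
  by_cases hb : b = 0 <;> by_cases hd : d = 0
  · simp [hb, hd]
  · have : a ≠ 0 := by tauto
    simp [hb, hd, this]
  · have : c ≠ 0 := by tauto
    simp [hb, hd, this]
  · simp only [hb, hd, if_false, OnePoint.coe_eq_coe]
    rw [div_eq_div_iff hb hd, mul_comm c b]

theorem toSphere_mul {c : ℂ} (hc : c ≠ 0) (a b : ℂ) :
    toSphere (c * a) (c * b) = toSphere a b := by
  unfold toSphere
  by_cases hb : b = 0
  · simp [hb]
  · simp [hb, hc, mul_div_mul_left]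

theorem gl_ne_zero (h : GL (Fin 2) ℂ) {a b : ℂ} (hab : a ≠ 0 ∨ b ≠ 0) :
    h 0 0 * a + h 0 1 * b ≠ 0 ∨ h 1 0 * a + h 1 1 * b ≠ 0 := by
  have hdet : h 0 0 * h 1 1 - h 0 1 * h 1 0 ≠ 0 := by
    have := h.det_ne_zero
    rwa [Matrix.det_fin_two] at this
  by_contra! hc
  obtain ⟨h1, h2⟩ := hc
  have ha : (h 0 0 * h 1 1 - h 0 1 * h 1 0) * a = 0 := by
    linear_combination h 1 1 * h1 - h 0 1 * h2
  have hb : (h 0 0 * h 1 1 - h 0 1 * h 1 0) * b = 0 := by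
    linear_combination h 0 0 * h2 - h 1 0 * h1
  simp [hdet] at ha hb
  tauto

theorem smul_toSphere (h : GL (Fin 2) ℂ) {a b : ℂ} (hab : a ≠ 0 ∨ b ≠ 0) :
    h • toSphere a b = toSphere (h 0 0 * a + h 0 1 * b) (h 1 0 * a + h 1 1 * b) := by
  unfold toSphere
  by_cases hb : b = 0
  · have ha : a ≠ 0 := by tauto
    simp only [hb, if_true, OnePoint.smul_infty_eq_ite, mul_zero, add_zero, mul_eq_zero, ha,
      or_false]
    rw [mul_div_mul_right _ _ ha]
  · simp only [hb, if_false, OnePoint.smul_some_eq_ite]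
    have e1 : h 1 0 * (a / b) + h 1 1 = (h 1 0 * a + h 1 1 * b) / b := by field_simp
    have e2 : h 0 0 * (a / b) + h 0 1 = (h 0 0 * a + h 0 1 * b) / b := by field_simp
    rw [e1, e2, div_div_div_cancel_right₀ hb]
    simp [hb]

/-- The homography with given coefficients. -/
def homography (a b c d : ℂ) (h : a * d - b * c ≠ 0) : GL (Fin 2) ℂ :=
  Matrix.GeneralLinearGroup.mkOfDetNeZero !![a, b; c, d] (by rwa [Matrix.det_fin_two_of])

theorem homography_smul {a b c d : ℂ} (h : a * d - b * c ≠ 0) {u v : ℂ} (huv : u ≠ 0 ∨ v ≠ 0) :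
    homography a b c d h • toSphere u v = toSphere (a * u + b * v) (c * u + d * v) := by
  rw [smul_toSphere _ huv]
  rfl

theorem exists_smul_eq_infty (x : Sphere) : ∃ h : GL (Fin 2) ℂ, h • x = ∞ := by
  induction x using OnePoint.rec with
  | infty => exact ⟨1, one_smul _ _⟩
  | coe x =>
    refine ⟨homography 0 1 1 (-x) (by simp), ?_⟩
    rw [← toSphere_one, homography_smul _ (by simp)]
    simp [toSphere]

/-! ### Holomorphic germs with values in the sphere -/

/-- `f` is holomorphic at `z`, as a map to the sphere. -/
def HolAt (f : ℂ → Sphere) (z : ℂ) : Prop :=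
  ∃ F : ℂ → ℂ, AnalyticAt ℂ F z ∧
    ((∀ᶠ w in 𝓝 z, f w = (F w : Sphere)) ∨
     (∀ᶠ w in 𝓝 z, f w = if F w = 0 then ∞ else (((F w)⁻¹ : ℂ) : Sphere)))

theorem HolAt.congr {f g : ℂ → Sphere} {z : ℂ} (hf : HolAt f z) (h : ∀ᶠ w in 𝓝 z, g w = f w) :
    HolAt g z := by
  obtain ⟨F, hF, h1 | h1⟩ := hf
  · exact ⟨F, hF, Or.inl (by filter_upwards [h, h1] with w h h1 using h.trans h1)⟩
  · exact ⟨F, hF, Or.inr (by filter_upwards [h, h1] with w h h1 using h.trans h1)⟩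

theorem holAt_coe {F : ℂ → ℂ} {z : ℂ} (hF : AnalyticAt ℂ F z) :
    HolAt (fun w => (F w : Sphere)) z := ⟨F, hF, Or.inl (Eventually.of_forall fun _ => rfl)⟩

/-- One of the two coordinates is the constant `1`, which is why they have no common zero even away
from `z`. Homogeneous coordinates avoid a case split on whether the value is infinite. -/
theorem HolAt.exists_toSphere {f : ℂ → Sphere} {z : ℂ} (hf : HolAt f z) :
    ∃ A B : ℂ → ℂ, AnalyticAt ℂ A z ∧ AnalyticAt ℂ B z ∧ (∀ w, A w ≠ 0 ∨ B w ≠ 0) ∧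
      ∀ᶠ w in 𝓝 z, f w = toSphere (A w) (B w) := by
  obtain ⟨F, hF, h | h⟩ := hf
  · exact ⟨F, fun _ => 1, hF, analyticAt_const, fun _ => by simp, by simpa [toSphere_one] using h⟩
  · exact ⟨fun _ => 1, F, analyticAt_const, hF, fun _ => by simp,
      by simpa [toSphere_one_left] using h⟩

theorem holAt_toSphere {A B : ℂ → ℂ} {z : ℂ} (hA : AnalyticAt ℂ A z) (hB : AnalyticAt ℂ B z)
    (h : A z ≠ 0 ∨ B z ≠ 0) : HolAt (fun w => toSphere (A w) (B w)) z := by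
  by_cases hBz : B z = 0
  · have hAz : A z ≠ 0 := by tauto
    refine ⟨fun w => B w / A w, hB.fun_div hA hAz, Or.inr ?_⟩
    filter_upwards [hA.continuousAt.eventually_ne hAz] with w hw
    by_cases hb : B w = 0 <;> simp [toSphere, hb, hw]
  · refine ⟨fun w => A w / B w, hA.fun_div hB hBz, Or.inl ?_⟩
    filter_upwards [hB.continuousAt.eventually_ne hBz] with w hw
    simp [toSphere, hw]

theorem HolAt.smul {f : ℂ → Sphere} {z : ℂ} (hf : HolAt f z) (h : GL (Fin 2) ℂ) :
    HolAt (fun w => h • f w) z := by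
  obtain ⟨A, B, hA, hB, hne, he⟩ := hf.exists_toSphere
  have := holAt_toSphere (A := fun w => h 0 0 * A w + h 0 1 * B w)
    (B := fun w => h 1 0 * A w + h 1 1 * B w) (z := z) (by fun_prop) (by fun_prop)
    (gl_ne_zero h (hne z))
  refine this.congr ?_
  filter_upwards [he] with w hw
  rw [hw, smul_toSphere h (hne w)]

theorem HolAt.comp {f : ℂ → Sphere} {g : ℂ → ℂ} {z : ℂ} (hf : HolAt f (g z))
    (hg : AnalyticAt ℂ g z) : HolAt (fun w => f (g w)) z := by
  obtain ⟨F, hF, h | h⟩ := hf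
  · exact ⟨F ∘ g, hF.comp hg, Or.inl (hg.continuousAt.eventually h)⟩
  · exact ⟨F ∘ g, hF.comp hg, Or.inr (hg.continuousAt.eventually h)⟩

theorem HolAt.exists_coe {f : ℂ → Sphere} {z : ℂ} (hf : HolAt f z) (hz : f z ≠ ∞) :
    ∃ F : ℂ → ℂ, AnalyticAt ℂ F z ∧ ∀ᶠ w in 𝓝 z, f w = (F w : Sphere) := by
  obtain ⟨F, hF, h | h⟩ := hf
  · exact ⟨F, hF, h⟩
  · have h0 : F z ≠ 0 := by
      intro h0
      exact hz (by simpa [h0] using h.self_of_nhds)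
    refine ⟨fun w => (F w)⁻¹, hF.fun_inv h0, ?_⟩
    filter_upwards [h, hF.continuousAt.eventually_ne h0] with w hw hw0
    simpa [hw0] using hw

theorem HolAt.exists_inv {f : ℂ → Sphere} {z : ℂ} (hf : HolAt f z) (hz : f z = ∞) :
    ∃ F : ℂ → ℂ, AnalyticAt ℂ F z ∧ F z = 0 ∧
      ∀ᶠ w in 𝓝 z, f w = if F w = 0 then ∞ else (((F w)⁻¹ : ℂ) : Sphere) := by
  obtain ⟨F, hF, h | h⟩ := hf
  · exact absurd (h.self_of_nhds.symm.trans hz) (OnePoint.coe_ne_infty _)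
  · refine ⟨F, hF, ?_, h⟩
    by_contra h0
    have := h.self_of_nhds
    rw [if_neg h0, hz] at this
    exact OnePoint.infty_ne_coe _ this

/-- In homogeneous coordinates equality of the two maps is `A D = B C`, and the dichotomy is that of
isolated zeros. -/
theorem HolAt.eventually_eq_or_ne {f g : ℂ → Sphere} {z : ℂ} (hf : HolAt f z) (hg : HolAt g z) :
    (∀ᶠ w in 𝓝 z, f w = g w) ∨ ∀ᶠ w in 𝓝[≠] z, f w ≠ g w := by
  obtain ⟨A, B, hA, hB, hne, he⟩ := hf.exists_toSphere
  obtain ⟨C, D, hC, hD, hne', he'⟩ := hg.exists_toSphere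
  rcases (hA.fun_mul hD).eventually_eq_or_eventually_ne (hB.fun_mul hC) with h | h
  · left
    filter_upwards [h, he, he'] with w h h1 h2
    rw [h1, h2, toSphere_eq_iff (hne w) (hne' w), h]
  · right
    filter_upwards [h, he.filter_mono nhdsWithin_le_nhds, he'.filter_mono nhdsWithin_le_nhds]
      with w h h1 h2
    rwa [h1, h2, Ne, toSphere_eq_iff (hne w) (hne' w)]

theorem HolAt.eq_of_frequently {f g : ℂ → Sphere} {z : ℂ} (hf : HolAt f z) (hg : HolAt g z)
    (h : ∃ᶠ w in 𝓝[≠] z, f w = g w) : ∀ᶠ w in 𝓝 z, f w = g w :=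
  (hf.eventually_eq_or_ne hg).resolve_right fun h' => h (h'.mono fun _ hw => hw)

/-- Identity theorem for holomorphic maps to the sphere. -/
theorem eq_of_eventually_eq {f g : ℂ → Sphere} (hf : ∀ z, HolAt f z) (hg : ∀ z, HolAt g z)
    {z₀ : ℂ} (h : ∃ᶠ w in 𝓝[≠] z₀, f w = g w) : f = g := by
  have hcl : IsClopen {z | ∀ᶠ w in 𝓝 z, f w = g w} := by
    constructor
    · rw [← isOpen_compl_iff, isOpen_iff_mem_nhds]
      intro z hz
      have h1 := ((hf z).eventually_eq_or_ne (hg z)).resolve_left hz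
      rw [eventually_nhdsWithin_iff] at h1
      filter_upwards [h1.eventually_nhds] with w hw
      by_cases hwz : w = z
      · exact hwz ▸ hz
      · intro h2
        exact hw.self_of_nhds hwz h2.self_of_nhds
    · rw [isOpen_iff_mem_nhds]
      intro z hz
      exact Filter.Eventually.eventually_nhds hz
  have h0 := (hf z₀).eq_of_frequently (hg z₀) h
  have := hcl.eq_univ ⟨z₀, h0⟩
  funext z
  have hz : z ∈ {z | ∀ᶠ w in 𝓝 z, f w = g w} := this ▸ Set.mem_univ z
  exact (show ∀ᶠ w in 𝓝 z, f w = g w from hz).self_of_nhds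

theorem eventually_ne_of_ne {f : ℂ → Sphere} (hf : ∀ z, HolAt f z) (hne : ∃ z w, f z ≠ f w)
    (z : ℂ) (c : Sphere) : ∀ᶠ w in 𝓝[≠] z, f w ≠ c := by
  by_contra hc
  have hcst : ∀ z, HolAt (fun _ => c) z := by
    intro z
    obtain ⟨a, b, hab, rfl⟩ := exists_toSphere c
    exact holAt_toSphere analyticAt_const analyticAt_const hab
  have := eq_of_eventually_eq hf hcst (z₀ := z) (by
    rw [Filter.Frequently]; simpa using hc)
  obtain ⟨z, w, h⟩ := hne
  exact h (by simp [this])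

/-- A value taken along a convergent sequence is taken at the limit. -/
theorem HolAt.eq_of_tendsto {f : ℂ → Sphere} {z : ℂ} (hf : HolAt f z) {c : Sphere} {u : ℕ → ℂ}
    (hu : Tendsto u atTop (𝓝 z)) (h : ∀ n, f (u n) = c) : f z = c := by
  obtain ⟨A, B, hA, hB, hne, he⟩ := hf.exists_toSphere
  obtain ⟨a, b, hab, rfl⟩ := DGroupoid.exists_toSphere c
  rw [he.self_of_nhds, toSphere_eq_iff (hne z) hab]
  have h1 : Tendsto (fun n => A (u n) * b - B (u n) * a) atTop (𝓝 (A z * b - B z * a)) :=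
    ((hA.continuousAt.tendsto.comp hu).mul_const b).sub
      ((hB.continuousAt.tendsto.comp hu).mul_const a)
  have h2 : ∀ᶠ n in atTop, A (u n) * b - B (u n) * a = 0 := by
    filter_upwards [hu.eventually he] with n hn
    have := h n
    rw [hn, toSphere_eq_iff (hne _) hab] at this
    rw [this, sub_self]
  exact sub_eq_zero.1 (tendsto_nhds_unique h1 (tendsto_const_nhds.congr' (h2.mono fun n hn => hn.symm)))


/-! ### Rational maps in homogeneous coordinates -/

/-- The homogenization of degree `d` of a polynomial. -/
def homog (P : Polynomial ℂ) (d : ℕ) (a b : ℂ) : ℂ :=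
  ∑ i ∈ Finset.range (d + 1), P.coeff i * a ^ i * b ^ (d - i)

theorem homog_of_ne {P : Polynomial ℂ} {d : ℕ} (hd : P.natDegree ≤ d) (a : ℂ) {b : ℂ}
    (hb : b ≠ 0) : homog P d a b = b ^ d * P.eval (a / b) := by
  rw [Polynomial.eval_eq_sum_range' (n := d + 1) (by omega), Finset.mul_sum]
  refine Finset.sum_congr rfl fun i hi => ?_
  have hi' : i ≤ d := by simpa [Nat.lt_succ_iff] using hi
  rw [← Nat.sub_add_cancel hi', pow_add, Nat.add_sub_cancel, div_pow]
  field_simp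

theorem homog_one {P : Polynomial ℂ} {d : ℕ} (hd : P.natDegree ≤ d) (a : ℂ) :
    homog P d a 1 = P.eval a := by
  simpa using homog_of_ne hd a one_ne_zero

theorem homog_zero (P : Polynomial ℂ) (d : ℕ) (a : ℂ) : homog P d a 0 = P.coeff d * a ^ d := by
  unfold homog
  rw [Finset.sum_range_succ, Finset.sum_eq_zero, zero_add, Nat.sub_self, pow_zero, mul_one]
  intro i hi
  have : d - i ≠ 0 := by have := Finset.mem_range.1 hi; omega
  simp [this]

theorem analyticAt_homog (P : Polynomial ℂ) (d : ℕ) {A B : ℂ → ℂ} {z : ℂ} (hA : AnalyticAt ℂ A z)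
    (hB : AnalyticAt ℂ B z) : AnalyticAt ℂ (fun w => homog P d (A w) (B w)) z := by
  unfold homog
  exact Finset.analyticAt_fun_sum _ fun i _ => by fun_prop

theorem continuous_homog (P : Polynomial ℂ) (d : ℕ) {A B : ℂ → ℂ} (hA : Continuous A)
    (hB : Continuous B) : Continuous (fun w => homog P d (A w) (B w)) := by
  unfold homog
  fun_prop

theorem natDegree_num_le (R : RatFunc ℂ) : R.num.natDegree ≤ degree R := le_max_left _ _

theorem natDegree_denom_le (R : RatFunc ℂ) : R.denom.natDegree ≤ degree R := le_max_right _ _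

/-- At infinity the coefficient of degree `degree R` survives in the numerator or the denominator;
at finite points the two are coprime. -/
theorem homog_ne_zero (R : RatFunc ℂ) {a b : ℂ} (hab : a ≠ 0 ∨ b ≠ 0) :
    homog R.num (degree R) a b ≠ 0 ∨ homog R.denom (degree R) a b ≠ 0 := by
  by_cases hb : b = 0
  · have ha : a ≠ 0 := by tauto
    rw [hb, homog_zero, homog_zero]
    rcases le_total R.num.natDegree R.denom.natDegree with h | h
    · right
      rw [degree, max_eq_right h]
      exact mul_ne_zero (Polynomial.leadingCoeff_ne_zero.2 R.denom_ne_zero) (pow_ne_zero _ ha)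
    · rcases eq_or_ne R.num 0 with h0 | h0
      · right
        have : R.denom.natDegree = 0 := by simpa [h0] using h
        rw [degree, h0, Polynomial.natDegree_zero, this, max_self]
        have := Polynomial.leadingCoeff_ne_zero.2 R.denom_ne_zero
        rw [Polynomial.leadingCoeff, ‹R.denom.natDegree = 0›] at this
        simpa using this
      · left
        rw [degree, max_eq_left h]
        exact mul_ne_zero (Polynomial.leadingCoeff_ne_zero.2 h0) (pow_ne_zero _ ha)
  · rw [homog_of_ne (natDegree_num_le R) a hb, homog_of_ne (natDegree_denom_le R) a hb]
    by_contra! hc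
    obtain ⟨u, v, huv⟩ := R.isCoprime_num_denom
    have h1 : R.num.eval (a / b) = 0 := by simpa [hb] using hc.1
    have h2 : R.denom.eval (a / b) = 0 := by simpa [hb] using hc.2
    have := congrArg (Polynomial.eval (a / b)) huv
    simp [h1, h2] at this

theorem val_eq (R : RatFunc ℂ) (x : ℂ) : val R x = R.num.eval x / R.denom.eval x := by
  simp [val, RatFunc.eval, Polynomial.eval₂_id]

theorem ratMap_coe (R : RatFunc ℂ) (x : ℂ) :
    ratMap R (x : Sphere) = if R.denom.eval x = 0 then ∞ else ((val R x : ℂ) : Sphere) := rfl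

theorem ratMap_infty (R : RatFunc ℂ) :
    ratMap R ∞ = if R.denom.natDegree < R.num.natDegree then ∞
      else ((R.num.coeff R.denom.natDegree / R.denom.coeff R.denom.natDegree : ℂ) : Sphere) := rfl

theorem ratMap_coe_of_regularAt {R : RatFunc ℂ} {x : ℂ} (h : RegularAt R x) :
    ratMap R (x : Sphere) = ((val R x : ℂ) : Sphere) := by
  rw [ratMap_coe, if_neg h]

theorem ratMap_toSphere (R : RatFunc ℂ) {a b : ℂ} (hab : a ≠ 0 ∨ b ≠ 0) :
    ratMap R (toSphere a b) =
      toSphere (homog R.num (degree R) a b) (homog R.denom (degree R) a b) := by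
  by_cases hb : b = 0
  · have ha : a ≠ 0 := by tauto
    subst hb
    rw [homog_zero, homog_zero, toSphere_zero, ratMap_infty]
    by_cases h : R.denom.natDegree < R.num.natDegree
    · rw [if_pos h, Polynomial.coeff_eq_zero_of_natDegree_lt (p := R.denom)
        (lt_of_lt_of_le h (natDegree_num_le R)), zero_mul, toSphere_zero]
    · rw [if_neg h, degree, max_eq_right (not_lt.1 h), toSphere_of_ne, mul_div_mul_right]
      · exact pow_ne_zero _ ha
      · exact mul_ne_zero (Polynomial.leadingCoeff_ne_zero.2 R.denom_ne_zero) (pow_ne_zero _ ha)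
  · rw [homog_of_ne (natDegree_num_le R) a hb, homog_of_ne (natDegree_denom_le R) a hb,
      toSphere_mul (pow_ne_zero _ hb), toSphere_of_ne hb, ratMap_coe, val_eq, toSphere]

theorem HolAt.ratMap {f : ℂ → Sphere} {z : ℂ} (hf : HolAt f z) (R : RatFunc ℂ) :
    HolAt (fun w => ratMap R (f w)) z := by
  obtain ⟨A, B, hA, hB, hne, he⟩ := hf.exists_toSphere
  refine (holAt_toSphere (analyticAt_homog R.num (degree R) hA hB)
    (analyticAt_homog R.denom (degree R) hA hB) (homog_ne_zero R (hne z))).congr ?_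
  filter_upwards [he] with w hw
  rw [hw, ratMap_toSphere R (hne w)]

/-- A pair of polynomials without common zero on the sphere defines a rational map. -/
theorem exists_ratFunc {p q : Polynomial ℂ} {d : ℕ} (hp : p.natDegree ≤ d) (hq : q.natDegree ≤ d)
    (hq0 : q ≠ 0) (hne : ∀ a b : ℂ, (a ≠ 0 ∨ b ≠ 0) → homog p d a b ≠ 0 ∨ homog q d a b ≠ 0) :
    ∃ S : RatFunc ℂ, degree S = d ∧ ∀ a b : ℂ, (a ≠ 0 ∨ b ≠ 0) →
      ratMap S (toSphere a b) = toSphere (homog p d a b) (homog q d a b) := by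
  set S : RatFunc ℂ := algebraMap _ _ p / algebraMap _ _ q with hS
  have hcop : IsCoprime p q := by
    rw [Polynomial.isCoprime_iff_aeval_ne_zero_of_isAlgClosed ℂ ℂ]
    intro x
    simpa [homog_one hp, homog_one hq] using hne x 1 (by simp)
  -- As `p` and `q` are coprime, the reduced fraction differs from `p / q` only by the constant
  -- making its denominator monic.
  obtain ⟨c, hc0, hnum, hden⟩ : ∃ c : ℂ, c ≠ 0 ∧ S.num = Polynomial.C c * p ∧
      S.denom = Polynomial.C c * q := by
    have e : S.num * q = p * S.denom := (RatFunc.num_mul_eq_mul_denom_iff hq0).2 hS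
    have h1 : S.denom ∣ q := RatFunc.denom_div_dvd p q
    have h2 : q ∣ S.denom := hcop.symm.dvd_of_dvd_mul_left (Dvd.intro_left _ e)
    obtain ⟨u, hu⟩ := associated_of_dvd_dvd h2 h1
    obtain ⟨c, hc, hcu⟩ := Polynomial.isUnit_iff.1 u.isUnit
    refine ⟨c, hc.ne_zero, ?_, ?_⟩
    · apply mul_right_cancel₀ hq0
      rw [e, ← hu, hcu]
      ring
    · rw [← hu, hcu, mul_comm]
  have hdeg : degree S = d := by
    rw [degree, hnum, hden, Polynomial.natDegree_C_mul hc0, Polynomial.natDegree_C_mul hc0]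
    refine le_antisymm (max_le hp hq) ?_
    rcases hne 1 0 (by simp) with h | h <;> rw [homog_zero] at h
    · exact (Polynomial.le_natDegree_of_ne_zero (left_ne_zero_of_mul h)).trans (le_max_left _ _)
    · exact (Polynomial.le_natDegree_of_ne_zero (left_ne_zero_of_mul h)).trans (le_max_right _ _)
  have hh : ∀ (r : Polynomial ℂ) (a b : ℂ), homog (Polynomial.C c * r) d a b = c * homog r d a b := by
    intro r a b
    simp [homog, Finset.mul_sum, mul_assoc]
  refine ⟨S, hdeg, fun a b hab => ?_⟩
  rw [ratMap_toSphere S hab, hdeg, hnum, hden, hh, hh, toSphere_mul hc0]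

/-- `p (α X + β, γ X + δ)` for the homogenization of degree `d` of `p`. -/
theorem exists_homog_comp (P : Polynomial ℂ) (d : ℕ) (α β γ δ : ℂ) :
    ∃ p : Polynomial ℂ, p.natDegree ≤ d ∧
      ∀ a b : ℂ, homog p d a b = homog P d (α * a + β * b) (γ * a + δ * b) := by
  set p : Polynomial ℂ := ∑ i ∈ Finset.range (d + 1), Polynomial.C (P.coeff i) *
    (Polynomial.C α * Polynomial.X + Polynomial.C β) ^ i *
    (Polynomial.C γ * Polynomial.X + Polynomial.C δ) ^ (d - i) with hp
  have hpd : p.natDegree ≤ d := by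
    refine Polynomial.natDegree_sum_le_of_forall_le _ _ fun i hi => ?_
    have hi' : i ≤ d := by simpa [Nat.lt_succ_iff] using hi
    have h1 : ∀ (u v : ℂ) (n : ℕ),
        ((Polynomial.C u * Polynomial.X + Polynomial.C v) ^ n).natDegree ≤ n := fun u v n => by
      refine Polynomial.natDegree_pow_le.trans ?_
      have : (Polynomial.C u * Polynomial.X + Polynomial.C v).natDegree ≤ 1 :=
        Polynomial.natDegree_linear_le
      nlinarith
    rw [mul_assoc]
    refine Polynomial.natDegree_C_mul_le _ _ |>.trans (Polynomial.natDegree_mul_le.trans ?_)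
    have := h1 α β i
    have := h1 γ δ (d - i)
    omega
  refine ⟨p, hpd, fun a b => ?_⟩
  have key : ∀ b ∈ ({0}ᶜ : Set ℂ),
      homog p d a b = homog P d (α * a + β * b) (γ * a + δ * b) := by
    intro b hb
    have hb : b ≠ 0 := hb
    rw [homog_of_ne hpd a hb, hp, Polynomial.eval_finsetSum, homog, Finset.mul_sum]
    refine Finset.sum_congr rfl fun i hi => ?_
    have hi' : i ≤ d := by simpa [Nat.lt_succ_iff] using hi
    simp only [Polynomial.eval_mul, Polynomial.eval_C, Polynomial.eval_pow, Polynomial.eval_add,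
      Polynomial.eval_X]
    have e1 : α * a + β * b = b * (α * (a / b) + β) := by field_simp
    have e2 : γ * a + δ * b = b * (γ * (a / b) + δ) := by field_simp
    rw [e1, e2, mul_pow, mul_pow]
    have : b ^ d = b ^ i * b ^ (d - i) := by rw [← pow_add, Nat.add_sub_cancel' hi']
    rw [this]
    ring
  have hd : Dense ({0}ᶜ : Set ℂ) := dense_compl_singleton 0
  have := Continuous.ext_on hd (f := fun b => homog p d a b)
    (g := fun b => homog P d (α * a + β * b) (γ * a + δ * b))
    (continuous_homog _ _ (by fun_prop) (by fun_prop))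
    (continuous_homog _ _ (by fun_prop) (by fun_prop)) key
  exact congrFun this b

theorem ratMap_C (c : ℂ) (x : Sphere) : ratMap (RatFunc.C c) x = (c : Sphere) := by
  induction x using OnePoint.rec with
  | infty => rw [ratMap_infty]; simp
  | coe x => rw [ratMap_coe, val_eq]; simp

/-- Two rational fractions which take the same values at infinitely many points are equal. -/
theorem ratFunc_ext {R S : RatFunc ℂ}
    (h : {x : ℂ | ratMap R (x : Sphere) = ratMap S (x : Sphere)}.Infinite) : R = S := by
  have h1 : R.num * S.denom = S.num * R.denom := by
    refine Polynomial.eq_of_infinite_eval_eq _ _ (h.mono fun x hx => ?_)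
    have hx : ratMap R (x : Sphere) = ratMap S (x : Sphere) := hx
    rw [← toSphere_one, ratMap_toSphere R (by simp), ratMap_toSphere S (by simp),
      toSphere_eq_iff (homog_ne_zero R (by simp)) (homog_ne_zero S (by simp)),
      homog_one (natDegree_num_le R), homog_one (natDegree_denom_le R),
      homog_one (natDegree_num_le S), homog_one (natDegree_denom_le S)] at hx
    simp only [Set.mem_ofPred_eq, Polynomial.eval_mul]
    rw [hx, mul_comm]
  rw [← R.num_div_denom, ← S.num_div_denom, div_eq_div_iff]
  · rw [← map_mul, ← map_mul, h1]
  · simpa using R.denom_ne_zero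
  · simpa using S.denom_ne_zero

theorem eq_C_of_ratMap_const {R : RatFunc ℂ} {c : Sphere} (h : ∀ x, ratMap R x = c) :
    ∃ c, R = RatFunc.C c := by
  have hinf : {x : ℂ | R.denom.eval x = 0}.Finite :=
    (R.denom.roots.toFinset.finite_toSet).subset fun x hx => by
      simpa [R.denom_ne_zero] using hx
  obtain ⟨x, hx⟩ := hinf.infinite_compl.nonempty
  refine ⟨val R x, ratFunc_ext ?_⟩
  have hc : c = (val R x : ℂ) := by rw [← h x]; exact ratMap_coe_of_regularAt hx
  convert Set.infinite_univ (α := ℂ)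
  ext y
  simp [h, ratMap_C, hc]

/-- Substitute `h⁻¹` into the homogenized numerator and denominator and recombine them linearly by
`h`: the degree is kept and no common zero appears. The new denominator is nonzero because otherwise
`R` would be constant, equal to `h⁻¹ • ∞`. -/
theorem exists_conj (R : RatFunc ℂ) (hR : ¬ ∃ c, R = RatFunc.C c) (h : GL (Fin 2) ℂ) :
    ∃ S : RatFunc ℂ, degree S = degree R ∧ (¬ ∃ c, S = RatFunc.C c) ∧
      ∀ x, ratMap S (h • x) = h • ratMap R x := by
  set d := degree R
  set g := h⁻¹
  obtain ⟨p₁, hp₁, ep₁⟩ := exists_homog_comp R.num d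
    (g 0 0) (g 0 1) (g 1 0) (g 1 1)
  obtain ⟨q₁, hq₁, eq₁⟩ := exists_homog_comp R.denom d
    (g 0 0) (g 0 1) (g 1 0) (g 1 1)
  set p := Polynomial.C (h 0 0) * p₁ + Polynomial.C (h 0 1) * q₁ with hp
  set q := Polynomial.C (h 1 0) * p₁ + Polynomial.C (h 1 1) * q₁ with hq
  have hlin : ∀ (u v a b : ℂ), homog (Polynomial.C u * p₁ + Polynomial.C v * q₁) d a b =
      u * homog p₁ d a b + v * homog q₁ d a b := by
    intro u v a b
    simp only [homog, Finset.mul_sum, ← Finset.sum_add_distrib, Polynomial.coeff_add,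
      Polynomial.coeff_C_mul]
    exact Finset.sum_congr rfl fun i _ => by ring
  have hdeg : ∀ u v : ℂ, (Polynomial.C u * p₁ + Polynomial.C v * q₁).natDegree ≤ d := by
    intro u v
    exact (Polynomial.natDegree_add_le _ _).trans (max_le ((Polynomial.natDegree_C_mul_le _ _).trans hp₁)
      ((Polynomial.natDegree_C_mul_le _ _).trans hq₁))
  have key : ∀ a b : ℂ, (a ≠ 0 ∨ b ≠ 0) → (homog p d a b ≠ 0 ∨ homog q d a b ≠ 0) ∧
      h • ratMap R (g • toSphere a b) = toSphere (homog p d a b) (homog q d a b) := by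
    intro a b hab
    have h1 := gl_ne_zero g hab
    have h2 := homog_ne_zero R h1
    have h3 := gl_ne_zero h h2
    rw [smul_toSphere g hab, ratMap_toSphere R h1, smul_toSphere h h2, hp, hq, hlin, hlin, ep₁, eq₁]
    exact ⟨h3, rfl⟩
  have hq0 : q ≠ 0 := by
    intro h0
    apply hR
    refine eq_C_of_ratMap_const (c := g • ∞) fun x => ?_
    obtain ⟨a, b, hab, e⟩ := exists_toSphere (h • x)
    have := (key a b hab).2
    rw [← e, inv_smul_smul, h0] at this
    rw [eq_inv_smul_iff, this]
    simp [homog, toSphere]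
  obtain ⟨S, hS, hS'⟩ := exists_ratFunc (hdeg _ _) (hdeg _ _) hq0 fun a b hab => (key a b hab).1
  have hconj : ∀ x, ratMap S (h • x) = h • ratMap R x := by
    intro x
    obtain ⟨a, b, hab, e⟩ := exists_toSphere (h • x)
    rw [e, hS' a b hab, ← (key a b hab).2, ← e, inv_smul_smul]
  refine ⟨S, hS, ?_, hconj⟩
  rintro ⟨c, rfl⟩
  apply hR
  refine eq_C_of_ratMap_const (c := g • (c : Sphere)) fun x => ?_
  rw [eq_inv_smul_iff, ← hconj, ratMap_C]


/-! ### Local analysis in one complex variable -/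

/-- The pull-back of the connection form `m` by `f`. -/
def pull (m f : ℂ → ℂ) (z : ℂ) : ℂ := m (f z) * deriv f z + deriv (deriv f) z / deriv f z

theorem pull_congr {m f g : ℂ → ℂ} {z : ℂ} (h : f =ᶠ[𝓝 z] g) : pull m f z = pull m g z := by
  rw [pull, pull, h.eq_of_nhds, h.deriv_eq, h.deriv.deriv_eq]

/-- The chain rule for `f'' / f'`, in the form `(f ∘ g)^* m = g^* (f^* m)`. Every transport of `μ`
below rests on it. -/
theorem pull_comp {m f g : ℂ → ℂ} {z : ℂ} (hf : AnalyticAt ℂ f (g z)) (hg : AnalyticAt ℂ g z)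
    (hf' : deriv f (g z) ≠ 0) (hg' : deriv g z ≠ 0) :
    pull m (fun w => f (g w)) z = pull (pull m f) g z := by
  have h1 : deriv (fun w => f (g w)) =ᶠ[𝓝 z] fun w => deriv f (g w) * deriv g w := by
    filter_upwards [hg.continuousAt.eventually hf.eventually_analyticAt, hg.eventually_analyticAt]
      with w hw1 hw2
    exact (hw1.differentiableAt.hasDerivAt.comp w hw2.differentiableAt.hasDerivAt).deriv
  have h2 : deriv (deriv fun w => f (g w)) z =
      deriv (deriv f) (g z) * deriv g z * deriv g z + deriv f (g z) * deriv (deriv g) z := by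
    rw [h1.deriv_eq]
    exact ((hf.deriv.differentiableAt.hasDerivAt.comp z hg.differentiableAt.hasDerivAt).mul
      hg.deriv.differentiableAt.hasDerivAt).deriv
  simp only [pull, h1.eq_of_nhds, h2]
  field_simp
  ring

theorem analyticAt_pull {m f : ℂ → ℂ} {z : ℂ} (hf : AnalyticAt ℂ f z) (hm : AnalyticAt ℂ m (f z))
    (hf' : deriv f z ≠ 0) : AnalyticAt ℂ (pull m f) z :=
  ((hm.comp hf).fun_mul hf.deriv).fun_add (hf.deriv.deriv.fun_div hf.deriv hf')

theorem eventually_const_of_deriv {f : ℂ → ℂ} {z : ℂ} (h : ∀ᶠ w in 𝓝 z, HasDerivAt f 0 w) :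
    ∀ᶠ w in 𝓝 z, f w = f z := by
  obtain ⟨r, hr, hb⟩ := Metric.eventually_nhds_iff_ball.1 h
  filter_upwards [Metric.ball_mem_nhds z hr] with w hw
  refine Metric.isOpen_ball.is_const_of_deriv_eq_zero
    (convex_ball z r).isPreconnected (fun x hx => (hb x hx).differentiableAt.differentiableWithinAt)
    (fun x hx => (hb x hx).deriv) hw (Metric.mem_ball_self hr)

theorem eventuallyEq_of_punctured {f g : ℂ → ℂ} {z : ℂ} (hf : AnalyticAt ℂ f z)
    (hg : AnalyticAt ℂ g z) (h : ∀ᶠ w in 𝓝[≠] z, f w = g w) : ∀ᶠ w in 𝓝 z, f w = g w :=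
  (hf.frequently_eq_iff_eventually_eq hg).1 h.frequently

/-- Two developing maps of the same affine structure differ by an affine map. -/
theorem eq_affine_of_pull_eq {D E : ℂ → ℂ} {z : ℂ} (hD : AnalyticAt ℂ D z) (hE : AnalyticAt ℂ E z)
    (hD' : deriv D z ≠ 0) (hE' : deriv E z ≠ 0)
    (h : ∀ᶠ w in 𝓝[≠] z, pull 0 E w = pull 0 D w) :
    ∀ᶠ w in 𝓝 z, E w = E z + deriv E z / deriv D z * (D w - D z) := by
  have h0 : ∀ᶠ w in 𝓝 z, pull 0 E w = pull 0 D w :=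
    eventuallyEq_of_punctured (analyticAt_pull hE analyticAt_const hE')
      (analyticAt_pull hD analyticAt_const hD') h
  -- The hypothesis equates the logarithmic derivatives of `E'` and `D'`, so `E' / D'` is constant;
  -- a second integration gives the affine relation.
  have h1 : ∀ᶠ w in 𝓝 z, HasDerivAt (fun w => deriv E w / deriv D w) 0 w := by
    filter_upwards [h0, hD.eventually_analyticAt, hE.eventually_analyticAt,
      hD.deriv.continuousAt.eventually_ne hD', hE.deriv.continuousAt.eventually_ne hE']
      with w hw hDw hEw hD0 hE0
    refine (hEw.deriv.differentiableAt.hasDerivAt.fun_div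
      hDw.deriv.differentiableAt.hasDerivAt hD0).congr_deriv ?_
    simp only [pull, Pi.zero_apply, zero_mul, zero_add] at hw
    rw [div_eq_div_iff hE0 hD0] at hw
    rw [hw]
    ring
  have h2 : ∀ᶠ w in 𝓝 z,
      HasDerivAt (fun w => E w - deriv E z / deriv D z * D w) 0 w := by
    filter_upwards [eventually_const_of_deriv h1, hD.eventually_analyticAt,
      hE.eventually_analyticAt, hD.deriv.continuousAt.eventually_ne hD'] with w hw hDw hEw hD0
    refine (hEw.differentiableAt.hasDerivAt.fun_sub
      (hDw.differentiableAt.hasDerivAt.const_mul (deriv E z / deriv D z))).congr_deriv ?_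
    rw [← hw]
    field_simp
    ring
  filter_upwards [eventually_const_of_deriv h2] with w hw
  linear_combination hw

/-- Every holomorphic connection form has a developing map. -/
theorem exists_developing {m : ℂ → ℂ} {z : ℂ} (hm : AnalyticAt ℂ m z) :
    ∃ D : ℂ → ℂ, AnalyticAt ℂ D z ∧ D z = 0 ∧ deriv D z = 1 ∧ ∀ᶠ w in 𝓝 z, pull 0 D w = m w := by
  have prim : ∀ f : ℂ → ℂ, AnalyticAt ℂ f z →
      ∃ g, g z = 0 ∧ AnalyticAt ℂ g z ∧ ∀ᶠ w in 𝓝 z, HasDerivAt g (f w) w := by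
    intro f hf
    obtain ⟨r, hr, hb⟩ := Metric.eventually_nhds_iff_ball.1 hf.eventually_analyticAt
    have hd : DifferentiableOn ℂ f (Metric.ball z r) :=
      fun w hw => (hb w hw).differentiableAt.differentiableWithinAt
    obtain ⟨g, hg0, hg⟩ := hd.isExactOn_ball.with_val_at z 0
    refine ⟨g, hg0, ?_, ?_⟩
    · exact DifferentiableOn.analyticAt
        (fun w hw => (hg w hw).differentiableAt.differentiableWithinAt) (Metric.ball_mem_nhds z hr)
    · filter_upwards [Metric.ball_mem_nhds z hr] with w hw using hg w hw
  -- The equation `D'' / D' = m` is solved by integrating `exp M`, where `M` is a primitive of `m`.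
  obtain ⟨M, hM0, hM, hM'⟩ := prim m hm
  obtain ⟨D, hD0, hD, hD'⟩ := prim (fun w => Complex.exp (M w)) hM.cexp
  have hd : deriv D =ᶠ[𝓝 z] fun w => Complex.exp (M w) := hD'.mono fun w hw => hw.deriv
  refine ⟨D, hD, hD0, by rw [hd.eq_of_nhds, hM0, Complex.exp_zero], ?_⟩
  filter_upwards [hd.eventually_nhds, hM'] with w hw hMw
  have hw : deriv D =ᶠ[𝓝 w] fun w => Complex.exp (M w) := hw
  rw [pull, Pi.zero_apply, zero_mul, zero_add, hw.deriv_eq, hw.eq_of_nhds, hMw.cexp.deriv]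
  field_simp

/-- The principal root is taken of `g w / g z`, which equals `1` at `z`, so analyticity holds there.
The chosen root `r` fixes the branch; this later prescribes the multiplier of a lift. -/
theorem exists_root {g : ℂ → ℂ} {z r : ℂ} {n : ℕ} (hg : AnalyticAt ℂ g z) (hn : n ≠ 0)
    (hr : r ^ n = g z) (hz : g z ≠ 0) :
    ∃ u : ℂ → ℂ, AnalyticAt ℂ u z ∧ u z = r ∧ ∀ w, u w ^ n = g w := by
  refine ⟨fun w => r * (g w / g z) ^ ((n : ℂ)⁻¹), ?_, by simp [div_self hz], fun w => ?_⟩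
  · refine analyticAt_const.fun_mul (AnalyticAt.cpow (hg.fun_div analyticAt_const hz)
      analyticAt_const ?_)
    rw [div_self hz]
    exact Complex.one_mem_slitPlane
  · rw [mul_pow, Complex.cpow_nat_inv_pow _ hn, hr]
    field_simp

/-- A non-constant holomorphic germ is a power in a suitable coordinate. -/
theorem exists_normal_form {F : ℂ → ℂ} {z : ℂ} (hF : AnalyticAt ℂ F z)
    (hne : ¬ ∀ᶠ w in 𝓝 z, F w = F z) :
    ∃ (n : ℕ) (t : ℂ → ℂ), n ≠ 0 ∧ AnalyticAt ℂ t z ∧ t z = 0 ∧ deriv t z ≠ 0 ∧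
      ∀ᶠ w in 𝓝 z, F w = F z + t w ^ n := by
  obtain ⟨n, g, hg, hg0, he⟩ := (AnalyticAt.exists_eventuallyEq_pow_smul_nonzero_iff
    (hF.fun_sub (analyticAt_const (v := F z)))).2 (by simpa [sub_eq_zero] using hne)
  have hn : n ≠ 0 := by
    rintro rfl
    have := he.self_of_nhds
    simp at this
    exact hg0 this.symm
  obtain ⟨r, hr⟩ := IsAlgClosed.exists_pow_nat_eq (g z) (Nat.pos_of_ne_zero hn)
  obtain ⟨u, hu, huz, hun⟩ := exists_root hg hn hr hg0
  have hu0 : u z ≠ 0 := by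
    intro h
    apply hg0
    rw [← hun, h, zero_pow hn]
  refine ⟨n, fun w => (w - z) * u w, hn, by fun_prop, by simp, ?_, ?_⟩
  · have : HasDerivAt (fun w => (w - z) * u w) (1 * u z + (z - z) * deriv u z) z :=
      ((hasDerivAt_id z).sub_const z).mul hu.differentiableAt.hasDerivAt
    rw [this.deriv]
    simpa using hu0
  · filter_upwards [he] with w hw
    rw [mul_pow, hun, ← smul_eq_mul ((w - z) ^ n), ← hw]
    ring

theorem exists_local_inverse {t : ℂ → ℂ} {z : ℂ} (ht : AnalyticAt ℂ t z) (ht' : deriv t z ≠ 0) :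
    ∃ τ : ℂ → ℂ, AnalyticAt ℂ τ (t z) ∧ τ (t z) = z ∧ deriv τ (t z) ≠ 0 ∧
      (∀ᶠ w in 𝓝 z, τ (t w) = w) ∧ ∀ᶠ s in 𝓝 (t z), t (τ s) = s := by
  have h := ht.hasStrictDerivAt
  have hl := HasStrictFDerivAt.eventually_left_inverse (h.hasStrictFDerivAt_equiv ht')
  refine ⟨h.localInverse _ _ _ ht', ht.analyticAt_localInverse ht', ?_, ?_, hl, ?_⟩
  · exact hl.self_of_nhds
  · rw [(h.to_localInverse ht').hasDerivAt.deriv]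
    exact inv_ne_zero ht'
  · exact HasStrictFDerivAt.eventually_right_inverse (h.hasStrictFDerivAt_equiv ht')

theorem tendsto_punctured {f : ℂ → ℂ} {z : ℂ} (hf : AnalyticAt ℂ f z) (hf' : deriv f z ≠ 0) :
    Tendsto f (𝓝[≠] z) (𝓝[≠] (f z)) :=
  hf.differentiableAt.hasDerivAt.tendsto_nhdsNE hf'

/-- In a coordinate where the germ is `t ^ n`, the points `x` and `ζ x` have the same image for an
`n`-th root of unity `ζ`, so injectivity forces `n = 1`. -/
theorem deriv_ne_zero_of_injOn {F : ℂ → ℂ} {z : ℂ} (hF : AnalyticAt ℂ F z) {s : Set ℂ}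
    (hs : s ∈ 𝓝 z) (hi : Set.InjOn F s) : deriv F z ≠ 0 := by
  have hne : ¬ ∀ᶠ w in 𝓝 z, F w = F z := by
    intro h
    have h1 : ∀ᶠ w in 𝓝[≠] z, w = z := by
      filter_upwards [(h.and hs).filter_mono nhdsWithin_le_nhds] with w hw
      exact hi hw.2 (mem_of_mem_nhds hs) hw.1
    obtain ⟨w, hw1, hw2⟩ := (h1.and self_mem_nhdsWithin).exists
    exact hw2 hw1
  obtain ⟨n, t, hn, ht, htz, ht', he⟩ := exists_normal_form hF hne
  obtain ⟨τ, hτ, hτz, hτ', hl, hr⟩ := exists_local_inverse ht ht'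
  rw [htz] at hτ hτz hτ' hr
  have hn1 : n = 1 := by
    by_contra hn1
    have hprim := Complex.isPrimitiveRoot_exp n hn
    set ζ := Complex.exp (2 * Real.pi * Complex.I / n)
    have hζ : ζ ≠ 1 := hprim.ne_one (by omega)
    have hg : ∀ᶠ x in 𝓝 (0 : ℂ), τ x ∈ s ∧ t (τ x) = x ∧ F (τ x) = F z + t (τ x) ^ n := by
      have hc : Tendsto τ (𝓝 0) (𝓝 z) := by simpa [hτz] using hτ.continuousAt.tendsto
      filter_upwards [hc.eventually hs, hr, hc.eventually he] with x h1 h2 h3 using ⟨h1, h2, h3⟩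
    have hg' : ∀ᶠ x in 𝓝 (0 : ℂ),
        τ (ζ * x) ∈ s ∧ t (τ (ζ * x)) = ζ * x ∧ F (τ (ζ * x)) = F z + t (τ (ζ * x)) ^ n := by
      have hc : Tendsto (fun x : ℂ => ζ * x) (𝓝 0) (𝓝 0) := by
        have : Continuous fun x : ℂ => ζ * x := by fun_prop
        simpa using this.tendsto 0
      exact hc.eventually hg
    obtain ⟨x, ⟨h1, h2⟩, hx⟩ := (((hg.and hg').filter_mono nhdsWithin_le_nhds).and
      (self_mem_nhdsWithin : {0}ᶜ ∈ 𝓝[≠] (0 : ℂ))).exists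
    have hx : x ≠ 0 := hx
    have h3 : τ x = τ (ζ * x) := hi h1.1 h2.1 (by
      rw [h1.2.2, h2.2.2, h1.2.1, h2.2.1, mul_pow, hprim.pow_eq_one, one_mul])
    have h4 : x = ζ * x := by
      have := congrArg t h3
      rwa [h1.2.1, h2.2.1] at this
    exact hζ (mul_right_cancel₀ hx (by rw [one_mul]; exact h4.symm))
  subst hn1
  have he : F =ᶠ[𝓝 z] fun w => F z + t w ^ 1 := he
  rw [he.deriv_eq]
  simpa using ht'

theorem nhds_le_map {F : ℂ → ℂ} {z : ℂ} (hF : AnalyticAt ℂ F z)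
    (hne : ¬ ∀ᶠ w in 𝓝 z, F w = F z) : 𝓝 (F z) ≤ map F (𝓝 z) :=
  hF.eventually_constant_or_nhds_le_map_nhds.resolve_left hne

theorem eventually_deriv_ne_zero {F : ℂ → ℂ} {z : ℂ} (hF : AnalyticAt ℂ F z)
    (hne : ¬ ∀ᶠ w in 𝓝 z, F w = F z) : ∀ᶠ w in 𝓝[≠] z, deriv F w ≠ 0 := by
  refine hF.deriv.eventually_eq_zero_or_eventually_ne_zero.resolve_left fun h => hne ?_
  refine eventually_const_of_deriv ?_
  filter_upwards [h, hF.eventually_analyticAt] with w hw hFw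
  exact hw ▸ hFw.differentiableAt.hasDerivAt

/-- A holomorphic germ which is constant on the fibres of `p` factors through `p`. -/
theorem exists_local_factor {p b : ℂ → ℂ} {z : ℂ} (hp : AnalyticAt ℂ p z) (hb : AnalyticAt ℂ b z)
    (hne : ¬ ∀ᶠ w in 𝓝 z, p w = p z)
    {U : Set ℂ} (hU : U ∈ 𝓝 z) (hfib : ∀ x ∈ U, ∀ y ∈ U, p x = p y → b x = b y) :
    ∃ B : ℂ → ℂ, AnalyticAt ℂ B (p z) ∧ ∀ᶠ w in 𝓝 z, b w = B (p w) := by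
  have hgood : ∀ᶠ w in 𝓝 z, w ∈ U ∧ AnalyticAt ℂ p w ∧ AnalyticAt ℂ b w ∧
      (w ≠ z → deriv p w ≠ 0) := by
    filter_upwards [hU, hp.eventually_analyticAt, hb.eventually_analyticAt,
      eventually_nhdsWithin_iff.1 (eventually_deriv_ne_zero hp hne)] with w h1 h2 h3 h4
    exact ⟨h1, h2, h3, h4⟩
  obtain ⟨r, hr, hgood⟩ := Metric.eventually_nhds_iff_ball.1 hgood
  set V := Metric.ball z r with hV
  have hVz : V ∈ 𝓝 z := Metric.ball_mem_nhds z hr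
  have hzV : z ∈ V := Metric.mem_ball_self hr
  classical
  set B : ℂ → ℂ := fun x => if h : ∃ w ∈ V, p w = x then b h.choose else 0 with hB
  have hBp : ∀ w ∈ V, B (p w) = b w := by
    intro w hw
    have h : ∃ w' ∈ V, p w' = p w := ⟨w, hw, rfl⟩
    rw [hB]
    simp only [dif_pos h]
    exact hfib _ (hgood _ h.choose_spec.1).1 _ (hgood _ hw).1 h.choose_spec.2
  have himg : ∀ N ∈ 𝓝 z, p '' N ∈ 𝓝 (p z) := fun N hN => nhds_le_map hp hne (image_mem_map hN)
  -- Away from the possible critical value, a local inverse of `p` makes `B` differentiable. At `p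
  -- z` openness of `p` gives continuity, and the singularity is removable.
  refine ⟨B, ?_, ?_⟩
  · refine Complex.analyticAt_of_differentiable_on_punctured_nhds_of_continuousAt ?_ ?_
    · rw [eventually_nhdsWithin_iff]
      filter_upwards [himg V hVz]
      rintro _ ⟨w, hw, rfl⟩ hwz
      have hwz : w ≠ z := fun h => hwz (by rw [h]; rfl)
      obtain ⟨-, hpw, hbw, hdw⟩ := hgood w hw
      obtain ⟨τ, hτ, hτw, -, -, hr⟩ := exists_local_inverse hpw (hdw hwz)
      have : B =ᶠ[𝓝 (p w)] fun x => b (τ x) := by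
        have hc : Tendsto τ (𝓝 (p w)) (𝓝 w) := by simpa [hτw] using hτ.continuousAt.tendsto
        filter_upwards [hr, hc.eventually (Metric.isOpen_ball.mem_nhds hw)] with x h1 h2
        rw [← hBp _ h2, h1]
      refine DifferentiableAt.congr_of_eventuallyEq ?_ this
      refine DifferentiableAt.comp (p w) ?_ hτ.differentiableAt
      rw [hτw]
      exact hbw.differentiableAt
    · intro N hN
      rw [hBp z hzV] at hN
      have hN' : b ⁻¹' N ∩ V ∈ 𝓝 z := inter_mem (hb.continuousAt hN) hVz
      change B ⁻¹' N ∈ 𝓝 (p z)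
      filter_upwards [himg _ hN']
      rintro _ ⟨w, hw, rfl⟩
      rw [Set.mem_preimage, hBp w hw.2]
      exact hw.1
  · filter_upwards [hVz] with w hw
    rw [hBp w hw]

/-- A function which agrees with a holomorphic germ in a punctured neighbourhood of every point
extends to an entire function. -/
theorem exists_entire_extension {g : ℂ → ℂ}
    (h : ∀ z, ∃ F : ℂ → ℂ, AnalyticAt ℂ F z ∧ ∀ᶠ w in 𝓝[≠] z, g w = F w) :
    ∃ G : ℂ → ℂ, Differentiable ℂ G ∧ (∀ z, ContinuousAt g z → G z = g z) ∧
      ∀ z, ∀ᶠ w in 𝓝[≠] z, G w = g w := by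
  choose F hF hgF using h
  have huniq : ∀ z (f : ℂ → ℂ), ContinuousAt f z → (∀ᶠ w in 𝓝[≠] z, g w = f w) → F z z = f z := by
    intro z f hf hgf
    refine tendsto_nhds_unique_of_eventuallyEq (l := 𝓝[≠] z)
      ((hF z).continuousAt.tendsto.mono_left nhdsWithin_le_nhds)
      (hf.tendsto.mono_left nhdsWithin_le_nhds) ?_
    filter_upwards [hgF z, hgf] with w h1 h2
    rw [← h1, h2]
  have hcont : ∀ z, ContinuousAt g z → F z z = g z :=
    fun z hz => huniq z g hz (Eventually.of_forall fun _ => rfl)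
  have hloc : ∀ z, ∀ᶠ w in 𝓝 z, F w w = F z w := by
    intro z
    have h1 := eventually_nhdsWithin_iff.1 (hgF z)
    filter_upwards [h1.eventually_nhds, (hF z).eventually_analyticAt] with w hw hFw
    refine huniq w (F z) hFw.continuousAt ?_
    by_cases hwz : w = z
    · subst hwz
      exact hgF w
    · have : ∀ᶠ x in 𝓝 w, x ≠ z := isOpen_ne.mem_nhds hwz
      filter_upwards [(hw.and this).filter_mono nhdsWithin_le_nhds] with x hx
      exact hx.1 hx.2
  refine ⟨fun z => F z z, fun z => ?_, hcont, fun z => ?_⟩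
  · exact ((hF z).congr ((hloc z).mono fun w hw => hw.symm)).differentiableAt
  · filter_upwards [(hloc z).filter_mono nhdsWithin_le_nhds, hgF z] with w h1 h2
    rw [h1, h2]


/-! ### Values of rational fractions -/

theorem analyticAt_val {R : RatFunc ℂ} {x : ℂ} (h : RegularAt R x) : AnalyticAt ℂ (val R) x := by
  have : val R = fun x => R.num.eval x / R.denom.eval x := funext (val_eq R)
  rw [this]
  exact (R.num.differentiable.analyticAt x).fun_div (R.denom.differentiable.analyticAt x) h

theorem finite_eval_eq_zero {P : Polynomial ℂ} (h : P ≠ 0) : {x | P.eval x = 0}.Finite :=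
  (P.roots.toFinset.finite_toSet).subset fun x hx => by
    simpa [h] using hx

theorem regularAt_cofinite (R : RatFunc ℂ) : ∀ᶠ x in cofinite, RegularAt R x := by
  rw [eventually_cofinite]
  simpa [RegularAt] using finite_eval_eq_zero R.denom_ne_zero

theorem RegularAt.eventually {R : RatFunc ℂ} {x : ℂ} (h : RegularAt R x) :
    ∀ᶠ y in 𝓝 x, RegularAt R y :=
  (Polynomial.continuous R.denom).continuousAt.eventually_ne h

theorem num_ne_C_mul_denom {R : RatFunc ℂ} (hR : ¬ ∃ c, R = RatFunc.C c) (c : ℂ) :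
    R.num - Polynomial.C c * R.denom ≠ 0 := by
  intro h
  apply hR
  refine ⟨c, ?_⟩
  rw [← R.num_div_denom, sub_eq_zero.1 h, map_mul, mul_div_assoc, div_self, mul_one]
  · rfl
  · simpa using R.denom_ne_zero

theorem val_ne_cofinite {R : RatFunc ℂ} (hR : ¬ ∃ c, R = RatFunc.C c) (c : ℂ) :
    ∀ᶠ x in cofinite, val R x ≠ c := by
  have h := eventually_cofinite.2 (by
    simpa using finite_eval_eq_zero (num_ne_C_mul_denom hR c) :
    {x | ¬ (R.num - Polynomial.C c * R.denom).eval x ≠ 0}.Finite)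
  filter_upwards [regularAt_cofinite R, h] with x hx h1 h2
  apply h1
  rw [val_eq, div_eq_iff hx] at h2
  simp [h2]

theorem deriv_val {R : RatFunc ℂ} {x : ℂ} (h : RegularAt R x) :
    deriv (val R) x = (R.num.derivative.eval x * R.denom.eval x -
      R.num.eval x * R.denom.derivative.eval x) / R.denom.eval x ^ 2 := by
  have : val R = fun x => R.num.eval x / R.denom.eval x := funext (val_eq R)
  rw [this]
  exact ((R.num.hasDerivAt x).fun_div (R.denom.hasDerivAt x) h).deriv

/-- Up to sign the numerator of the derivative is the Wronskian of numerator and denominator; for a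
coprime pair it vanishes only if both are constant. -/
theorem deriv_val_ne_cofinite {R : RatFunc ℂ} (hR : ¬ ∃ c, R = RatFunc.C c) :
    ∀ᶠ x in cofinite, deriv (val R) x ≠ 0 := by
  have hw : Polynomial.wronskian R.num R.denom ≠ 0 := by
    intro h
    obtain ⟨h1, h2⟩ := R.isCoprime_num_denom.wronskian_eq_zero_iff.1 h
    have e1 := Polynomial.eq_C_of_derivative_eq_zero h1
    have e2 := Polynomial.eq_C_of_derivative_eq_zero h2
    apply hR
    refine ⟨R.num.coeff 0 / R.denom.coeff 0, ?_⟩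
    rw [map_div₀, ← R.num_div_denom]
    conv_lhs => rw [e1, e2]
    simp [RatFunc.algebraMap_C]
  have h := eventually_cofinite.2 (by
    simpa using finite_eval_eq_zero hw :
    {x | ¬ (Polynomial.wronskian R.num R.denom).eval x ≠ 0}.Finite)
  filter_upwards [regularAt_cofinite R, h] with x hx h1 h2
  apply h1
  rw [deriv_val hx, div_eq_zero_iff, or_iff_left (pow_ne_zero _ hx)] at h2
  simp only [Polynomial.wronskian, Polynomial.eval_sub, Polynomial.eval_mul]
  linear_combination -h2

theorem val_comp_cofinite {R : RatFunc ℂ} (hR : ¬ ∃ c, R = RatFunc.C c) {p : ℂ → Prop}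
    (hp : ∀ᶠ y in cofinite, p y) : ∀ᶠ x in cofinite, p (val R x) := by
  have : ∀ c ∈ {y | ¬ p y}, ∀ᶠ x in cofinite, val R x ≠ c := fun c _ => val_ne_cofinite hR c
  have h := (eventually_all_finite (eventually_cofinite.1 hp)).2 this
  filter_upwards [h] with x hx
  by_contra hc
  exact hx _ hc rfl

/-! ### Solutions of `G₂(μ)` -/

/-- The two-jet of `R` at `x` is invertible with source and target outside the poles of `μ`. -/
def Allowed (μ R : RatFunc ℂ) (x : ℂ) : Prop :=
  RegularAt R x ∧ deriv (val R) x ≠ 0 ∧ RegularAt μ x ∧ RegularAt μ (val R x)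

theorem allowed_cofinite (μ : RatFunc ℂ) {R : RatFunc ℂ} (hR : ¬ ∃ c, R = RatFunc.C c) :
    ∀ᶠ x in cofinite, Allowed μ R x := by
  filter_upwards [regularAt_cofinite R, deriv_val_ne_cofinite hR, regularAt_cofinite μ,
    val_comp_cofinite hR (regularAt_cofinite μ)] with x h1 h2 h3 h4 using ⟨h1, h2, h3, h4⟩

theorem isSolutionG2_iff {μ R : RatFunc ℂ} : IsSolutionG2 μ R ↔ (¬ ∃ c, R = RatFunc.C c) ∧
    ∀ x, Allowed μ R x → pull (val μ) (val R) x = val μ x := by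
  refine and_congr_right fun _ => forall_congr' fun x => ?_
  constructor
  · rintro h ⟨h1, h2, h3, h4⟩
    exact sub_eq_zero.1 (h h2 h1 h3 h4).2.2
  · intro h h2 h1 h3 h4
    exact ⟨h3, h4, sub_eq_zero.2 (h ⟨h1, h2, h3, h4⟩)⟩

theorem IsSolutionG2.pull_eq {μ R : RatFunc ℂ} (h : IsSolutionG2 μ R) {x : ℂ}
    (hx : Allowed μ R x) : pull (val μ) (val R) x = val μ x := (isSolutionG2_iff.1 h).2 x hx

/-- The allowed points form the complement of a finite set, which is connected, and both sides are
analytic on it. -/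
theorem isSolutionG2_of_eventually {μ R : RatFunc ℂ} (hR : ¬ ∃ c, R = RatFunc.C c) {x₀ : ℂ}
    (hx₀ : Allowed μ R x₀) (h : ∃ᶠ x in 𝓝[≠] x₀, pull (val μ) (val R) x = val μ x) :
    IsSolutionG2 μ R := by
  refine isSolutionG2_iff.2 ⟨hR, fun x hx => ?_⟩
  have hpre : IsPreconnected {x | Allowed μ R x} := by
    have := ((eventually_cofinite.1 (allowed_cofinite μ hR)).countable
      ).isPathConnected_compl_of_one_lt_rank (E := ℂ) (by simp)
    convert this.isConnected.isPreconnected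
    ext x
    simp
  have han : AnalyticOnNhd ℂ (pull (val μ) (val R)) {x | Allowed μ R x} := fun x hx =>
    analyticAt_pull (analyticAt_val hx.1) (analyticAt_val hx.2.2.2) hx.2.1
  have han' : AnalyticOnNhd ℂ (val μ) {x | Allowed μ R x} := fun x hx => analyticAt_val hx.2.2.1
  exact han.eqOn_of_preconnected_of_frequently_eq han' hpre hx₀ h hx

theorem isSolutionG2_of_cofinite {μ R : RatFunc ℂ} (hR : ¬ ∃ c, R = RatFunc.C c)
    (h : ∀ᶠ x in cofinite, pull (val μ) (val R) x = val μ x) : IsSolutionG2 μ R := by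
  obtain ⟨x₀, hx₀⟩ := (allowed_cofinite μ hR).exists
  refine isSolutionG2_of_eventually hR hx₀ (Eventually.frequently ?_)
  have h1 : {x | ¬ pull (val μ) (val R) x = val μ x}.Finite := eventually_cofinite.1 h
  have := (h1.subset (Set.sdiff_subset (t := {x₀}))).isClosed.isOpen_compl.mem_nhds
    (x := x₀) (by simp)
  filter_upwards [mem_nhdsWithin_of_mem_nhds this, self_mem_nhdsWithin] with x hx hx'
  by_contra hc
  exact hx ⟨hc, hx'⟩

/-! ### Generic values -/

theorem eval₂_eq (P : Polynomial ℂ) (x : ℂ) : P.eval₂ (RingHom.id ℂ) x = P.eval x :=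
  Polynomial.eval₂_id

theorem val_add (μ ν : RatFunc ℂ) : ∀ᶠ x in cofinite, val (μ + ν) x = val μ x + val ν x := by
  filter_upwards [regularAt_cofinite μ, regularAt_cofinite ν] with x h1 h2
  exact RatFunc.eval_add _ _ ((eval₂_eq _ x).trans_ne h1) ((eval₂_eq _ x).trans_ne h2)

theorem val_mul (μ ν : RatFunc ℂ) : ∀ᶠ x in cofinite, val (μ * ν) x = val μ x * val ν x := by
  filter_upwards [regularAt_cofinite μ, regularAt_cofinite ν] with x h1 h2
  exact RatFunc.eval_mul _ _ ((eval₂_eq _ x).trans_ne h1) ((eval₂_eq _ x).trans_ne h2)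

theorem val_C (c x : ℂ) : val (RatFunc.C c) x = c := by simp [val]

theorem val_X (x : ℂ) : val RatFunc.X x = x := by simp [val]

theorem val_inv (μ : RatFunc ℂ) : ∀ᶠ x in cofinite, val μ⁻¹ x = (val μ x)⁻¹ := by
  by_cases h : μ = 0
  · subst h
    simp [val]
  · have h1 := eventually_cofinite.2 (by
      simpa using finite_eval_eq_zero (RatFunc.num_ne_zero h) : {x | ¬ μ.num.eval x ≠ 0}.Finite)
    filter_upwards [val_mul μ μ⁻¹, regularAt_cofinite μ, h1] with x hx h2 h3
    rw [mul_inv_cancel₀ h] at hx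
    refine eq_inv_of_mul_eq_one_right ?_
    rw [← hx]
    simp [val]

theorem val_neg (μ : RatFunc ℂ) : ∀ᶠ x in cofinite, val (-μ) x = -val μ x := by
  filter_upwards [val_mul (RatFunc.C (-1)) μ] with x hx
  rw [val_C] at hx
  simpa using hx

theorem val_sub (μ ν : RatFunc ℂ) : ∀ᶠ x in cofinite, val (μ - ν) x = val μ x - val ν x := by
  filter_upwards [val_add μ (-ν), val_neg ν] with x h1 h2
  rw [sub_eq_add_neg, h1, h2, sub_eq_add_neg]

theorem val_div (μ ν : RatFunc ℂ) : ∀ᶠ x in cofinite, val (μ / ν) x = val μ x / val ν x := by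
  filter_upwards [val_mul μ ν⁻¹, val_inv ν] with x h1 h2
  rw [div_eq_mul_inv, h1, h2, div_eq_mul_inv]

theorem val_pow (μ : RatFunc ℂ) (n : ℕ) : ∀ᶠ x in cofinite, val (μ ^ n) x = val μ x ^ n := by
  induction n with
  | zero => simp [val]
  | succ n ih =>
    filter_upwards [ih, val_mul (μ ^ n) μ] with x h1 h2
    rw [pow_succ, h2, h1, pow_succ]

theorem val_one (x : ℂ) : val (1 : RatFunc ℂ) x = 1 := by simp [val]

/-- A polynomial in a rational fraction is a rational fraction. -/
theorem exists_val_eval (P : Polynomial ℂ) (R : RatFunc ℂ) :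
    ∃ ν : RatFunc ℂ, ∀ᶠ x in cofinite, val ν x = P.eval (val R x) := by
  induction P using Polynomial.induction_on' with
  | add p q hp hq =>
    obtain ⟨ν₁, h₁⟩ := hp
    obtain ⟨ν₂, h₂⟩ := hq
    refine ⟨ν₁ + ν₂, ?_⟩
    filter_upwards [h₁, h₂, val_add ν₁ ν₂] with x h1 h2 h3
    rw [h3, h1, h2, Polynomial.eval_add]
  | monomial n c =>
    refine ⟨RatFunc.C c * R ^ n, ?_⟩
    filter_upwards [val_mul (RatFunc.C c) (R ^ n), val_pow R n] with x h1 h2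
    rw [h1, h2, val_C, Polynomial.eval_monomial]

theorem exists_val_comp (μ R : RatFunc ℂ) :
    ∃ ν : RatFunc ℂ, ∀ᶠ x in cofinite, val ν x = val μ (val R x) := by
  obtain ⟨ν₁, h₁⟩ := exists_val_eval μ.num R
  obtain ⟨ν₂, h₂⟩ := exists_val_eval μ.denom R
  refine ⟨ν₁ / ν₂, ?_⟩
  filter_upwards [h₁, h₂, val_div ν₁ ν₂] with x h1 h2 h3
  rw [h3, h1, h2, val_eq μ]

theorem exists_val_deriv (R : RatFunc ℂ) :
    ∃ ν : RatFunc ℂ, ∀ᶠ x in cofinite, val ν x = deriv (val R) x := by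
  obtain ⟨ν₁, h₁⟩ := exists_val_eval (R.num.derivative * R.denom - R.num * R.denom.derivative)
    RatFunc.X
  obtain ⟨ν₂, h₂⟩ := exists_val_eval (R.denom ^ 2) RatFunc.X
  refine ⟨ν₁ / ν₂, ?_⟩
  filter_upwards [h₁, h₂, val_div ν₁ ν₂, regularAt_cofinite R] with x h1 h2 h3 h4
  rw [h3, h1, h2, val_X, deriv_val h4]
  simp

theorem cofinite_eventually_nhds {p : ℂ → Prop} (h : ∀ᶠ x in cofinite, p x) :
    ∀ᶠ x in cofinite, ∀ᶠ y in 𝓝 x, p y := by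
  filter_upwards [h] with x hx
  have h1 : {x | ¬ p x}.Finite := eventually_cofinite.1 h
  filter_upwards [h1.isClosed.isOpen_compl.mem_nhds (x := x) (by simpa using hx)] with y hy
  simpa using hy

theorem exists_val_pull (μ R : RatFunc ℂ) :
    ∃ ν : RatFunc ℂ, ∀ᶠ x in cofinite, val ν x = pull (val μ) (val R) x := by
  obtain ⟨ν₁, h₁⟩ := exists_val_comp μ R
  obtain ⟨ν₂, h₂⟩ := exists_val_deriv R
  obtain ⟨ν₃, h₃⟩ := exists_val_deriv ν₂
  refine ⟨ν₁ * ν₂ + ν₃ / ν₂, ?_⟩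
  filter_upwards [h₁, h₂, cofinite_eventually_nhds h₂, h₃, val_add (ν₁ * ν₂) (ν₃ / ν₂),
    val_mul ν₁ ν₂, val_div ν₃ ν₂] with x e1 e2 e2' e3 e4 e5 e6
  have : deriv (val ν₂) x = deriv (deriv (val R)) x := EventuallyEq.deriv_eq e2'
  rw [e4, e5, e6, e3, this, e1, e2, pull]

/-- The rational fraction of a homography. -/
theorem exists_ratFunc_homography (h : GL (Fin 2) ℂ) :
    ∃ H : RatFunc ℂ, (¬ ∃ c, H = RatFunc.C c) ∧
      ∀ x, RegularAt H x → h • (x : Sphere) = ((val H x : ℂ) : Sphere) := by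
  set l : ℂ → ℂ → Polynomial ℂ := fun u v => Polynomial.C u * Polynomial.X + Polynomial.C v
  have hl : ∀ u v a b : ℂ, homog (l u v) 1 a b = u * a + v * b := by
    intro u v a b
    simp [l, homog, Finset.sum_range_succ, Polynomial.coeff_X, Polynomial.coeff_C]
    ring
  have hl0 : l (h 1 0) (h 1 1) ≠ 0 := by
    intro h0
    have h1 := smul_toSphere h (a := 1) (b := 0) (by simp)
    have h2 := smul_toSphere h (a := 0) (b := 1) (by simp)
    rw [← hl (h 1 0), h0] at h1 h2
    have h3 : toSphere 1 0 = toSphere 0 1 := by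
      apply MulAction.injective h
      simp only
      rw [h1, h2]
      simp [homog, toSphere]
    rw [toSphere_eq_iff (by simp) (by simp)] at h3
    simp at h3
  obtain ⟨H, -, hH⟩ := exists_ratFunc (p := l (h 0 0) (h 0 1)) (q := l (h 1 0) (h 1 1)) (d := 1)
    Polynomial.natDegree_linear_le Polynomial.natDegree_linear_le hl0 fun a b hab => by
      rw [hl, hl]
      exact gl_ne_zero h hab
  have hH' : ∀ x, ratMap H x = h • x := by
    intro x
    obtain ⟨a, b, hab, rfl⟩ := exists_toSphere x
    rw [hH a b hab, hl, hl, smul_toSphere h hab]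
  refine ⟨H, ?_, fun x hx => by rw [← hH', ratMap_coe_of_regularAt hx]⟩
  rintro ⟨c, rfl⟩
  have h1 := hH' (0 : ℂ)
  rw [ratMap_C, ← ratMap_C c (1 : ℂ), hH'] at h1
  simpa using MulAction.injective h h1

/-- Solutions are transported by homographies. -/
theorem exists_solution_of_conj {R S : RatFunc ℂ} (hR : ¬ ∃ c, R = RatFunc.C c)
    {h : GL (Fin 2) ℂ} (hRS : ∀ x, ratMap S (h • x) = h • ratMap R x) {μ : RatFunc ℂ}
    (hS : IsSolutionG2 μ S) : ∃ ν : RatFunc ℂ, IsSolutionG2 ν R := by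
  obtain ⟨H, hH, hval⟩ := exists_ratFunc_homography h
  obtain ⟨ν, hν⟩ := exists_val_pull μ H
  refine ⟨ν, isSolutionG2_of_cofinite hR ?_⟩
  have hSH : ∀ᶠ x in cofinite, val S (val H x) = val H (val R x) := by
    filter_upwards [regularAt_cofinite R, regularAt_cofinite H,
      val_comp_cofinite hR (regularAt_cofinite H), val_comp_cofinite hH (regularAt_cofinite S)]
      with x h1 h2 h3 h4
    have := hRS x
    rwa [hval x h2, ratMap_coe_of_regularAt h1, hval _ h3, ratMap_coe_of_regularAt h4,
      OnePoint.coe_eq_coe] at this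
  filter_upwards [hν, val_comp_cofinite hR hν, cofinite_eventually_nhds hSH,
    regularAt_cofinite R, regularAt_cofinite H, deriv_val_ne_cofinite hR,
    deriv_val_ne_cofinite hH, val_comp_cofinite hR (regularAt_cofinite H),
    val_comp_cofinite hR (deriv_val_ne_cofinite hH),
    val_comp_cofinite hH (allowed_cofinite μ hS.1),
    cofinite_eventually_nhds (val_comp_cofinite hH (allowed_cofinite μ hS.1)),
    cofinite_eventually_nhds (val_comp_cofinite hR hν)]
    with x e1 e2 e3 r1 r2 d1 d2 r3 d3 al al' e2'
  -- With `ν = H^* μ` the computation is `R^* H^* μ = (H R)^* μ = (S H)^* μ = H^* S^* μ = H^* μ`.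
  have a1 : pull (val ν) (val R) x = pull (pull (val μ) (val H)) (val R) x := by
    rw [pull, pull, e2]
  rw [a1, ← pull_comp (analyticAt_val r3) (analyticAt_val r1) d3 d1,
    pull_congr (show (fun w => val H (val R w)) =ᶠ[𝓝 x] fun w => val S (val H w) from
      e3.mono fun y hy => hy.symm),
    pull_comp (analyticAt_val al.1) (analyticAt_val r2) al.2.1 d2, e1]
  change pull (val μ) (val S) (val H x) * _ + _ = _
  rw [hS.pull_eq al, pull]


/-! ### Maps to the sphere which pull back `μ` to a given connection form -/

/-- Near `z`, `f` is a local coordinate outside the poles of `μ`, and it pulls back `μ` to `m`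
at `z`. -/
def Sol (μ : RatFunc ℂ) (m : ℂ → ℂ) (f : ℂ → Sphere) (z : ℂ) : Prop :=
  ∃ F : ℂ → ℂ, AnalyticAt ℂ F z ∧ (∀ᶠ w in 𝓝 z, f w = (F w : Sphere)) ∧ deriv F z ≠ 0 ∧
    RegularAt μ (F z) ∧ pull (val μ) F z = m z

theorem Sol.congr {μ : RatFunc ℂ} {m : ℂ → ℂ} {f g : ℂ → Sphere} {z : ℂ} (h : Sol μ m f z)
    (hfg : ∀ᶠ w in 𝓝 z, g w = f w) : Sol μ m g z := by
  obtain ⟨F, h1, h2, h3⟩ := h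
  exact ⟨F, h1, by filter_upwards [h2, hfg] with w a b using b.trans a, h3⟩

theorem Sol.comp_affine {μ : RatFunc ℂ} {f : ℂ → Sphere} {a b z : ℂ} (ha : a ≠ 0)
    (h : Sol μ 0 f (a * z + b)) : Sol μ 0 (fun w => f (a * w + b)) z := by
  obtain ⟨F, h1, h2, h3, h4, h5⟩ := h
  have hg : AnalyticAt ℂ (fun w => a * w + b) z := by fun_prop
  have hg' : ∀ w, HasDerivAt (fun w => a * w + b) a w := fun w => by
    simpa using ((hasDerivAt_id w).const_mul a).add_const b
  have hd : deriv (fun w => a * w + b) = fun _ => a := funext fun w => (hg' w).deriv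
  refine ⟨fun w => F (a * w + b), AnalyticAt.comp (f := fun w => a * w + b) h1 hg, hg.continuousAt.eventually h2, ?_, h4, ?_⟩
  · have : HasDerivAt (fun w => F (a * w + b)) (deriv F (a * z + b) * a) z :=
      h1.differentiableAt.hasDerivAt.comp z (hg' z)
    rw [this.deriv]
    exact mul_ne_zero h3 ha
  · rw [pull_comp (g := fun w => a * w + b) h1 hg h3 (by rw [hd]; exact ha), pull, h5, hd]
    simp

theorem Sol.injOn {μ : RatFunc ℂ} {m : ℂ → ℂ} {f : ℂ → Sphere} {z : ℂ} (h : Sol μ m f z) :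
    ∃ s ∈ 𝓝 z, Set.InjOn f s := by
  obtain ⟨F, h1, h2, h3, -⟩ := h
  obtain ⟨τ, -, -, -, hl, -⟩ := exists_local_inverse h1 h3
  refine ⟨_, hl.and h2, fun x hx y hy hxy => ?_⟩
  obtain ⟨hx1, hx2⟩ := hx
  obtain ⟨hy1, hy2⟩ := hy
  rw [hx2, hy2, OnePoint.coe_eq_coe] at hxy
  rw [← hx1, ← hy1, hxy]

theorem holAt_const (c : Sphere) (z : ℂ) : HolAt (fun _ => c) z := by
  obtain ⟨a, b, hab, rfl⟩ := exists_toSphere c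
  exact holAt_toSphere analyticAt_const analyticAt_const hab

theorem eventually_ne_of_injOn {f : ℂ → Sphere} {z : ℂ} (hf : HolAt f z)
    (hi : ∃ᶠ w in 𝓝[≠] z, ∃ s ∈ 𝓝 w, Set.InjOn f s) (c : Sphere) :
    ∀ᶠ w in 𝓝[≠] z, f w ≠ c := by
  refine (hf.eventually_eq_or_ne (holAt_const c z)).resolve_left fun h => ?_
  obtain ⟨w, ⟨s, hs, hinj⟩, hw⟩ := (hi.and_eventually
    (h.eventually_nhds.filter_mono nhdsWithin_le_nhds)).exists
  have hw' : ∀ᶠ x in 𝓝[≠] w, x ∈ s ∧ f x = c :=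
    (Filter.Eventually.and hs hw).filter_mono nhdsWithin_le_nhds
  obtain ⟨x, hx, hxw⟩ := (hw'.and self_mem_nhdsWithin).exists
  exact hxw (hinj hx.1 (mem_of_mem_nhds hs) (hx.2.trans hw.self_of_nhds.symm))

/-- `R` preserves `μ` except over finitely many bad values, and `f`, being locally injective near
`z`, avoids each of these on a punctured neighbourhood. -/
theorem Sol.ratMap {μ R : RatFunc ℂ} (hR : IsSolutionG2 μ R) {m : ℂ → ℂ} {f : ℂ → Sphere} {z : ℂ}
    (hf : HolAt f z) (h : ∀ᶠ w in 𝓝[≠] z, Sol μ m f w) :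
    ∀ᶠ w in 𝓝[≠] z, Sol μ m (fun v => ratMap R (f v)) w := by
  have hfin : {y | ¬ Allowed μ R y}.Finite := eventually_cofinite.1 (allowed_cofinite μ hR.1)
  have hbad := (eventually_all_finite hfin).2 fun y _ =>
    eventually_ne_of_injOn hf (h.frequently.mono fun w hw => hw.injOn) (y : Sphere)
  filter_upwards [h, hbad] with w hw hwb
  obtain ⟨F, h1, h2, h3, h4, h5⟩ := hw
  have hal : Allowed μ R (F w) := by
    by_contra hc
    exact hwb _ hc h2.self_of_nhds
  have hRF := analyticAt_val hal.1
  have hd : HasDerivAt (fun v => val R (F v)) (deriv (val R) (F w) * deriv F w) w :=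
    hRF.differentiableAt.hasDerivAt.comp w h1.differentiableAt.hasDerivAt
  refine ⟨fun v => val R (F v), hRF.comp h1, ?_, ?_, hal.2.2.2, ?_⟩
  · filter_upwards [h2, h1.continuousAt.eventually hal.1.eventually] with v hv hv'
    rw [hv, ratMap_coe_of_regularAt hv']
  · rw [hd.deriv]
    exact mul_ne_zero hal.2.1 h3
  · rw [pull_comp hRF h1 hal.2.1 h3, pull, hR.pull_eq hal]
    exact h5

theorem HolAt.iterate_ratMap {f : ℂ → Sphere} {z : ℂ} (hf : HolAt f z) (R : RatFunc ℂ) (k : ℕ) :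
    HolAt (fun w => (DGroupoid.ratMap R)^[k] (f w)) z := by
  induction k with
  | zero => exact hf
  | succ k ih =>
    simp only [Function.iterate_succ_apply']
    exact ih.ratMap R

theorem Sol.iterate_ratMap {μ R : RatFunc ℂ} (hR : IsSolutionG2 μ R) {m : ℂ → ℂ} {f : ℂ → Sphere}
    {z : ℂ} (hf : HolAt f z) (h : ∀ᶠ w in 𝓝[≠] z, Sol μ m f w) (k : ℕ) :
    ∀ᶠ w in 𝓝[≠] z, Sol μ m (fun v => (DGroupoid.ratMap R)^[k] (f v)) w := by
  induction k with
  | zero => exact h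
  | succ k ih =>
    simp only [Function.iterate_succ_apply']
    exact Sol.ratMap hR (hf.iterate_ratMap R k) ih

/-- A local solution of `R ∘ Ψ = Ψ ∘ λ` extends to the whole of `ℂ` when `|λ| > 1`. -/
theorem exists_global_linearization {μ R : RatFunc ℂ} (hR : IsSolutionG2 μ R) {lam : ℂ}
    (hlam : 1 < ‖lam‖) {Ψ₀ : ℂ → Sphere} (hhol : ∀ᶠ z in 𝓝 0, HolAt Ψ₀ z)
    (hsemi : ∀ᶠ z in 𝓝 0, ratMap R (Ψ₀ z) = Ψ₀ (lam * z))
    (hsol : ∀ᶠ z in 𝓝[≠] 0, Sol μ 0 Ψ₀ z) :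
    ∃ Ψ : ℂ → Sphere, (∀ z, HolAt Ψ z) ∧ (∀ z, ratMap R (Ψ z) = Ψ (lam * z)) ∧
      ∀ z, ∀ᶠ w in 𝓝[≠] z, Sol μ 0 Ψ w := by
  have hlam0 : lam ≠ 0 := by
    rintro rfl
    simp at hlam
    linarith
  obtain ⟨r, hr, hb⟩ := Metric.eventually_nhds_iff.1
    (hhol.and (hsemi.and (eventually_nhdsWithin_iff.1 hsol)))
  simp only [dist_zero_right] at hb
  have hex : ∀ z : ℂ, ∃ k : ℕ, ‖z‖ < r * ‖lam‖ ^ k := by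
    intro z
    obtain ⟨k, hk⟩ := pow_unbounded_of_one_lt (‖z‖ / r) hlam
    exact ⟨k, by rwa [div_lt_iff₀' hr] at hk⟩
  have hsmall : ∀ (z : ℂ) (k : ℕ), ‖z‖ < r * ‖lam‖ ^ k → ‖(lam ^ k)⁻¹ * z + 0‖ < r := by
    intro z k hk
    rw [add_zero, norm_mul, norm_inv, norm_pow, inv_mul_lt_iff₀ (by positivity)]
    linarith
  -- The candidates `R^k (Ψ₀ (lam^{-k} z))` agree as soon as `lam^{-k} z` lies in the disc where
  -- `Ψ₀` is controlled. The `+ 0` puts the substitution in the shape used by `Sol.comp_affine`.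
  set it : ℕ → ℂ → Sphere := fun k z => (ratMap R)^[k] (Ψ₀ ((lam ^ k)⁻¹ * z + 0)) with hit
  have hstep : ∀ (z : ℂ) (k : ℕ), ‖z‖ < r * ‖lam‖ ^ k → it (k + 1) z = it k z := by
    intro z k hk
    have hk' : ‖z‖ < r * ‖lam‖ ^ (k + 1) := hk.trans_le
      (mul_le_mul_of_nonneg_left (pow_le_pow_right₀ hlam.le (Nat.le_succ k)) hr.le)
    simp only [hit, Function.iterate_succ_apply]
    rw [(hb (hsmall z _ hk')).2.1]
    congr 2
    field_simp
    ring
  have hind : ∀ (z : ℂ) (k j : ℕ), ‖z‖ < r * ‖lam‖ ^ k → it (k + j) z = it k z := by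
    intro z k j hk
    induction j with
    | zero => rfl
    | succ j ih =>
      rw [← add_assoc, hstep, ih]
      exact hk.trans_le (mul_le_mul_of_nonneg_left
        (pow_le_pow_right₀ hlam.le (Nat.le_add_right k j)) hr.le)
  choose N hN using hex
  set Ψ : ℂ → Sphere := fun z => it (N z) z with hΨ
  have hΨk : ∀ (z : ℂ) (k : ℕ), ‖z‖ < r * ‖lam‖ ^ k → Ψ z = it k z := by
    intro z k hk
    rw [hΨ]
    simp only
    rw [← hind z (N z) k (hN z), add_comm, hind z k (N z) hk]
  have hΨloc : ∀ (z : ℂ), ∀ᶠ w in 𝓝 z, Ψ w = it (N z) w := by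
    intro z
    filter_upwards [continuous_norm.continuousAt.eventually_lt continuousAt_const (hN z)] with w hw
    exact hΨk w _ hw
  refine ⟨Ψ, fun z => ?_, fun z => ?_, fun z => ?_⟩
  · refine HolAt.congr ?_ (hΨloc z)
    exact HolAt.iterate_ratMap (HolAt.comp (g := fun w => (lam ^ N z)⁻¹ * w + 0)
      (hb (hsmall z _ (hN z))).1 (by fun_prop)) R _
  · have h1 : ‖lam * z‖ < r * ‖lam‖ ^ (N z + 1) := by
      rw [norm_mul, pow_succ]
      have := mul_lt_mul_of_pos_left (hN z) (by linarith : 0 < ‖lam‖)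
      linarith
    rw [hΨk _ _ h1, hΨk z _ (hN z)]
    simp only [hit, Function.iterate_succ_apply', add_zero]
    congr 3
    field_simp
    ring
  · have h1 : ∀ᶠ w in 𝓝[≠] z, Sol μ 0 (it (N z)) w := by
      refine Sol.iterate_ratMap hR (HolAt.comp (g := fun w => (lam ^ N z)⁻¹ * w + 0)
      (hb (hsmall z _ (hN z))).1 (by fun_prop)) ?_ _
      have h0 : ∀ᶠ w in 𝓝[≠] z, w ≠ 0 := by
        by_cases hz : z = 0
        · subst hz
          exact self_mem_nhdsWithin
        · exact (isOpen_ne.eventually_mem hz).filter_mono nhdsWithin_le_nhds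
      have h2 : ∀ᶠ w in 𝓝[≠] z, ‖w‖ < r * ‖lam‖ ^ N z :=
        (continuous_norm.continuousAt.eventually_lt continuousAt_const (hN z)).filter_mono
          nhdsWithin_le_nhds
      filter_upwards [h0, h2] with w hw0 hw
      have hpow : (lam ^ N z)⁻¹ ≠ 0 := inv_ne_zero (pow_ne_zero _ hlam0)
      refine Sol.comp_affine hpow ((hb (hsmall w _ hw)).2.2 ?_)
      simpa [hlam0] using hw0
    filter_upwards [h1, ((hΨloc z).eventually_nhds).filter_mono nhdsWithin_le_nhds] with w hw hw'
    exact hw.congr hw'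


/-! ### Affine symmetries of maps to the sphere -/

/-- The affine bijection `z ↦ a z + b`. -/
def affine (a b : ℂ) (ha : a ≠ 0) : ℂ ≃ᵃ[ℂ] ℂ :=
  (LinearEquiv.smulOfNeZero ℂ ℂ a ha).toAffineEquiv.trans (AffineEquiv.constVAdd ℂ ℂ b)

theorem affine_apply {a b : ℂ} (ha : a ≠ 0) (z : ℂ) : affine a b ha z = a * z + b := by
  simp [affine, add_comm]

theorem exists_affine_eq (γ : ℂ ≃ᵃ[ℂ] ℂ) : ∃ a b : ℂ, a ≠ 0 ∧ ∀ z, γ z = a * z + b := by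
  have h : ∀ z, γ z = γ.linear 1 * z + γ 0 := by
    intro z
    have h1 := γ.map_vadd 0 z
    have h2 : γ.linear z = z * γ.linear 1 := by
      have := γ.linear.map_smul z 1
      simpa using this
    simp only [vadd_eq_add, add_zero] at h1
    rw [h1, h2, mul_comm]
  refine ⟨γ.linear 1, γ 0, fun h0 => ?_, h⟩
  have : γ 0 = γ 1 := by rw [h 1, h0]; simp
  exact zero_ne_one (γ.injective this)

theorem affine_mul_apply (γ δ : ℂ ≃ᵃ[ℂ] ℂ) (z : ℂ) : (γ * δ) z = γ (δ z) := rfl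

theorem affine_apply_inv_apply (γ : ℂ ≃ᵃ[ℂ] ℂ) (z : ℂ) : γ (γ⁻¹ z) = z := γ.apply_symm_apply z

theorem eventually_eventually_nhds_punctured {p : ℂ → Prop} {z : ℂ} (h : ∀ᶠ w in 𝓝[≠] z, p w) :
    ∀ᶠ w in 𝓝[≠] z, ∀ᶠ v in 𝓝 w, p v := by
  filter_upwards [(eventually_nhdsWithin_iff.1 h).eventually_nhds.filter_mono nhdsWithin_le_nhds,
    self_mem_nhdsWithin] with w hw hwz
  filter_upwards [hw, isOpen_ne.eventually_mem hwz] with v hv hvz using hv hvz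

/-- If `‖a‖ < 1`, iteration sends every point to the fixed point of the map, so `Ψ` takes a single
value. If `‖a‖ > 1`, apply this to the inverse. -/
theorem norm_eq_one_of_invariant {Ψ : ℂ → Sphere} (hΨ : ∀ z, HolAt Ψ z)
    (hne : ∃ z w, Ψ z ≠ Ψ w) {a b : ℂ} (ha : a ≠ 0) (h : ∀ z, Ψ (a * z + b) = Ψ z) :
    ‖a‖ = 1 := by
  have key : ∀ a b : ℂ, ‖a‖ < 1 → (∀ z, Ψ (a * z + b) = Ψ z) → False := by
    intro a b ha h
    have h1 : 1 - a ≠ 0 := by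
      intro h1
      rw [← sub_eq_zero.1 h1] at ha
      simp at ha
    set p := b / (1 - a) with hp
    have hpb : b = p * (1 - a) := by rw [hp, div_mul_cancel₀ _ h1]
    have hc : ∀ z, Ψ p = Ψ z := by
      intro z
      refine (hΨ p).eq_of_tendsto (u := fun n => a ^ n * (z - p) + p) ?_ fun n => ?_
      · have := ((tendsto_pow_atTop_nhds_zero_of_norm_lt_one ha).mul_const (z - p)).add_const p
        simpa using this
      · induction n with
        | zero => simp
        | succ n ih =>
          rw [← ih, ← h (a ^ n * (z - p) + p)]
          congr 1
          rw [hpb, pow_succ]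
          ring
    obtain ⟨z, w, hzw⟩ := hne
    exact hzw ((hc z).symm.trans (hc w))
  rcases lt_trichotomy ‖a‖ 1 with h1 | h1 | h1
  · exact (key a b h1 h).elim
  · exact h1
  · refine (key a⁻¹ (-b / a) (by rw [norm_inv]; exact inv_lt_one_of_one_lt₀ h1) fun z => ?_).elim
    rw [← h]
    congr 1
    field_simp
    ring

/-- With `Ψ = F` near `z` and `Ψ = H` near `w`, the transition `H⁻¹ ∘ F` carries the flat form to
the flat form, hence is affine. The identity theorem makes the local symmetry global. -/
theorem exists_affine_of_sol {μ : RatFunc ℂ} {Ψ : ℂ → Sphere} (hΨ : ∀ z, HolAt Ψ z) {z w : ℂ}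
    (hz : ∀ᶠ x in 𝓝 z, Sol μ 0 Ψ x) (hw : ∀ᶠ x in 𝓝 w, Sol μ 0 Ψ x) (h : Ψ z = Ψ w) :
    ∃ a : ℂ, a ≠ 0 ∧ ∀ x, Ψ (w + a * (x - z)) = Ψ x := by
  have key : ∀ z, (∀ᶠ x in 𝓝 z, Sol μ 0 Ψ x) → ∃ F : ℂ → ℂ, AnalyticAt ℂ F z ∧ deriv F z ≠ 0 ∧
      RegularAt μ (F z) ∧ (∀ᶠ x in 𝓝 z, Ψ x = (F x : Sphere)) ∧
      ∀ᶠ x in 𝓝 z, pull (val μ) F x = 0 := by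
    intro z hz
    obtain ⟨F, h1, h2, h3, h4, -⟩ := hz.self_of_nhds
    refine ⟨F, h1, h3, h4, h2, ?_⟩
    filter_upwards [hz, h2.eventually_nhds] with x hx hx2
    obtain ⟨F', k1, k2, k3, k4, k5⟩ := hx
    rw [← Pi.zero_apply (M := fun _ => ℂ) x, ← k5]
    refine pull_congr ?_
    filter_upwards [hx2, k2] with y hy1 hy2
    exact OnePoint.coe_injective (hy1.symm.trans hy2)
  obtain ⟨F, hF, hF', hFr, hFe, hFp⟩ := key z hz
  obtain ⟨H, hH, hH', hHr, hHe, hHp⟩ := key w hw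
  have hFH : F z = H w := OnePoint.coe_injective
    (hFe.self_of_nhds.symm.trans (h.trans hHe.self_of_nhds))
  obtain ⟨τ, hτ, hτw, hτ', -, hτr⟩ := exists_local_inverse hH hH'
  rw [← hFH] at hτ hτw hτ' hτr
  have hg : AnalyticAt ℂ (fun x => τ (F x)) z := AnalyticAt.comp hτ hF
  have hgz : τ (F z) = w := hτw
  have hgd : deriv (fun x => τ (F x)) z ≠ 0 := by
    have hd : HasDerivAt (fun x => τ (F x)) (deriv τ (F z) * deriv F z) z :=
      hτ.differentiableAt.hasDerivAt.comp z hF.differentiableAt.hasDerivAt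
    rw [hd.deriv]
    exact mul_ne_zero hτ' hF'
  have hgc : Tendsto (fun x => τ (F x)) (𝓝 z) (𝓝 w) := by
    have := hg.continuousAt.tendsto
    rwa [hgz] at this
  have hHg : ∀ᶠ x in 𝓝 z, H (τ (F x)) = F x := hF.continuousAt.eventually hτr
  have hid : ∀ x : ℂ, pull 0 (fun y => y) x = 0 := by
    intro x
    simp [pull]
  have hpull : ∀ᶠ x in 𝓝[≠] z, pull 0 (fun x => τ (F x)) x = pull 0 (fun y => y) x := by
    refine Filter.Eventually.filter_mono nhdsWithin_le_nhds ?_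
    filter_upwards [hHg.eventually_nhds, hg.eventually_analyticAt,
      hg.deriv.continuousAt.eventually_ne hgd, hgc.eventually hH.eventually_analyticAt,
      hgc.eventually (hH.deriv.continuousAt.eventually_ne hH'), hgc.eventually hHp, hFp]
      with x e1 e2 e3 e4 e5 e6 e7
    have h1 := pull_comp (m := val μ) (g := fun x => τ (F x)) e4 e2 e5 e3
    rw [pull_congr (show (fun y => H (τ (F y))) =ᶠ[𝓝 x] F from e1), e7] at h1
    have h2 : pull (pull (val μ) H) (fun x => τ (F x)) x = pull 0 (fun x => τ (F x)) x := by
      rw [pull, e6, pull, Pi.zero_apply]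
    rw [← h2, ← h1, hid]
  have haff := eq_affine_of_pull_eq analyticAt_id hg (by simp) hgd hpull
  refine ⟨deriv (fun x => τ (F x)) z, hgd, ?_⟩
  set a := deriv (fun x => τ (F x)) z
  have hae : (fun x => Ψ (w + a * (x - z))) = Ψ := by
    refine eq_of_eventually_eq (z₀ := z)
      (fun x => HolAt.comp (g := fun x => w + a * (x - z)) (hΨ _) (by fun_prop)) hΨ ?_
    refine Eventually.frequently (Filter.Eventually.filter_mono nhdsWithin_le_nhds ?_)
    filter_upwards [haff, hHg, hFe, hgc.eventually hHe] with x e1 e2 e3 e4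
    have : w + a * (x - z) = τ (F x) := by
      rw [e1, hgz]
      simp
    rw [this, e4, e2, e3]
  exact congrFun hae

/-- Moving `z` slightly to a regular point changes the common value, and openness of `Ψ` at `w`
lifts the new value near `w`. The value is kept different from `Ψ z` so that `w' ≠ w`, hence `w'` is
regular too. -/
theorem exists_sol_pair {μ : RatFunc ℂ} {Ψ : ℂ → Sphere} (hΨ : ∀ z, HolAt Ψ z)
    (hsol : ∀ z, ∀ᶠ w in 𝓝[≠] z, Sol μ 0 Ψ w) {z w : ℂ} (h : Ψ z = Ψ w) {ε : ℝ} (hε : 0 < ε) :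
    ∃ z' w', ‖z' - z‖ < ε ∧ ‖w' - w‖ < ε ∧ Ψ z' = Ψ w' ∧ (∀ᶠ x in 𝓝 z', Sol μ 0 Ψ x) ∧
      ∀ᶠ x in 𝓝 w', Sol μ 0 Ψ x := by
  have hball : ∀ z : ℂ, ∀ᶠ x in 𝓝 z, ‖x - z‖ < ε := fun z => by
    filter_upwards [Metric.ball_mem_nhds z hε] with x hx using by simpa [dist_eq_norm] using hx
  have hsol' := fun z => eventually_eventually_nhds_punctured (hsol z)
  have hne : ∃ z w, Ψ z ≠ Ψ w := by
    obtain ⟨x, s, hs, hi⟩ := ((hsol 0).mono fun w hw => hw.injOn).exists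
    obtain ⟨y, hy, hyx⟩ := ((Filter.Eventually.filter_mono nhdsWithin_le_nhds
      (show ∀ᶠ y in 𝓝 x, y ∈ s from hs)).and (self_mem_nhdsWithin : {x}ᶜ ∈ 𝓝[≠] x)).exists
    exact ⟨y, x, fun h => hyx (hi hy (mem_of_mem_nhds hs) h)⟩
  -- `σ` is the inverse of the chart around the common value, finite or infinite, so both cases
  -- continue together.
  obtain ⟨F, H, hF, hH, hFH, σ, hHr, hrep⟩ : ∃ F H : ℂ → ℂ, AnalyticAt ℂ F z ∧ AnalyticAt ℂ H w ∧
      F z = H w ∧ ∃ σ : ℂ → Sphere, (∀ᶠ x in 𝓝 z, Ψ x = σ (F x)) ∧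
        ∀ᶠ x in 𝓝 w, Ψ x = σ (H x) := by
    by_cases hi : Ψ z = ∞
    · obtain ⟨F, hF, hF0, hFe⟩ := (hΨ z).exists_inv hi
      obtain ⟨H, hH, hH0, hHe⟩ := (hΨ w).exists_inv (h ▸ hi)
      exact ⟨F, H, hF, hH, by rw [hF0, hH0], fun u => if u = 0 then ∞ else ((u⁻¹ : ℂ) : Sphere),
        hFe, hHe⟩
    · obtain ⟨F, hF, hFe⟩ := (hΨ z).exists_coe hi
      obtain ⟨H, hH, hHe⟩ := (hΨ w).exists_coe (h ▸ hi)
      refine ⟨F, H, hF, hH, ?_, fun u => (u : Sphere), hFe, hHe⟩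
      exact OnePoint.coe_injective (hFe.self_of_nhds.symm.trans (h.trans hHe.self_of_nhds))
  have hHne : ¬ ∀ᶠ x in 𝓝 w, H x = H w := by
    intro hc
    obtain ⟨x, hx1, hx2, hx3⟩ := ((eventually_ne_of_ne hΨ hne w (Ψ w)).and
      ((hc.and hrep).filter_mono nhdsWithin_le_nhds)).exists
    exact hx1 (by rw [hx3, hx2, hrep.self_of_nhds])
  have himg : H '' {y | ‖y - w‖ < ε ∧ (y ≠ w → ∀ᶠ x in 𝓝 y, Sol μ 0 Ψ x) ∧ Ψ y = σ (H y)} ∈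
      𝓝 (H w) := by
    refine nhds_le_map hH hHne (image_mem_map ?_)
    exact (hball w).and ((eventually_nhdsWithin_iff.1 (hsol' w)).and hrep)
  rw [← hFH] at himg
  obtain ⟨z', h1, h2, h3, h4, ⟨w', ⟨hw1, hw2, hw3⟩, hw4⟩⟩ := ((hsol' z).and
    ((eventually_ne_of_ne hΨ hne z (Ψ z)).and (((hball z).and (hHr.and
    (hF.continuousAt.eventually himg))).filter_mono nhdsWithin_le_nhds))).exists
  refine ⟨z', w', h3, hw1, by rw [h4, hw3, hw4], h1, hw2 ?_⟩
  rintro rfl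
  apply h2
  rw [h, h4, hw3, hw4]

/-- The fibres of `Ψ` are the orbits of its affine symmetries. -/
theorem exists_affine_of_eq {μ : RatFunc ℂ} {Ψ : ℂ → Sphere} (hΨ : ∀ z, HolAt Ψ z)
    (hne : ∃ z w, Ψ z ≠ Ψ w)
    (hsol : ∀ z, ∀ᶠ w in 𝓝[≠] z, Sol μ 0 Ψ w) {z w : ℂ} (h : Ψ z = Ψ w) :
    ∃ a : ℂ, a ≠ 0 ∧ ∀ x, Ψ (w + a * (x - z)) = Ψ x := by
  have hpair := fun n : ℕ => exists_sol_pair hΨ hsol h (Nat.one_div_pos_of_nat (n := n) (α := ℝ))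
  choose z' w' hz' hw' hzw hz hw using hpair
  choose a ha0 ha using fun n => exists_affine_of_sol hΨ (hz n) (hw n) (hzw n)
  have hnorm : ∀ n, ‖a n‖ = 1 := fun n =>
    norm_eq_one_of_invariant hΨ hne (b := w' n - a n * z' n) (ha0 n) fun x => by
      rw [← ha n x]
      congr 1
      ring
  -- The symmetries found for regular pairs tending to `(z, w)` have linear parts on the unit
  -- circle; a limit of a subsequence is a symmetry taking `z` to `w`.
  obtain ⟨A, hA, φ, hφ, hlim⟩ := (isCompact_sphere (0 : ℂ) 1).tendsto_subseq
    (x := a) fun n => by simp [hnorm n]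
  have hconv : ∀ (u : ℕ → ℂ) (c : ℂ), (∀ n, ‖u n - c‖ < 1 / ((n : ℝ) + 1)) →
      Tendsto u atTop (𝓝 c) := by
    intro u c hu
    rw [tendsto_iff_norm_sub_tendsto_zero]
    exact squeeze_zero (fun _ => norm_nonneg _) (fun n => (hu n).le)
      tendsto_one_div_add_atTop_nhds_zero_nat
  refine ⟨A, ?_, fun x => ?_⟩
  · rintro rfl
    simp at hA
  · refine (hΨ _).eq_of_tendsto (u := fun n => w' (φ n) + a (φ n) * (x - z' (φ n))) ?_
      fun n => ha (φ n) x
    exact ((hconv w' w hw').comp hφ.tendsto_atTop).add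
      (hlim.mul (tendsto_const_nhds.sub ((hconv z' z hz').comp hφ.tendsto_atTop)))

/-- The group of affine symmetries of a map. -/
def symmetryGroup (Ψ : ℂ → Sphere) : Subgroup (ℂ ≃ᵃ[ℂ] ℂ) where
  carrier := {γ | ∀ z, Ψ (γ z) = Ψ z}
  mul_mem' {γ δ} hγ hδ z := by
    rw [affine_mul_apply, hγ, hδ]
  one_mem' z := rfl
  inv_mem' {γ} hγ z := by
    rw [← hγ, affine_apply_inv_apply]

/-- If `γ` is close to `γ₀`, then `γ₀⁻¹ γ` keeps two given points in a ball where `Ψ` is injective,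
so it fixes both, and an affine map with two fixed points is the identity. -/
theorem isDiscreteGroup_symmetryGroup {Ψ : ℂ → Sphere} {z₀ : ℂ}
    (h : ∃ s ∈ 𝓝 z₀, Set.InjOn Ψ s) : IsDiscreteGroup (symmetryGroup Ψ) := by
  obtain ⟨s, hs, hinj⟩ := h
  obtain ⟨r, hr, hrs⟩ := Metric.mem_nhds_iff.1 hs
  refine IsDiscrete.of_nhdsWithin fun p hp => ?_
  obtain ⟨γ₀, hγ₀, h₀⟩ := hp
  have ha0 : p.1 ≠ 0 := by
    intro h0
    have : γ₀ 0 = γ₀ 1 := by rw [h₀, h₀, h0]; simp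
    exact zero_ne_one (γ₀.injective this)
  have hinv : ∀ x, γ₀⁻¹ x = (x - p.2) / p.1 := by
    intro x
    apply γ₀.injective
    rw [affine_apply_inv_apply, h₀]
    field_simp
    ring
  have hcl : ∀ z ∈ ({z₀, z₀ + r / 2} : Set ℂ), ∀ᶠ q in 𝓝 p,
      ((q.1 * z + q.2) - p.2) / p.1 ∈ Metric.ball z₀ r := by
    intro z hz
    have hc : ContinuousAt (fun q : ℂ × ℂ => ((q.1 * z + q.2) - p.2) / p.1) p := by fun_prop
    refine hc.eventually (Metric.isOpen_ball.mem_nhds ?_)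
    have : (p.1 * z + p.2 - p.2) / p.1 = z := by field_simp; ring
    simp only [this]
    rcases hz with rfl | rfl
    · exact Metric.mem_ball_self hr
    · simp [abs_of_pos hr, hr]
  rw [le_pure_iff]
  change ∀ᶠ q in 𝓝[_] p, q = p
  rw [eventually_nhdsWithin_iff]
  filter_upwards [hcl z₀ (by simp), hcl (z₀ + r / 2) (by simp)] with q h1 h2 hq
  obtain ⟨γ, hγ, hγe⟩ := hq
  have hfix : ∀ z ∈ Metric.ball z₀ r, ((q.1 * z + q.2) - p.2) / p.1 ∈ Metric.ball z₀ r →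
      q.1 * z + q.2 = p.1 * z + p.2 := by
    intro z hz hz'
    have : Ψ (γ₀⁻¹ (γ z)) = Ψ z := by
      rw [(symmetryGroup Ψ).inv_mem hγ₀ (γ z), hγ z]
    rw [hγe, hinv] at this
    have := hinj (hrs hz') (hrs hz) this
    field_simp at this
    linear_combination this
  have e1 := hfix z₀ (Metric.mem_ball_self hr) h1
  have e2 := hfix (z₀ + r / 2) (by simp [abs_of_pos hr, hr]) h2
  have hr0 : (r : ℂ) ≠ 0 := by exact_mod_cast hr.ne'
  have e3 : q.1 = p.1 := by
    have : (q.1 - p.1) * (r / 2) = 0 := by linear_combination e2 - e1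
    simpa [hr0, sub_eq_zero] using this
  refine Prod.ext e3 ?_
  rw [e3] at e1
  exact add_left_cancel e1

theorem isQuotientOfDilation_symmetryGroup {μ R : RatFunc ℂ} {lam : ℂ} (hlam : lam ≠ 0)
    {Ψ : ℂ → Sphere} (hΨ : ∀ z, HolAt Ψ z) (hsemi : ∀ z, ratMap R (Ψ z) = Ψ (lam * z))
    (hsol : ∀ z, ∀ᶠ w in 𝓝[≠] z, Sol μ 0 Ψ w) :
    IsQuotientOfDilation R lam (symmetryGroup Ψ) Ψ := by
  obtain ⟨x, s, hs, hi⟩ := ((hsol 0).mono fun w hw => hw.injOn).exists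
  have hne : ∃ z w, Ψ z ≠ Ψ w := by
    obtain ⟨y, hy, hyx⟩ := ((Filter.Eventually.filter_mono nhdsWithin_le_nhds
      (show ∀ᶠ y in 𝓝 x, y ∈ s from hs)).and (self_mem_nhdsWithin : {x}ᶜ ∈ 𝓝[≠] x)).exists
    exact ⟨y, x, fun h => hyx (hi hy (mem_of_mem_nhds hs) h)⟩
  refine ⟨hlam, isDiscreteGroup_symmetryGroup ⟨s, hs, hi⟩, hΨ, fun z w => ⟨fun h => ?_, ?_⟩, hsemi⟩
  · obtain ⟨a, ha, hae⟩ := exists_affine_of_eq hΨ hne hsol h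
    refine ⟨affine a (w - a * z) ha, fun x => ?_, ?_⟩
    · rw [affine_apply, ← hae x]
      congr 1
      ring
    · rw [affine_apply]
      ring
  · rintro ⟨γ, hγ, rfl⟩
    exact (hγ z).symm


/-! ### Fixed points and backward orbits of rational maps -/

theorem degree_pos {R : RatFunc ℂ} (hR : ¬ ∃ c, R = RatFunc.C c) : 0 < degree R := by
  by_contra h
  have h0 : degree R = 0 := by omega
  have h1 : R.num.natDegree = 0 := Nat.le_zero.1 (h0 ▸ natDegree_num_le R)
  have h2 : R.denom.natDegree = 0 := Nat.le_zero.1 (h0 ▸ natDegree_denom_le R)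
  apply hR
  refine ⟨R.num.coeff 0 / R.denom.coeff 0, ?_⟩
  rw [map_div₀, ← R.num_div_denom]
  conv_lhs => rw [Polynomial.eq_C_of_natDegree_eq_zero h1, Polynomial.eq_C_of_natDegree_eq_zero h2]
  simp [RatFunc.algebraMap_C]

theorem num_ne_zero_or (R : RatFunc ℂ) (x : ℂ) : R.num.eval x ≠ 0 ∨ R.denom.eval x ≠ 0 := by
  have := homog_ne_zero R (a := x) (b := 1) (by simp)
  rwa [homog_one (natDegree_num_le R), homog_one (natDegree_denom_le R)] at this

theorem ratMap_coe_eq_toSphere (R : RatFunc ℂ) (x : ℂ) :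
    ratMap R (x : Sphere) = toSphere (R.num.eval x) (R.denom.eval x) := by
  rw [← toSphere_one, ratMap_toSphere R (by simp), homog_one (natDegree_num_le R),
    homog_one (natDegree_denom_le R)]

theorem ratMap_infty_eq_toSphere (R : RatFunc ℂ) :
    ratMap R ∞ = toSphere (R.num.coeff (degree R)) (R.denom.coeff (degree R)) := by
  rw [← toSphere_zero 1, ratMap_toSphere R (by simp), homog_zero, homog_zero]
  simp

theorem coeff_degree_ne_zero (R : RatFunc ℂ) :
    R.num.coeff (degree R) ≠ 0 ∨ R.denom.coeff (degree R) ≠ 0 := by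
  have := homog_ne_zero R (a := 1) (b := 0) (by simp)
  simpa [homog_zero] using this

/-- A preimage of `[u : v]` is a root of `v P - u Q`. If this polynomial is a nonzero constant, its
coefficient of degree `degree R > 0` vanishes, and infinity is the preimage. -/
theorem ratMap_surjective {R : RatFunc ℂ} (hR : ¬ ∃ c, R = RatFunc.C c) :
    Function.Surjective (ratMap R) := by
  intro c
  obtain ⟨u, v, huv, rfl⟩ := exists_toSphere c
  set p := Polynomial.C v * R.num - Polynomial.C u * R.denom with hp
  by_cases h : p.degree = 0
  · refine ⟨∞, ?_⟩
    rw [ratMap_infty_eq_toSphere, toSphere_eq_iff (coeff_degree_ne_zero R) huv]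
    have h1 : p.coeff (degree R) = 0 := by
      refine Polynomial.coeff_eq_zero_of_natDegree_lt ?_
      rw [Polynomial.natDegree_eq_of_degree_eq_some h]
      exact degree_pos hR
    simp only [hp, Polynomial.coeff_sub, Polynomial.coeff_C_mul] at h1
    linear_combination h1
  · obtain ⟨x, hx⟩ := IsAlgClosed.exists_root p h
    refine ⟨(x : Sphere), ?_⟩
    rw [ratMap_coe_eq_toSphere, toSphere_eq_iff (num_ne_zero_or R x) huv]
    simp only [hp, Polynomial.IsRoot, Polynomial.eval_sub, Polynomial.eval_mul,
      Polynomial.eval_C] at hx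
    linear_combination hx

/-- The map `κ ↦ 1 / (1 - κ)` sends the closed unit disc without `1` to the half-plane of real part
at least `1 / 2`. -/
theorem half_le_re_inv {κ : ℂ} (h1 : κ ≠ 1) (h : ‖κ‖ ≤ 1) : 1 / 2 ≤ ((1 - κ)⁻¹).re := by
  have h2 : 0 < Complex.normSq (1 - κ) := Complex.normSq_pos.2 (sub_ne_zero.2 (Ne.symm h1))
  have h3 : Complex.normSq κ ≤ 1 := by
    rw [Complex.normSq_eq_norm_sq]
    have := norm_nonneg κ
    nlinarith
  rw [Complex.inv_re, le_div_iff₀ h2]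
  simp only [Complex.normSq_apply, Complex.sub_re, Complex.sub_im, Complex.one_re,
    Complex.one_im] at h3 ⊢
  nlinarith

/-- A rational map of degree at least two has a repelling fixed point or a fixed point of
multiplier one. -/
theorem exists_fixed_point {R : RatFunc ℂ} (hd : 2 ≤ degree R) (hinf : ratMap R ∞ ≠ ∞) :
    ∃ x₀, RegularAt R x₀ ∧ val R x₀ = x₀ ∧
      (deriv (val R) x₀ = 1 ∨ 1 < ‖deriv (val R) x₀‖) := by
  set P := R.num with hP
  set Q := R.denom with hQ
  have hPQ : P.natDegree ≤ Q.natDegree := by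
    by_contra h
    exact hinf (by rw [ratMap_infty, if_pos (not_le.1 h)])
  have hdQ : Q.natDegree = degree R := (max_eq_right hPQ).symm
  -- The roots of `f` are the fixed points of `R`. Since infinity is not fixed, `f` is monic of
  -- degree `degree R + 1`.
  set f := Polynomial.X * Q - P with hf
  have hQm : Q.Monic := R.monic_denom
  have hXQ : (Polynomial.X * Q).natDegree = Q.natDegree + 1 := by
    rw [mul_comm, Polynomial.natDegree_mul_X hQm.ne_zero]
  have hfm : f.Monic := by
    refine (Polynomial.monic_X.mul hQm).sub_of_left ?_
    refine Polynomial.degree_lt_degree ?_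
    omega
  have hfd : f.natDegree = Q.natDegree + 1 := by
    rw [hf, Polynomial.natDegree_sub_eq_left_of_natDegree_lt, hXQ]
    omega
  have hroot : ∀ x, f.eval x = 0 → RegularAt R x ∧ val R x = x ∧
      f.derivative.eval x = Q.eval x * (1 - deriv (val R) x) := by
    intro x hx
    have hPx : P.eval x = x * Q.eval x := by
      simp only [hf, Polynomial.eval_sub, Polynomial.eval_mul, Polynomial.eval_X] at hx
      linear_combination -hx
    have hQx : Q.eval x ≠ 0 := by
      intro h0
      rcases num_ne_zero_or R x with h | h
      · exact h (by rw [← hP, hPx, h0, mul_zero])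
      · exact h h0
    refine ⟨hQx, by rw [val_eq, ← hP, ← hQ, hPx, mul_div_cancel_right₀ _ hQx], ?_⟩
    rw [deriv_val hQx, ← hP, ← hQ, hPx]
    simp only [hf, Polynomial.derivative_sub, Polynomial.derivative_mul, Polynomial.derivative_X,
      Polynomial.eval_sub, Polynomial.eval_add, Polynomial.eval_mul, Polynomial.eval_X,
      Polynomial.eval_one]
    field_simp
    ring
  -- Otherwise every multiplier lies in the closed unit disc and differs from `1`; as `f' = Q (1 -
  -- R')` at a root, all roots of `f` are simple.
  by_contra! hc
  have hsimple : ∀ x, f.eval x = 0 → f.derivative.eval x ≠ 0 := by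
    intro x hx h0
    obtain ⟨h1, h2, h3⟩ := hroot x hx
    rw [h0] at h3
    have h4 := (mul_eq_zero.1 h3.symm).resolve_left h1
    exact (hc x h1 h2).1 (sub_eq_zero.1 h4).symm
  have hnodup : f.roots.Nodup := by
    rw [Multiset.nodup_iff_count_le_one]
    intro x
    rw [Polynomial.count_roots]
    by_contra hcount
    have h1 := (Polynomial.one_lt_rootMultiplicity_iff_isRoot hfm.ne_zero).1 (not_le.1 hcount)
    exact hsimple x h1.1 h1.2
  set s := f.roots.toFinset with hs
  have hsplit : f.Splits := IsAlgClosed.splits f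
  have hcard : s.card = Q.natDegree + 1 := by
    rw [hs, Multiset.toFinset_card_of_nodup hnodup, ← hfd]
    exact hsplit.natDegree_eq_card_roots.symm
  have hfs : f = Lagrange.nodal s id := by
    rw [Lagrange.nodal]
    conv_lhs => rw [hsplit.eq_prod_roots_of_monic hfm]
    rw [hs, Finset.prod, Multiset.toFinset_val, hnodup.dedup]
    rfl
  -- Interpolating the monic `Q` at the roots of `f` and comparing leading coefficients gives `1 = ∑
  -- Q / f' = ∑ 1 / (1 - κ)`, the holomorphic fixed point formula.
  have hsum := Lagrange.leadingCoeff_eq_sum (s := s) (v := (id : ℂ → ℂ))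
    (Function.injective_id.injOn) (P := Q) (by
      rw [hcard, Polynomial.degree_eq_natDegree hQm.ne_zero]
      rfl)
  rw [hQm.leadingCoeff] at hsum
  have hterm : ∀ x ∈ s, Q.eval (id x) / ∏ j ∈ s.erase x, (id x - id j) =
      (1 - deriv (val R) x)⁻¹ := by
    intro x hx
    have hx0 : f.eval x = 0 := by
      have := Multiset.mem_toFinset.1 hx
      exact ((Polynomial.mem_roots hfm.ne_zero).1 this)
    obtain ⟨h1, h2, h3⟩ := hroot x hx0
    rw [hfs] at h3
    have h4 := Lagrange.eval_nodal_derivative_eval_node_eq (v := (id : ℂ → ℂ)) hx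
    rw [id] at h4
    rw [h4, Lagrange.eval_nodal] at h3
    rw [id, h3]
    have h1' : Q.eval x ≠ 0 := h1
    rw [div_mul_eq_div_div, div_self h1', one_div]
  rw [Finset.sum_congr rfl hterm] at hsum
  have hre := congrArg Complex.re hsum
  rw [Complex.re_sum, Complex.one_re] at hre
  -- There are `degree R + 1 ≥ 3` terms of real part at least `1 / 2`, while their sum is `1`.
  have hle : ∑ x ∈ s, (1 / 2 : ℝ) ≤ ∑ x ∈ s, ((1 - deriv (val R) x)⁻¹).re := by
    refine Finset.sum_le_sum fun x hx => ?_
    have hx0 : f.eval x = 0 := (Polynomial.mem_roots hfm.ne_zero).1 (Multiset.mem_toFinset.1 hx)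
    obtain ⟨h1, h2, h3⟩ := hroot x hx0
    exact half_le_re_inv (hc x h1 h2).1 (hc x h1 h2).2
  rw [← hre, Finset.sum_const, hcard, nsmul_eq_mul] at hle
  have : (2 : ℝ) ≤ Q.natDegree := by exact_mod_cast hdQ ▸ hd
  push_cast at hle
  linarith

/-- If infinity is not a preimage, the numerator of `R - x₀` has degree at least two, and `x₀` is a
simple root because the multiplier is nonzero. -/
theorem exists_other_preimage {R : RatFunc ℂ} (hd : 2 ≤ degree R) {x₀ : ℂ} (hx₀ : RegularAt R x₀)
    (hfix : val R x₀ = x₀) (hderiv : deriv (val R) x₀ ≠ 0) :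
    ∃ y : Sphere, y ≠ x₀ ∧ ratMap R y = x₀ := by
  by_cases hinf : ratMap R ∞ = x₀
  · exact ⟨∞, OnePoint.infty_ne_coe _, hinf⟩
  set p := R.num - Polynomial.C x₀ * R.denom with hp
  have hx₀' : R.denom.eval x₀ ≠ 0 := hx₀
  have hnum : R.num.eval x₀ = x₀ * R.denom.eval x₀ := by
    rw [val_eq, div_eq_iff hx₀'] at hfix
    exact hfix
  have hcoeff : p.coeff (degree R) ≠ 0 := by
    intro h0
    apply hinf
    rw [ratMap_infty_eq_toSphere, ← toSphere_one,
      toSphere_eq_iff (coeff_degree_ne_zero R) (by simp)]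
    simp only [hp, Polynomial.coeff_sub, Polynomial.coeff_C_mul] at h0
    linear_combination h0
  have hpd : degree R ≤ p.natDegree := Polynomial.le_natDegree_of_ne_zero hcoeff
  have hp0 : p ≠ 0 := by
    rintro h
    simp [h] at hcoeff
  have hroot : p.IsRoot x₀ := by
    simp [hp, Polynomial.IsRoot, hnum]
  obtain ⟨q, hq⟩ := Polynomial.dvd_iff_isRoot.2 hroot
  have hq0 : q ≠ 0 := by
    rintro rfl
    simp [hq] at hp0
  have hqd : q.natDegree + 1 = p.natDegree := by
    rw [hq, Polynomial.natDegree_mul (Polynomial.X_sub_C_ne_zero x₀) hq0,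
      Polynomial.natDegree_X_sub_C]
    ring
  obtain ⟨y, hy⟩ := IsAlgClosed.exists_root q (by
    rw [Polynomial.degree_eq_natDegree hq0]
    have : q.natDegree ≠ 0 := by omega
    exact_mod_cast this)
  refine ⟨(y : Sphere), ?_, ?_⟩
  · intro h
    rw [OnePoint.coe_eq_coe] at h
    subst h
    apply hderiv
    have h1 : p.derivative.eval y = 0 := by
      rw [hq]
      simp [Polynomial.derivative_mul, hy.eq_zero]
    simp only [hp, Polynomial.derivative_sub, Polynomial.derivative_C_mul, Polynomial.eval_sub,
      Polynomial.eval_mul, Polynomial.eval_C] at h1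
    rw [deriv_val hx₀, hnum, div_eq_zero_iff]
    left
    linear_combination R.denom.eval y * h1
  · have h1 : p.eval y = 0 := by rw [hq, Polynomial.eval_mul, hy.eq_zero, mul_zero]
    rw [ratMap_coe_eq_toSphere, ← toSphere_one, toSphere_eq_iff (num_ne_zero_or R y) (by simp)]
    simp only [hp, Polynomial.eval_sub, Polynomial.eval_mul, Polynomial.eval_C] at h1
    linear_combination h1

/-- The backward orbit of a fixed point which is not critical is infinite. -/
theorem infinite_backward_orbit {R : RatFunc ℂ} (hR : ¬ ∃ c, R = RatFunc.C c)
    (hd : 2 ≤ degree R) {x₀ : ℂ} (hx₀ : RegularAt R x₀)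
    (hfix : val R x₀ = x₀) (hderiv : deriv (val R) x₀ ≠ 0) :
    {y : Sphere | ∃ k, (ratMap R)^[k] y = x₀}.Infinite := by
  intro hfin
  set B := {y : Sphere | ∃ k, (ratMap R)^[k] y = x₀} with hB
  have hf0 : ratMap R x₀ = x₀ := by rw [ratMap_coe_of_regularAt hx₀, hfix]
  have hmaps : ∀ y : B, ratMap R y ∈ B := by
    rintro ⟨y, k, hk⟩
    refine ⟨k, ?_⟩
    rw [← Function.iterate_succ_apply, Function.iterate_succ_apply', hk, hf0]
  have : Finite B := hfin
  set f : B → B := fun y => ⟨ratMap R y, hmaps y⟩ with hf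
  -- On a finite backward orbit the surjection `R` would be injective, but `x₀` and a second
  -- preimage both map to `x₀`.
  have hsurj : Function.Surjective f := by
    rintro ⟨y, k, hk⟩
    obtain ⟨x, hx⟩ := ratMap_surjective hR y
    exact ⟨⟨x, k + 1, by rw [Function.iterate_succ_apply, hx, hk]⟩, Subtype.ext hx⟩
  have hinj := Finite.injective_iff_surjective.2 hsurj
  obtain ⟨y, hy, hy'⟩ := exists_other_preimage hd hx₀ hfix hderiv
  have h1 : f ⟨y, 1, hy'⟩ = f ⟨x₀, 0, rfl⟩ := Subtype.ext (hy'.trans hf0.symm)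
  exact hy (congrArg Subtype.val (hinj h1))

theorem exists_regular_backward (μ : RatFunc ℂ) {R : RatFunc ℂ} (hR : ¬ ∃ c, R = RatFunc.C c)
    (hd : 2 ≤ degree R) {x₀ : ℂ} (hx₀ : RegularAt R x₀)
    (hfix : val R x₀ = x₀) (hderiv : deriv (val R) x₀ ≠ 0) :
    ∃ (k : ℕ) (y : ℂ), RegularAt μ y ∧ (ratMap R)^[k] (y : Sphere) = x₀ := by
  have hfin : ({∞} ∪ (↑) '' {y : ℂ | ¬ RegularAt μ y} : Set Sphere).Finite :=
    (Set.finite_singleton _).union ((eventually_cofinite.1 (regularAt_cofinite μ)).image _)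
  obtain ⟨y, ⟨k, hk⟩, hy⟩ :=
    ((infinite_backward_orbit hR hd hx₀ hfix hderiv).sdiff hfin).nonempty
  induction y using OnePoint.rec with
  | infty => simp at hy
  | coe y => exact ⟨k, y, by simpa using hy, hk⟩


/-! ### Linearization at a repelling fixed point -/

/-- Near a point whose backward orbit meets the regular points of `μ`, the connection becomes
regular in a ramified coordinate. -/
theorem exists_ramified_chart {μ R : RatFunc ℂ} (hR : IsSolutionG2 μ R) {k : ℕ} {x₀ y : ℂ}
    (hy : RegularAt μ y) (hk : (ratMap R)^[k] (y : Sphere) = x₀) :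
    ∃ (n : ℕ) (m : ℂ → ℂ), n ≠ 0 ∧ AnalyticAt ℂ m 0 ∧ ∀ᶠ s in 𝓝[≠] (0 : ℂ),
      RegularAt μ (x₀ + s ^ n) ∧ pull (val μ) (fun s => x₀ + s ^ n) s = m s := by
  have hid : HolAt (fun w : ℂ => (w : Sphere)) y := holAt_coe analyticAt_id
  have hsol : ∀ᶠ w in 𝓝[≠] y, Sol μ (val μ) (fun w : ℂ => (w : Sphere)) w := by
    filter_upwards [hy.eventually.filter_mono nhdsWithin_le_nhds] with w hw
    exact ⟨fun w => w, analyticAt_id, Eventually.of_forall fun _ => rfl, by simp, hw,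
      by simp [pull]⟩
  have hsolk := Sol.iterate_ratMap hR hid hsol k
  obtain ⟨F, hF, hFe⟩ := (hid.iterate_ratMap R k).exists_coe (by simp [hk])
  have hFy : F y = x₀ := OnePoint.coe_injective (hFe.self_of_nhds.symm.trans hk)
  have hgood : ∀ᶠ w in 𝓝[≠] y, AnalyticAt ℂ F w ∧ deriv F w ≠ 0 ∧ RegularAt μ (F w) ∧
      pull (val μ) F w = val μ w := by
    filter_upwards [hsolk, hFe.eventually_nhds.filter_mono nhdsWithin_le_nhds] with w hw hw'
    obtain ⟨F', h1, h2, h3, h4, h5⟩ := hw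
    have e : F =ᶠ[𝓝 w] F' := by
      filter_upwards [h2, hw'] with x a b using OnePoint.coe_injective (b.symm.trans a)
    refine ⟨h1.congr e.symm, e.deriv_eq ▸ h3, e.eq_of_nhds ▸ h4, ?_⟩
    rw [pull_congr e, h5]
  have hne : ¬ ∀ᶠ w in 𝓝 y, F w = F y := by
    intro h
    obtain ⟨w, hw, hw'⟩ := (hgood.and (h.eventually_nhds.filter_mono nhdsWithin_le_nhds)).exists
    exact hw.2.1 ((EventuallyEq.deriv_eq hw').trans (deriv_const _ _))
  obtain ⟨n, t, hn, ht, hty, ht', hnf⟩ := exists_normal_form hF hne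
  obtain ⟨τ, hτ, hτy, hτ', -, hr⟩ := exists_local_inverse ht ht'
  rw [hty] at hτ hτy hτ' hr
  -- Near `y` the iterate is `x₀ + t ^ n`; in the coordinate `s = t` on the source, the form `μ`,
  -- regular at `y`, becomes `pull μ τ` with `τ = t⁻¹`. Invariance under `R` identifies it with the
  -- pull-back of `μ` by `x₀ + s ^ n`.
  refine ⟨n, pull (val μ) τ, hn,
    analyticAt_pull hτ (hτy ▸ analyticAt_val hy) hτ', ?_⟩
  have htp : Tendsto τ (𝓝[≠] 0) (𝓝[≠] y) := by
    have := tendsto_punctured hτ hτ'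
    rwa [hτy] at this
  have htn : Tendsto τ (𝓝 0) (𝓝 y) := by simpa [hτy] using hτ.continuousAt.tendsto
  have hcomp : ∀ᶠ s in 𝓝 (0 : ℂ), F (τ s) = x₀ + s ^ n := by
    filter_upwards [hr, htn.eventually hnf] with s h1 h2
    rw [h2, h1, hFy]
  filter_upwards [htp.eventually hgood, hcomp.eventually_nhds.filter_mono nhdsWithin_le_nhds,
    hτ.eventually_analyticAt.filter_mono nhdsWithin_le_nhds,
    (hτ.deriv.continuousAt.eventually_ne hτ').filter_mono nhdsWithin_le_nhds] with s h1 h2 h3 h4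
  have e : (fun s => x₀ + s ^ n) =ᶠ[𝓝 s] fun s => F (τ s) := h2.mono fun x hx => hx.symm
  refine ⟨?_, ?_⟩
  · rw [← h2.self_of_nhds]
    exact h1.2.2.1
  · rw [pull_congr e, pull_comp h1.1 h3 h1.2.1 h4, pull, h1.2.2.2, pull]

/-- Write `f (x₀ + s ^ n) - x₀ = s ^ n g(s)` with `g 0 = f' x₀` and take for `L` the product of `s`
and the `n`-th root of `g` with value `lam` at `0`. -/
theorem exists_ramified_lift {f : ℂ → ℂ} {x₀ lam : ℂ} {n : ℕ} (hf : AnalyticAt ℂ f x₀)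
    (hfix : f x₀ = x₀) (hn : n ≠ 0) (hlam : lam ^ n = deriv f x₀) (hf' : deriv f x₀ ≠ 0) :
    ∃ L : ℂ → ℂ, AnalyticAt ℂ L 0 ∧ L 0 = 0 ∧ deriv L 0 = lam ∧
      ∀ s, x₀ + L s ^ n = f (x₀ + s ^ n) := by
  have hg : AnalyticAt ℂ (dslope f x₀) x₀ := by
    obtain ⟨p, hp⟩ := hf
    exact hp.has_fpower_series_dslope_fslope.analyticAt
  have hh : AnalyticAt ℂ (fun s : ℂ => dslope f x₀ (x₀ + s ^ n)) 0 := by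
    refine AnalyticAt.comp (f := fun s : ℂ => x₀ + s ^ n) ?_ (by fun_prop)
    rwa [show x₀ + (0 : ℂ) ^ n = x₀ by simp [hn]]
  have h0 : dslope f x₀ (x₀ + 0 ^ n) = deriv f x₀ := by simp [hn]
  obtain ⟨u, hu, hu0, hun⟩ := exists_root hh hn (by rw [h0, hlam]) (by rwa [h0])
  refine ⟨fun s => s * u s, by fun_prop, by simp, ?_, fun s => ?_⟩
  · have : HasDerivAt (fun s => s * u s) (1 * u 0 + 0 * deriv u 0) 0 :=
      (hasDerivAt_id 0).mul hu.differentiableAt.hasDerivAt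
    rw [this.deriv, hu0]
    simp
  · have := sub_smul_dslope f x₀ (x₀ + s ^ n)
    simp only [add_sub_cancel_left, smul_eq_mul] at this
    rw [mul_pow, hun, this, hfix]
    ring

/-- In the ramified coordinate the connection is regular, so it has a developing map `D`. The lift
of `R` preserves the connection and fixes `0`, hence is linear in `D`. The local linearization is
then `π ∘ D⁻¹`. -/
theorem exists_linearization {μ R : RatFunc ℂ} (hR : IsSolutionG2 μ R) (hd : 2 ≤ degree R)
    {x₀ : ℂ} (hx₀ : RegularAt R x₀) (hfix : val R x₀ = x₀)
    (hmult : deriv (val R) x₀ = 1 ∨ 1 < ‖deriv (val R) x₀‖) :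
    ∃ (lam : ℂ) (Ψ : ℂ → Sphere), 1 < ‖lam‖ ∧ (∀ z, HolAt Ψ z) ∧
      (∀ z, ratMap R (Ψ z) = Ψ (lam * z)) ∧ ∀ z, ∀ᶠ w in 𝓝[≠] z, Sol μ 0 Ψ w := by
  have hκ : deriv (val R) x₀ ≠ 0 := by
    rcases hmult with h | h
    · rw [h]
      exact one_ne_zero
    · intro h0
      rw [h0, norm_zero] at h
      linarith
  obtain ⟨k, y, hy, hk⟩ := exists_regular_backward μ hR.1 hd hx₀ hfix hκ
  obtain ⟨n, m, hn, hm, hchart⟩ := exists_ramified_chart hR hy hk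
  obtain ⟨D, hD, hD0, hD', hDm⟩ := exists_developing hm
  have hDd : deriv D 0 ≠ 0 := by rw [hD']; exact one_ne_zero
  have hRan := analyticAt_val hx₀
  set π : ℂ → ℂ := fun s => x₀ + s ^ n with hπ
  have hπd : ∀ s, HasDerivAt π (n * s ^ (n - 1)) s := fun s => by
    exact (hasDerivAt_pow n s).const_add x₀
  have hπan : ∀ s, AnalyticAt ℂ π s := fun s => by fun_prop
  have hπ0 : π 0 = x₀ := by simp [hπ, hn]
  have hπne : ∀ s ≠ 0, deriv π s ≠ 0 := by
    intro s hs
    rw [(hπd s).deriv]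
    exact mul_ne_zero (Nat.cast_ne_zero.2 hn) (pow_ne_zero _ hs)
  have hπt : Tendsto π (𝓝 0) (𝓝 x₀) := by
    have := (hπan 0).continuousAt.tendsto
    rwa [hπ0] at this
  -- the lift is linear in the coordinate `D`
  have key : ∀ lam : ℂ, lam ^ n = deriv (val R) x₀ → ∃ L : ℂ → ℂ, AnalyticAt ℂ L 0 ∧ L 0 = 0 ∧
      (∀ s, π (L s) = val R (π s)) ∧ ∀ᶠ s in 𝓝 0, D (L s) = lam * D s := by
    intro lam hlam
    have hlam0 : lam ≠ 0 := by
      rintro rfl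
      exact hκ (by rw [← hlam, zero_pow hn])
    obtain ⟨L, hL, hL0, hL', hLR⟩ := exists_ramified_lift hRan hfix hn hlam hκ
    refine ⟨L, hL, hL0, hLR, ?_⟩
    have hLd : deriv L 0 ≠ 0 := by rwa [hL']
    have hDL : AnalyticAt ℂ D (L 0) := by rwa [hL0]
    have hE : AnalyticAt ℂ (fun s => D (L s)) 0 := hDL.comp hL
    have hEd : deriv (fun s => D (L s)) 0 = lam := by
      have : HasDerivAt (fun s => D (L s)) (deriv D (L 0) * deriv L 0) 0 :=
        hDL.differentiableAt.hasDerivAt.comp 0 hL.differentiableAt.hasDerivAt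
      rw [this.deriv, hL0, hD', hL', one_mul]
    have hLp : Tendsto L (𝓝[≠] 0) (𝓝[≠] 0) := by
      have := tendsto_punctured hL hLd
      rwa [hL0] at this
    have hLt : Tendsto L (𝓝 0) (𝓝 0) := by
      have := hL.continuousAt.tendsto
      rwa [hL0] at this
    have hpull : ∀ᶠ s in 𝓝[≠] 0, pull 0 (fun s => D (L s)) s = pull 0 D s := by
      filter_upwards [self_mem_nhdsWithin, hchart, hLp.eventually hchart,
        hLp.eventually self_mem_nhdsWithin,
        (hL.eventually_analyticAt).filter_mono nhdsWithin_le_nhds,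
        (hL.deriv.continuousAt.eventually_ne hLd).filter_mono nhdsWithin_le_nhds,
        (hLt.eventually hD.eventually_analyticAt).filter_mono nhdsWithin_le_nhds,
        (hLt.eventually (hD.deriv.continuousAt.eventually_ne hDd)).filter_mono nhdsWithin_le_nhds,
        (hLt.eventually hDm).filter_mono nhdsWithin_le_nhds, hDm.filter_mono nhdsWithin_le_nhds,
        (hπt.eventually hx₀.eventually).filter_mono nhdsWithin_le_nhds,
        (hπt.eventually (hRan.deriv.continuousAt.eventually_ne hκ)).filter_mono nhdsWithin_le_nhds]
        with s hs hc hcL hLs hLan hLd' hDan hDd' hDmL hDms hreg hRd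
      have hs0 : s ≠ 0 := hs
      have hLs0 : L s ≠ 0 := hLs
      have hal : Allowed μ R (π s) := ⟨hreg, hRd, hc.1, by rw [← hLR s]; exact hcL.1⟩
      have e1 : pull 0 (fun s => D (L s)) s = pull (val μ) (fun s => π (L s)) s := by
        rw [pull_comp hDan hLan hDd' hLd', pull_comp (hπan _) hLan (hπne _ hLs0) hLd']
        change pull 0 D (L s) * _ + _ = pull (val μ) π (L s) * _ + _
        rw [hDmL, hcL.2]
      have e2 : pull (val μ) (fun s => π (L s)) s = pull (val μ) π s := by
        rw [show (fun s => π (L s)) = fun s => val R (π s) from funext hLR,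
          pull_comp (analyticAt_val hreg) (hπan s) hRd (hπne s hs0), pull, hR.pull_eq hal, pull]
      rw [e1, e2, hc.2, hDms]
    -- `D ∘ L` and `D` develop the same structure and both vanish at `0`, so the affine relation
    -- between them has no constant term.
    filter_upwards [eq_affine_of_pull_eq hD hE hDd (by rwa [hEd]) hpull] with s hs
    rw [hs, hL0, hD0, hEd, hD']
    simp
  obtain ⟨σ, hσ, hσ0, hσ', hσl, hσr⟩ := exists_local_inverse hD hDd
  rw [hD0] at hσ hσ0 hσ' hσr
  have hσt : Tendsto σ (𝓝 0) (𝓝 0) := by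
    have := hσ.continuousAt.tendsto
    rwa [hσ0] at this
  rcases hmult with h1 | h1
  -- For multiplier one the lift with `lam = 1` is the identity near `0`. Then `R` fixes a
  -- neighbourhood of `x₀` pointwise, so `R = X`, of degree one.
  · exfalso
    obtain ⟨L, hL, hL0, hLR, hDL⟩ := key 1 (by rw [one_pow, h1])
    have hLt : Tendsto L (𝓝 0) (𝓝 0) := by
      have := hL.continuousAt.tendsto
      rwa [hL0] at this
    have hfixed : ∀ᶠ s in 𝓝 0, val R (π s) = π s := by
      filter_upwards [hDL, hσl, hLt.eventually hσl] with s a b c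
      rw [← hLR, ← c, a, one_mul, b]
    have hπne' : ¬ ∀ᶠ s in 𝓝 0, π s = π 0 := by
      intro h
      obtain ⟨s, hs, hs0⟩ := ((h.filter_mono nhdsWithin_le_nhds).and
        (self_mem_nhdsWithin : {0}ᶜ ∈ 𝓝[≠] (0 : ℂ))).exists
      have : s ^ n = 0 := by simpa [hπ, hn] using hs
      exact hs0 (by simpa using pow_eq_zero_iff hn |>.1 this)
    have himg := nhds_le_map (hπan 0) hπne' (image_mem_map
      (hfixed.and (hπt.eventually hx₀.eventually)))
    have hX : R = RatFunc.X := by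
      refine ratFunc_ext ((infinite_of_mem_nhds (π 0) himg).mono ?_)
      rintro _ ⟨s, ⟨hs1, hs2⟩, rfl⟩
      have h1 : RegularAt RatFunc.X (π s) := by simp [RegularAt]
      change ratMap R _ = ratMap RatFunc.X _
      rw [ratMap_coe_of_regularAt hs2, ratMap_coe_of_regularAt h1, hs1, val_X]
    rw [hX] at hd
    simp [degree] at hd
  · obtain ⟨lam, hlam⟩ := IsAlgClosed.exists_pow_nat_eq (deriv (val R) x₀) (Nat.pos_of_ne_zero hn)
    have hlam1 : 1 < ‖lam‖ := by
      rw [← hlam, norm_pow] at h1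
      by_contra h
      exact absurd (pow_le_one₀ (norm_nonneg _) (not_lt.1 h)) (not_le.2 h1)
    obtain ⟨L, hL, hL0, hLR, hDL⟩ := key lam hlam
    have hlamt : Tendsto (fun z : ℂ => lam * z) (𝓝 0) (𝓝 0) := by
      have : Continuous fun z : ℂ => lam * z := by fun_prop
      simpa using this.tendsto 0
    have hLt : Tendsto L (𝓝 0) (𝓝 0) := by
      have := hL.continuousAt.tendsto
      rwa [hL0] at this
    have hσp : Tendsto σ (𝓝[≠] 0) (𝓝[≠] 0) := by
      have := tendsto_punctured hσ hσ'
      rwa [hσ0] at this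
    have hΨ₀ : ∀ᶠ z in 𝓝 0, HolAt (fun z => (π (σ z) : Sphere)) z := by
      filter_upwards [hσ.eventually_analyticAt] with z hz
      exact holAt_coe ((hπan _).comp hz)
    have hsemi : ∀ᶠ z in 𝓝 0, ratMap R (π (σ z) : Sphere) = (π (σ (lam * z)) : Sphere) := by
      filter_upwards [hσr, hσt.eventually hDL, (hLt.comp hσt).eventually hσl,
        (hπt.comp hσt).eventually hx₀.eventually] with z a b c e
      simp only [Function.comp_apply] at b c e ⊢
      rw [ratMap_coe_of_regularAt e]
      rw [← hLR, ← c, b, a]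
    have hsol : ∀ᶠ z in 𝓝[≠] 0, Sol μ 0 (fun z => (π (σ z) : Sphere)) z := by
      filter_upwards [hσp.eventually hchart, hσp.eventually self_mem_nhdsWithin,
        hσ.eventually_analyticAt.filter_mono nhdsWithin_le_nhds,
        (hσ.deriv.continuousAt.eventually_ne hσ').filter_mono nhdsWithin_le_nhds,
        (hσt.eventually hD.eventually_analyticAt).filter_mono nhdsWithin_le_nhds,
        (hσt.eventually (hD.deriv.continuousAt.eventually_ne hDd)).filter_mono nhdsWithin_le_nhds,
        (hσt.eventually hDm).filter_mono nhdsWithin_le_nhds,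
        hσr.eventually_nhds.filter_mono nhdsWithin_le_nhds] with z hc hz hσz hσd hDz hDzd hDmz hid
      have hz0 : σ z ≠ 0 := hz
      refine ⟨fun z => π (σ z), (hπan _).comp hσz, Eventually.of_forall fun _ => rfl, ?_, hc.1, ?_⟩
      · have : HasDerivAt (fun z => π (σ z)) (deriv π (σ z) * deriv σ z) z :=
          (hπan _).differentiableAt.hasDerivAt.comp z hσz.differentiableAt.hasDerivAt
        rw [this.deriv]
        exact mul_ne_zero (hπne _ hz0) hσd
      · have e1 : pull (val μ) (fun z => π (σ z)) z = pull 0 (fun z => D (σ z)) z := by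
          rw [pull_comp hDz hσz hDzd hσd, pull_comp (hπan _) hσz (hπne _ hz0) hσd]
          change pull (val μ) π (σ z) * _ + _ = pull 0 D (σ z) * _ + _
          rw [hDmz, hc.2]
        rw [e1, pull_congr (show (fun z => D (σ z)) =ᶠ[𝓝 z] fun z => z from hid)]
        simp [pull]
    obtain ⟨Ψ, h1, h2, h3⟩ := exists_global_linearization hR hlam1 hΨ₀ hsemi hsol
    exact ⟨lam, Ψ, hlam1, h1, h2, h3⟩

theorem exists_not_fixed {R : RatFunc ℂ} (hd : degree R ≠ 1) :
    ∃ c : ℂ, ratMap R (c : Sphere) ≠ c := by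
  by_contra! h
  have : R = RatFunc.X := by
    refine ratFunc_ext ?_
    convert Set.infinite_univ (α := ℂ)
    ext x
    have h1 : RegularAt RatFunc.X x := by simp [RegularAt]
    simp [h, ratMap_coe_of_regularAt h1, val_X]
  apply hd
  rw [this]
  simp [degree]

theorem IsQuotientOfDilation.smul {R S : RatFunc ℂ} {lam : ℂ} {G : Subgroup (ℂ ≃ᵃ[ℂ] ℂ)}
    {Ψ : ℂ → Sphere} (hQ : IsQuotientOfDilation R lam G Ψ) {h : GL (Fin 2) ℂ}
    (hRS : ∀ x, ratMap S (h • x) = h • ratMap R x) :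
    IsQuotientOfDilation S lam G (fun z => h • Ψ z) where
  lam_ne_zero := hQ.lam_ne_zero
  discrete := hQ.discrete
  holomorphic z := HolAt.smul (hQ.holomorphic z) h
  fibres z w := by
    rw [← hQ.fibres z w]
    exact (MulAction.injective h).eq_iff
  semiconj z := by rw [hRS, hQ.semiconj]

/-- A point that is not fixed is first moved to infinity, as `exists_fixed_point` requires; the
quotient structure is then transported back. -/
theorem exists_quotient_of_solution {μ R : RatFunc ℂ} (hR : IsSolutionG2 μ R)
    (hd : degree R ≠ 1) : ∃ (lam : ℂ) (G : Subgroup (ℂ ≃ᵃ[ℂ] ℂ)) (Ψ : ℂ → Sphere),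
      IsQuotientOfDilation R lam G Ψ := by
  obtain ⟨c, hc⟩ := exists_not_fixed hd
  obtain ⟨h, hh⟩ := exists_smul_eq_infty (c : Sphere)
  obtain ⟨S, hSd, hS, hRS⟩ := exists_conj R hR.1 h
  have hSR : ∀ x, ratMap R (h⁻¹ • x) = h⁻¹ • ratMap S x := by
    intro x
    rw [eq_inv_smul_iff, ← hRS, smul_inv_smul]
  obtain ⟨ν, hν⟩ := exists_solution_of_conj hS hSR hR
  have hinf : ratMap S ∞ ≠ ∞ := by
    rw [← hh, hRS]
    exact fun e => hc (MulAction.injective h e)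
  have hd2 : 2 ≤ degree S := by
    have := degree_pos hS
    omega
  obtain ⟨x₀, h1, h2, h3⟩ := exists_fixed_point hd2 hinf
  obtain ⟨lam, Ψ, hlam, hΨ, hsemi, hsol⟩ := exists_linearization hν hd2 h1 h2 h3
  have hlam0 : lam ≠ 0 := by
    rintro rfl
    simp at hlam
    linarith
  exact ⟨lam, _, _, (isQuotientOfDilation_symmetryGroup hlam0 hΨ hsemi hsol).smul hSR⟩


/-! ### Discrete groups of affine isometries of the plane -/

theorem finite_of_separated {X : Type*} [PseudoMetricSpace X] [ProperSpace X] {s : Set X}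
    (hb : Bornology.IsBounded s) {δ : ℝ} (hδ : 0 < δ)
    (h : ∀ x ∈ s, ∀ y ∈ s, dist x y < δ → x = y) : s.Finite := by
  by_contra hinf
  obtain ⟨t, ht, hst⟩ := Metric.totallyBounded_iff.1
    ((Bornology.IsBounded.isCompact_closure hb).totallyBounded.subset subset_closure) (δ / 2)
    (half_pos hδ)
  have hc : ∀ x ∈ s, ∃ y ∈ t, dist x y < δ / 2 := fun x hx => by simpa using hst hx
  choose! c hct hcd using hc
  obtain ⟨x, hx, y, hy, hxy, he⟩ := Set.Infinite.exists_ne_map_eq_of_mapsTo hinf hct ht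
  refine hxy (h x hx y hy ?_)
  calc dist x y ≤ dist x (c x) + dist y (c x) := dist_triangle_right _ _ _
    _ < δ := by
      have h1 := hcd x hx
      have h2 := hcd y hy
      rw [← he] at h2
      linarith

/-- The relation `M a b`, meaning that `z ↦ a z + b` belongs to some fixed group, defines a discrete
group of isometries. -/
structure IsEuclidean (M : ℂ → ℂ → Prop) : Prop where
  one : M 1 0
  mul : ∀ {a b c d}, M a b → M c d → M (a * c) (a * d + b)
  inv : ∀ {a b}, M a b → M a⁻¹ (-b / a)
  norm : ∀ {a b}, M a b → ‖a‖ = 1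
  discrete : ∃ δ > 0, ∀ a b, M a b → ‖a - 1‖ < δ → ‖b‖ < δ → a = 1 ∧ b = 0

namespace IsEuclidean

variable {M : ℂ → ℂ → Prop}

theorem ne_zero (hM : IsEuclidean M) {a b : ℂ} (h : M a b) : a ≠ 0 := by
  rintro rfl
  simpa using hM.norm h

theorem scale (hM : IsEuclidean M) {t : ℂ} (ht : t ≠ 0) : IsEuclidean fun a b => M a (t * b) where
  one := by simpa using hM.one
  mul {a b c d} h1 h2 := by
    have := hM.mul h1 h2
    rwa [show a * (t * d) + t * b = t * (a * d + b) by ring] at this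
  inv {a b} h := by
    have := hM.inv h
    rwa [show -(t * b) / a = t * (-b / a) by ring] at this
  norm h := hM.norm h
  discrete := by
    obtain ⟨δ, hδ, h⟩ := hM.discrete
    refine ⟨min δ (δ / ‖t‖), lt_min hδ (div_pos hδ (norm_pos_iff.2 ht)), fun a b hab h1 h2 => ?_⟩
    have h3 := h a (t * b) hab (h1.trans_le (min_le_left _ _)) ?_
    · exact ⟨h3.1, (mul_eq_zero.1 h3.2).resolve_left ht⟩
    · have := h2.trans_le (min_le_right _ _)
      rw [lt_div_iff₀ (norm_pos_iff.2 ht)] at this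
      rwa [norm_mul, mul_comm]

theorem add (hM : IsEuclidean M) {b d : ℂ} (h1 : M 1 b) (h2 : M 1 d) : M 1 (b + d) := by
  have := hM.mul h1 h2
  simpa [add_comm] using this

theorem neg (hM : IsEuclidean M) {b : ℂ} (h1 : M 1 b) : M 1 (-b) := by
  simpa using hM.inv h1

theorem sub (hM : IsEuclidean M) {b d : ℂ} (h1 : M 1 b) (h2 : M 1 d) : M 1 (b - d) := by
  rw [sub_eq_add_neg]
  exact hM.add h1 (hM.neg h2)

theorem int_mul (hM : IsEuclidean M) {b : ℂ} (h : M 1 b) (n : ℤ) : M 1 (n * b) := by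
  induction n with
  | zero => simpa using hM.one
  | succ n ih => simpa [add_mul] using hM.add ih h
  | pred n ih => simpa [sub_mul] using hM.sub ih h

theorem smul (hM : IsEuclidean M) {a d b : ℂ} (ha : M a d) (hb : M 1 b) : M 1 (a * b) := by
  have := hM.mul (hM.mul ha hb) (hM.inv ha)
  have h0 := hM.ne_zero ha
  rwa [mul_one, mul_inv_cancel₀ h0, show a * (-d / a) + (a * b + d) = a * b by field_simp; ring]
    at this

theorem sub_of (hM : IsEuclidean M) {a b d : ℂ} (h1 : M a b) (h2 : M a d) : M 1 (b - d) := by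
  have := hM.mul h1 (hM.inv h2)
  have h0 := hM.ne_zero h1
  rwa [mul_inv_cancel₀ h0, show a * (-d / a) + b = b - d by field_simp; ring] at this

/-- Because the elements are isometries, isolation of the identity gives a uniform separation
between the pairs `(a, b)`, and bounded separated sets are finite. -/
theorem finite (hM : IsEuclidean M) (r : ℝ) : {p : ℂ × ℂ | M p.1 p.2 ∧ ‖p.2‖ ≤ r}.Finite := by
  obtain ⟨δ, hδ, h⟩ := hM.discrete
  refine finite_of_separated ?_ hδ ?_
  · refine ((Metric.isBounded_closedBall (x := (0 : ℂ)) (r := 1)).prod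
      (Metric.isBounded_closedBall (x := (0 : ℂ)) (r := r))).subset ?_
    rintro ⟨a, b⟩ ⟨h1, h2⟩
    exact ⟨by simp [hM.norm h1], by simpa using h2⟩
  · rintro ⟨a, b⟩ ⟨h1, -⟩ ⟨c, d⟩ ⟨h2, -⟩ hd
    simp only at h1 h2
    rw [Prod.dist_eq, max_lt_iff, dist_eq_norm, dist_eq_norm] at hd
    have ha := hM.norm h1
    have ha0 := hM.ne_zero h1
    have h3 := h _ _ (hM.mul (hM.inv h1) h2) ?_ ?_
    · obtain ⟨e1, e2⟩ := h3
      have e3 : a = c := by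
        field_simp at e1
        exact e1.symm
      have e4 : b = d := by
        field_simp at e2
        linear_combination -e2
      rw [e3, e4]
    · rw [show a⁻¹ * c - 1 = -((a - c) / a) by field_simp; ring, norm_neg, norm_div, ha, div_one]
      exact hd.1
    · rw [show a⁻¹ * d + -b / a = -((b - d) / a) by field_simp; ring, norm_neg, norm_div, ha,
        div_one]
      exact hd.2

theorem exists_shortest (hM : IsEuclidean M) {S : Set ℂ} (hS : S.Nonempty) (hST : ∀ b ∈ S, M 1 b) :
    ∃ t ∈ S, ∀ b ∈ S, ‖t‖ ≤ ‖b‖ := by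
  obtain ⟨b₀, hb₀⟩ := hS
  have hfin : (S ∩ {b | ‖b‖ ≤ ‖b₀‖}).Finite := by
    refine Set.Finite.of_finite_image (f := fun b => ((1 : ℂ), b)) ((hM.finite ‖b₀‖).subset ?_)
      fun x _ y _ h => (Prod.mk.inj h).2
    rintro _ ⟨b, ⟨h1, h2⟩, rfl⟩
    exact ⟨hST b h1, h2⟩
  obtain ⟨t, ⟨ht, ht'⟩, hmin⟩ := hfin.exists_minimalFor (fun b => ‖b‖) _ ⟨b₀, hb₀, le_refl ‖b₀‖⟩
  refine ⟨t, ht, fun b hb => ?_⟩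
  rcases le_total ‖b‖ ‖b₀‖ with h | h
  · by_contra hlt
    exact hlt (hmin ⟨hb, h⟩ (not_le.1 hlt).le)
  · exact le_trans ht' h

/-- The linear parts. -/
def Linear (M : ℂ → ℂ → Prop) (a : ℂ) : Prop := ∃ b, M a b

theorem linear_one (hM : IsEuclidean M) : Linear M 1 := ⟨0, hM.one⟩

theorem linear_mul (hM : IsEuclidean M) {a c : ℂ} : Linear M a → Linear M c → Linear M (a * c) :=
  fun ⟨_, h1⟩ ⟨_, h2⟩ => ⟨_, hM.mul h1 h2⟩

theorem linear_inv (hM : IsEuclidean M) {a : ℂ} : Linear M a → Linear M a⁻¹ :=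
  fun ⟨_, h1⟩ => ⟨_, hM.inv h1⟩

theorem linear_pow (hM : IsEuclidean M) {a : ℂ} (h : Linear M a) (n : ℕ) : Linear M (a ^ n) := by
  induction n with
  | zero => simpa using hM.linear_one
  | succ n ih => exact pow_succ a n ▸ hM.linear_mul ih h

/-- A discrete group whose linear parts are the `k`-th roots of unity is generated by its
translations and one rotation. -/
theorem exists_center (hM : IsEuclidean M) {k : ℕ} (hk : 1 ≤ k)
    (hlin : ∀ a, Linear M a ↔ a ^ k = 1) :
    ∃ p : ℂ, (k = 1 → p = 0) ∧ ∀ a b, M a b ↔ a ^ k = 1 ∧ M 1 (b + (a - 1) * p) := by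
  rcases hk.eq_or_lt with rfl | hk2
  · refine ⟨0, fun _ => rfl, fun a b => ⟨fun h => ?_, ?_⟩⟩
    · have ha := (hlin a).1 ⟨b, h⟩
      have ha' : a = 1 := by simpa using ha
      exact ⟨ha, by simpa [ha'] using h⟩
    · rintro ⟨h1, h2⟩
      have ha' : a = 1 := by simpa using h1
      simpa [ha'] using h2
  · have hprim := Complex.isPrimitiveRoot_exp k (by omega)
    set ε := Complex.exp (2 * Real.pi * Complex.I / k)
    obtain ⟨d, hd⟩ := (hlin ε).2 hprim.pow_eq_one
    have hε : 1 - ε ≠ 0 := fun h => hprim.ne_one hk2 (sub_eq_zero.1 h).symm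
    -- `p` is the fixed point of a rotation whose linear part generates all of them; its powers
    -- realize every linear part around the same center.
    set p := d / (1 - ε) with hp
    have hdp : d = (1 - ε) * p := by rw [hp]; field_simp
    have hrot : ∀ i : ℕ, M (ε ^ i) ((1 - ε ^ i) * p) := by
      intro i
      induction i with
      | zero => simpa using hM.one
      | succ i ih =>
        have := hM.mul ih hd
        rw [hdp] at this
        rwa [pow_succ, show (1 - ε ^ i * ε) * p = ε ^ i * ((1 - ε) * p) + (1 - ε ^ i) * p by ring]
    have hrot' : ∀ a, a ^ k = 1 → M a ((1 - a) * p) := by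
      intro a ha
      have : NeZero k := ⟨by omega⟩
      obtain ⟨i, -, rfl⟩ := hprim.eq_pow_of_pow_eq_one ha
      exact hrot i
    refine ⟨p, by omega, fun a b => ⟨fun h => ?_, ?_⟩⟩
    · have ha := (hlin a).1 ⟨b, h⟩
      refine ⟨ha, ?_⟩
      have := hM.sub_of h (hrot' a ha)
      rwa [show b - (1 - a) * p = b + (a - 1) * p by ring] at this
    · rintro ⟨h1, h2⟩
      have := hM.mul h2 (hrot' a h1)
      rwa [one_mul, one_mul, show (1 - a) * p + (b + (a - 1) * p) = b by ring] at this

/-- Commutators are translations, hence trivial, so all elements fix the center `p` of one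
nontrivial rotation. The linear parts form a finite subgroup of `ℂˣ`, which by counting is the full
group of roots of unity of its order. -/
theorem exists_linear_of_no_translation (hM : IsEuclidean M) (hT : ∀ b, M 1 b → b = 0) :
    ∃ k : ℕ, 1 ≤ k ∧ ∀ a, Linear M a ↔ a ^ k = 1 := by
  by_cases hK : ∀ a, Linear M a → a = 1
  · exact ⟨1, le_rfl, fun a => ⟨fun h => by simp [hK a h], fun h => by
      rw [pow_one] at h
      rw [h]
      exact hM.linear_one⟩⟩
  push Not at hK
  obtain ⟨ε, ⟨d, hd⟩, hε⟩ := hK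
  have hε' : 1 - ε ≠ 0 := fun h => hε (sub_eq_zero.1 h).symm
  set p := d / (1 - ε) with hp
  have hcomm : ∀ a b, M a b → b = (1 - a) * p := by
    intro a b hab
    have h1 := hM.mul hab hd
    have h2 := hM.mul hd hab
    rw [mul_comm ε a] at h2
    have := hT _ (hM.sub_of h1 h2)
    rw [hp]
    field_simp
    linear_combination this
  let K : Subgroup ℂˣ :=
    { carrier := {u | Linear M u}
      mul_mem' := fun {u v} hu hv => by
        simpa using hM.linear_mul hu hv
      one_mem' := by simpa using hM.linear_one
      inv_mem' := fun {u} hu => by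
        simpa using hM.linear_inv hu }
  have hfin : Finite K := by
    have : (K : Set ℂˣ).Finite := by
      refine Set.Finite.of_finite_image
        (f := fun u : ℂˣ => ((u : ℂ), (1 - (u : ℂ)) * p)) ((hM.finite (2 * ‖p‖)).subset ?_)
        fun x _ y _ h => Units.ext (Prod.mk.inj h).1
      rintro _ ⟨u, ⟨b, hb⟩, rfl⟩
      refine ⟨?_, ?_⟩
      · change M u ((1 - u) * p)
        rwa [← hcomm _ _ hb]
      · simp only [norm_mul]
        gcongr
        calc ‖1 - (u : ℂ)‖ ≤ ‖(1 : ℂ)‖ + ‖(u : ℂ)‖ := norm_sub_le _ _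
          _ = 2 := by rw [hM.norm hb]; norm_num
    exact this.to_subtype
  have hk : Nat.card K ≠ 0 := Nat.card_pos.ne'
  have : NeZero (Nat.card K) := ⟨hk⟩
  have hKle : K ≤ rootsOfUnity (Nat.card K) ℂ := by
    intro u hu
    rw [mem_rootsOfUnity]
    have := pow_card_eq_one' (x := (⟨u, hu⟩ : K))
    exact congrArg Subtype.val this
  have hKeq : K = rootsOfUnity (Nat.card K) ℂ := by
    refine SetLike.coe_injective (Set.eq_of_subset_of_ncard_le hKle ?_ ?_)
    · change (rootsOfUnity (Nat.card K) ℂ : Set ℂˣ).ncard ≤ (K : Set ℂˣ).ncard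
      rw [← Nat.card_coe_set_eq, ← Nat.card_coe_set_eq]
      have := Complex.card_rootsOfUnity (Nat.card K)
      exact this.le
    · exact (inferInstanceAs (Finite (rootsOfUnity (Nat.card K) ℂ)))
  refine ⟨Nat.card K, Nat.one_le_iff_ne_zero.2 hk, fun a => ⟨fun h => ?_, fun h => ?_⟩⟩
  · obtain ⟨b, hb⟩ := id h
    have : Units.mk0 a (hM.ne_zero hb) ∈ rootsOfUnity (Nat.card K) ℂ := hKle h
    rw [mem_rootsOfUnity] at this
    simpa using congrArg Units.val this
  · have ha0 : a ≠ 0 := by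
      rintro rfl
      simp [hk] at h
    have : Units.mk0 a ha0 ∈ K := by
      rw [hKeq, mem_rootsOfUnity]
      ext
      simpa using h
    exact this

end IsEuclidean

namespace IsEuclidean

/-! ### Lattices and their rotations -/

variable {M : ℂ → ℂ → Prop}

theorem exists_int_of_im_eq_zero (hM : IsEuclidean M) (h1 : M 1 1)
    (hmin : ∀ b, M 1 b → b ≠ 0 → 1 ≤ ‖b‖) {b : ℂ} (hb : M 1 b) (him : b.im = 0) :
    ∃ n : ℤ, b = n := by
  refine ⟨round b.re, ?_⟩
  by_contra hne
  have h2 : M 1 (b - round b.re) := by simpa using hM.sub hb (hM.int_mul h1 (round b.re))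
  have h3 := hmin _ h2 (sub_ne_zero.2 hne)
  have h4 : b - round b.re = ((b.re - round b.re : ℝ) : ℂ) := by
    apply Complex.ext <;> simp [him]
  rw [h4, Complex.norm_real, Real.norm_eq_abs] at h3
  linarith [abs_sub_round b.re]

/-- Lattice reduction: rounding the coordinates of `b` in the real basis `1, t` leaves a translation
with coordinates at most `1 / 2`, which is too short unless it vanishes. -/
theorem exists_eq_add_mul (hM : IsEuclidean M) (h1 : M 1 1)
    (hmin : ∀ b, M 1 b → b ≠ 0 → 1 ≤ ‖b‖) {t : ℂ} (ht : M 1 t) (hti : t.im ≠ 0)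
    (htmin : ∀ b, M 1 b → b.im ≠ 0 → ‖t‖ ≤ ‖b‖) (b : ℂ) :
    M 1 b ↔ ∃ m n : ℤ, m + n * t = b := by
  refine ⟨fun hb => ?_, ?_⟩
  · set y : ℝ := b.im / t.im with hy
    set x : ℝ := b.re - y * t.re with hx
    have hbx : b = x + y * t := by
      apply Complex.ext
      · simp [hx]
      · simp [hy, hti]
    refine ⟨round x, round y, ?_⟩
    set c : ℂ := b - (round x + round y * t) with hc
    have hcM : M 1 c := by
      refine hM.sub hb (hM.add ?_ (hM.int_mul ht _))
      simpa using hM.int_mul h1 (round x)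
    set u : ℝ := x - round x with hu
    set v : ℝ := y - round y with hv
    have hcu : c = u + v * t := by
      rw [hc, hbx, hu, hv]
      push_cast
      ring
    have hu2 : |u| ≤ 1 / 2 := abs_sub_round x
    have hv2 : |v| ≤ 1 / 2 := abs_sub_round y
    have hcim : c.im = v * t.im := by rw [hcu]; simp
    have hcre : c.re = u + v * t.re := by rw [hcu]; simp
    by_cases hv0 : v = 0
    · have hc0 : c = 0 := by
        by_contra hc0
        have := hmin c hcM hc0
        rw [hcu, hv0] at this
        simp only [Complex.ofReal_zero, zero_mul, add_zero, Complex.norm_real,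
          Real.norm_eq_abs] at this
        linarith
      linear_combination -hc0
    · exfalso
      have h2 := htmin c hcM (by rw [hcim]; exact mul_ne_zero hv0 hti)
      have h3 := hmin t ht (by rintro rfl; simp at hti)
      have h4 : ‖t‖ ^ 2 ≤ ‖c‖ ^ 2 := pow_le_pow_left₀ (norm_nonneg _) h2 2
      have h5 : (1 : ℝ) ≤ ‖t‖ ^ 2 := one_le_pow₀ h3
      rw [← Complex.normSq_eq_norm_sq, ← Complex.normSq_eq_norm_sq, Complex.normSq_apply,
        Complex.normSq_apply, hcre, hcim] at h4
      rw [← Complex.normSq_eq_norm_sq, Complex.normSq_apply] at h5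
      have hp : 0 < t.im ^ 2 := by positivity
      obtain ⟨hu3, hu4⟩ := abs_le.1 hu2
      obtain ⟨hv3, hv4⟩ := abs_le.1 hv2
      have hu5 : u ^ 2 ≤ 1 / 4 := by nlinarith
      have hv5 : v ^ 2 ≤ 1 / 4 := by nlinarith
      -- With `u², v² ≤ 1/4` this yields `‖c‖² ≤ 1/2 + ‖t‖²/2 - t.im²/4`, strictly less than `‖t‖²`
      -- because `‖t‖ ≥ 1` and `t.im ≠ 0`.
      have e1 : (u + v * t.re) * (u + v * t.re) ≤ 2 * u ^ 2 + 2 * (v ^ 2 * t.re ^ 2) := by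
        nlinarith [sq_nonneg (u - v * t.re)]
      nlinarith [mul_le_mul_of_nonneg_right hv5 (sq_nonneg t.re),
        mul_le_mul_of_nonneg_right hv5 hp.le]
  · rintro ⟨m, n, rfl⟩
    exact hM.add (by simpa using hM.int_mul h1 m) (hM.int_mul ht n)

theorem exists_periodPair (hM : IsEuclidean M) (h1 : M 1 1)
    (hmin : ∀ b, M 1 b → b ≠ 0 → 1 ≤ ‖b‖) {t : ℂ} (ht : M 1 t) (hti : t.im ≠ 0)
    (htmin : ∀ b, M 1 b → b.im ≠ 0 → ‖t‖ ≤ ‖b‖) :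
    ∃ L : PeriodPair, L.ω₁ = 1 ∧ L.ω₂ = t ∧ ∀ b, M 1 b ↔ b ∈ L.lattice := by
  have hind : LinearIndependent ℝ ![(1 : ℂ), t] := by
    rw [LinearIndependent.pair_iff]
    intro x y h
    have hi := congrArg Complex.im h
    have hr := congrArg Complex.re h
    simp [hti] at hi hr
    subst hi
    simpa using hr
  refine ⟨⟨1, t, hind⟩, rfl, rfl, fun b => ?_⟩
  rw [hM.exists_eq_add_mul h1 hmin ht hti htmin, PeriodPair.mem_lattice]
  simp

theorem linear_translation (hM : IsEuclidean M) (h1 : M 1 1) {a : ℂ} (ha : Linear M a) : M 1 a := by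
  obtain ⟨b, hb⟩ := ha
  simpa using hM.smul hb h1

/-- The crystallographic restriction. Rotating the translation `1` by `a` and `a⁻¹ = conj a` and
adding gives the real translation `2 Re a`, an integer in `[-2, 2]`; the extreme values force `a =
-1` or `a = 1`. -/
theorem exists_int_trace (hM : IsEuclidean M) (h1 : M 1 1)
    (hmin : ∀ b, M 1 b → b ≠ 0 → 1 ≤ ‖b‖) {a : ℂ} (ha : Linear M a) :
    ∃ n : ℤ, a ^ 2 - n * a + 1 = 0 ∧ 2 * a.re = n ∧ (a ^ 2 = 1 ∨ n = -1 ∨ n = 0 ∨ n = 1) := by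
  obtain ⟨b, hb⟩ := id ha
  have hnorm := hM.norm hb
  have hinv : a⁻¹ = (starRingEnd ℂ) a := by
    rw [Complex.inv_def, Complex.normSq_eq_norm_sq, hnorm]
    simp
  have htr := hM.add (hM.linear_translation h1 ha) (hM.linear_translation h1 (hM.linear_inv ha))
  obtain ⟨n, hn⟩ := hM.exists_int_of_im_eq_zero h1 hmin htr (by rw [hinv]; simp)
  have ha0 := hM.ne_zero hb
  have h2 : a ^ 2 - n * a + 1 = 0 := by
    rw [← hn]
    field_simp
    ring
  have h3 : 2 * a.re = n := by
    have := congrArg Complex.re hn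
    rw [hinv] at this
    simp at this
    linarith
  refine ⟨n, h2, h3, ?_⟩
  have h4 : |a.re| ≤ 1 := hnorm ▸ Complex.abs_re_le_norm a
  obtain ⟨h5, h6⟩ := abs_le.1 h4
  have h7 : -2 ≤ n := by
    have : (-2 : ℝ) ≤ n := by linarith
    exact_mod_cast this
  have h8 : n ≤ 2 := by
    have : (n : ℝ) ≤ 2 := by linarith
    exact_mod_cast this
  interval_cases n
  · left
    have : (a + 1) ^ 2 = 0 := by linear_combination h2
    linear_combination (a - 1) * (pow_eq_zero_iff two_ne_zero).1 this
  · simp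
  · simp
  · simp
  · left
    have : (a - 1) ^ 2 = 0 := by linear_combination h2
    linear_combination (a + 1) * (pow_eq_zero_iff two_ne_zero).1 this

theorem linear_of_sq (hM : IsEuclidean M) (h : ∀ a, Linear M a → a ^ 2 = 1) :
    ∃ k : ℕ, (k = 1 ∨ k = 2) ∧ ∀ a, Linear M a ↔ a ^ k = 1 := by
  by_cases hneg : Linear M (-1)
  · refine ⟨2, Or.inr rfl, fun a => ⟨h a, fun ha => ?_⟩⟩
    rcases sq_eq_one_iff.1 ha with rfl | rfl
    · exact hM.linear_one
    · exact hneg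
  · refine ⟨1, Or.inl rfl, fun a => ⟨fun ha => ?_, fun ha => ?_⟩⟩
    · rcases sq_eq_one_iff.1 (h a ha) with rfl | rfl
      · simp
      · exact (hneg ha).elim
    · rw [pow_one] at ha
      rw [ha]
      exact hM.linear_one

/-- A cube root of unity. -/
def cubeRoot : ℂ := Complex.exp (2 * Real.pi * Complex.I / 3)

theorem isPrimitiveRoot_cubeRoot : IsPrimitiveRoot cubeRoot 3 := by
  simpa [cubeRoot] using Complex.isPrimitiveRoot_exp 3 three_ne_zero

theorem cubeRoot_sq : cubeRoot ^ 2 + cubeRoot + 1 = 0 := by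
  have h := isPrimitiveRoot_cubeRoot
  have h1 : cubeRoot - 1 ≠ 0 := sub_ne_zero.2 (h.ne_one (by norm_num))
  have h2 : (cubeRoot - 1) * (cubeRoot ^ 2 + cubeRoot + 1) = 0 := by
    linear_combination h.pow_eq_one
  exact (mul_eq_zero.1 h2).resolve_left h1

theorem cubeRoot_im : cubeRoot.im ≠ 0 := by
  intro h
  have h1 := congrArg Complex.re cubeRoot_sq
  simp [pow_two, h] at h1
  nlinarith [sq_nonneg (cubeRoot.re + 1 / 2)]

theorem cubeRoot_re : 2 * cubeRoot.re = -1 := by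
  have h1 := congrArg Complex.im cubeRoot_sq
  simp [pow_two] at h1
  have h2 : cubeRoot.im * (2 * cubeRoot.re + 1) = 0 := by linear_combination h1
  linarith [(mul_eq_zero.1 h2).resolve_left cubeRoot_im]

/-- If `a ^ 2 ≠ 1` the trace of `a` is `-1`, `0` or `1`: then respectively `a` is a primitive cube
root of unity, `a = ± i`, or `a ^ 2` is a primitive cube root of unity. -/
theorem linear_cases (hM : IsEuclidean M) (h1 : M 1 1) (hmin : ∀ b, M 1 b → b ≠ 0 → 1 ≤ ‖b‖) :
    (∀ a, Linear M a → a ^ 2 = 1) ∨ Linear M Complex.I ∨ Linear M cubeRoot := by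
  by_contra! h
  obtain ⟨⟨a, ha, ha2⟩, hI, hj⟩ := h
  have key : ∀ c, Linear M c → c ^ 2 + c + 1 = 0 → False := by
    intro c hc h
    have h2 : (c - cubeRoot) * (c - cubeRoot ^ 2) = 0 := by
      linear_combination h + (cubeRoot - 1 - c) * cubeRoot_sq
    rcases mul_eq_zero.1 h2 with h3 | h3
    · exact hj (sub_eq_zero.1 h3 ▸ hc)
    · refine hj ?_
      have := hM.linear_pow hc 2
      rwa [sub_eq_zero.1 h3, show (cubeRoot ^ 2) ^ 2 = cubeRoot by
        linear_combination cubeRoot * isPrimitiveRoot_cubeRoot.pow_eq_one] at this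
  obtain ⟨n, hn, -, hcases⟩ := hM.exists_int_trace h1 hmin ha
  rcases hcases with h2 | rfl | rfl | rfl
  · exact ha2 h2
  · exact key a ha (by simpa using hn)
  · have h3 : a ^ 2 = Complex.I ^ 2 := by
      rw [Complex.I_sq]
      linear_combination hn
    rcases sq_eq_sq_iff_eq_or_eq_neg.1 h3 with rfl | rfl
    · exact hI ha
    · exact hI (by simpa using hM.linear_inv ha)
  · refine key (a ^ 2) (hM.linear_pow ha 2) ?_
    linear_combination (a ^ 2 + a + 1) * hn

/-- A linear part is itself a Gaussian integer, so its trace is even, which excludes orders three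
and six. -/
theorem linear_of_I (hM : IsEuclidean M) (h1 : M 1 1) (hmin : ∀ b, M 1 b → b ≠ 0 → 1 ≤ ‖b‖)
    (hI : Linear M Complex.I) : ∃ L : PeriodPair, L.ω₁ = 1 ∧ L.ω₂ = Complex.I ∧
      (∀ b, M 1 b ↔ b ∈ L.lattice) ∧ ∀ a, Linear M a ↔ a ^ 4 = 1 := by
  obtain ⟨L, hL1, hL2, hL⟩ := hM.exists_periodPair h1 hmin (hM.linear_translation h1 hI) (by simp)
    fun b hb hb0 => by
      rw [Complex.norm_I]
      exact hmin b hb (by rintro rfl; simp at hb0)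
  refine ⟨L, hL1, hL2, hL, fun a => ⟨fun ha => ?_, fun ha => ?_⟩⟩
  · obtain ⟨n, hn, hre, hcases⟩ := hM.exists_int_trace h1 hmin ha
    obtain ⟨x, y, hxy⟩ := PeriodPair.mem_lattice.1 ((hL a).1 (hM.linear_translation h1 ha))
    have hx : a.re = x := by
      rw [← hxy, hL1, hL2]
      simp
    have hnx : n = 2 * x := by
      have : (n : ℝ) = 2 * x := by rw [← hre, hx]
      exact_mod_cast this
    rcases hcases with h | h | h | h
    · linear_combination (a ^ 2 + 1) * h
    · omega
    · rw [h] at hn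
      push_cast at hn
      linear_combination (a ^ 2 - 1) * hn
    · omega
  · have hprim : IsPrimitiveRoot Complex.I 4 := Complex.isPrimitiveRoot_I
    obtain ⟨i, -, rfl⟩ := hprim.eq_pow_of_pow_eq_one ha
    exact hM.linear_pow hI i

/-- A rotation of order four would make the translations Gaussian integers, but `2 Re j = -1` is
odd. So all linear parts are sixth roots of unity, and the order is six or three according to
whether `-1` occurs. -/
theorem linear_of_cubeRoot (hM : IsEuclidean M) (h1 : M 1 1)
    (hmin : ∀ b, M 1 b → b ≠ 0 → 1 ≤ ‖b‖) (hj : Linear M cubeRoot) :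
    ∃ L : PeriodPair, L.ω₁ = 1 ∧ L.ω₂ = cubeRoot ∧ (∀ b, M 1 b ↔ b ∈ L.lattice) ∧
      ((∀ a, Linear M a ↔ a ^ 3 = 1) ∨ ∀ a, Linear M a ↔ a ^ 6 = 1) := by
  have hjn : ‖cubeRoot‖ = 1 := by
    obtain ⟨b, hb⟩ := hj
    exact hM.norm hb
  obtain ⟨L, hL1, hL2, hL⟩ := hM.exists_periodPair h1 hmin (hM.linear_translation h1 hj)
    cubeRoot_im fun b hb hb0 => by
      rw [hjn]
      exact hmin b hb (by rintro rfl; simp at hb0)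
  have hno : ∀ a, Linear M a → a ^ 2 ≠ -1 := by
    intro a ha h
    have hI : Linear M Complex.I := by
      rw [← Complex.I_sq] at h
      rcases sq_eq_sq_iff_eq_or_eq_neg.1 h with rfl | rfl
      · exact ha
      · simpa using hM.linear_inv ha
    obtain ⟨L', h1', h2', hL', -⟩ := hM.linear_of_I h1 hmin hI
    obtain ⟨x, y, hxy⟩ := PeriodPair.mem_lattice.1 ((hL' _).1 (hM.linear_translation h1 hj))
    have hx := congrArg Complex.re hxy
    rw [h1', h2'] at hx
    simp at hx
    have := cubeRoot_re
    rw [← hx] at this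
    have : 2 * x = -1 := by exact_mod_cast this
    omega
  have h6 : ∀ a, Linear M a → a ^ 6 = 1 := by
    intro a ha
    obtain ⟨n, hn, -, hcases⟩ := hM.exists_int_trace h1 hmin ha
    rcases hcases with h | h | h | h
    · linear_combination (a ^ 4 + a ^ 2 + 1) * h
    · rw [h] at hn
      push_cast at hn
      linear_combination (a ^ 3 + 1) * (a - 1) * hn
    · rw [h] at hn
      push_cast at hn
      exact (hno a ha (by linear_combination hn)).elim
    · rw [h] at hn
      push_cast at hn
      linear_combination (a ^ 3 - 1) * (a + 1) * hn
  have h3 : ∀ a, a ^ 3 = 1 → Linear M a := by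
    intro a ha
    obtain ⟨i, -, rfl⟩ := isPrimitiveRoot_cubeRoot.eq_pow_of_pow_eq_one ha
    exact hM.linear_pow hj i
  have hpm : ∀ a : ℂ, a ^ 6 = 1 → a ^ 3 = 1 ∨ a ^ 3 = -1 := by
    intro a ha
    refine sq_eq_one_iff.1 ?_
    linear_combination ha
  refine ⟨L, hL1, hL2, hL, ?_⟩
  by_cases hneg : Linear M (-1)
  · refine Or.inr fun a => ⟨h6 a, fun ha => ?_⟩
    rcases hpm a ha with h | h
    · exact h3 a h
    · have := hM.linear_mul hneg (h3 (-a) (by linear_combination -h))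
      simpa using this
  · refine Or.inl fun a => ⟨fun ha => ?_, h3 a⟩
    rcases hpm a (h6 a ha) with h | h
    · exact h
    · exact (hneg (h ▸ hM.linear_pow ha 3)).elim

theorem translation_cases (hM : IsEuclidean M) (h1 : M 1 1)
    (hmin : ∀ b, M 1 b → b ≠ 0 → 1 ≤ ‖b‖) :
    (∃ k : ℕ, (k = 1 ∨ k = 2) ∧ (∀ a, Linear M a ↔ a ^ k = 1) ∧
      ((∀ b, M 1 b ↔ b ∈ Set.range ((↑) : ℤ → ℂ)) ∨
        ∃ L : PeriodPair, L.ω₁ = 1 ∧ 0 < L.ω₂.im ∧ ∀ b, M 1 b ↔ b ∈ L.lattice)) ∨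
    (∃ L : PeriodPair, L.ω₁ = 1 ∧ L.ω₂ = Complex.I ∧
      (∀ b, M 1 b ↔ b ∈ L.lattice) ∧ ∀ a, Linear M a ↔ a ^ 4 = 1) ∨
    ∃ L : PeriodPair, L.ω₁ = 1 ∧ L.ω₂ = cubeRoot ∧ (∀ b, M 1 b ↔ b ∈ L.lattice) ∧
      ((∀ a, Linear M a ↔ a ^ 3 = 1) ∨ ∀ a, Linear M a ↔ a ^ 6 = 1) := by
  rcases hM.linear_cases h1 hmin with h | h | h
  · obtain ⟨k, hk, hlin⟩ := hM.linear_of_sq h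
    refine Or.inl ⟨k, hk, hlin, ?_⟩
    by_cases hreal : ∀ b, M 1 b → b.im = 0
    · refine Or.inl fun b => ⟨fun hb => ?_, ?_⟩
      · obtain ⟨n, rfl⟩ := hM.exists_int_of_im_eq_zero h1 hmin hb (hreal b hb)
        exact ⟨n, rfl⟩
      · rintro ⟨n, rfl⟩
        simpa using hM.int_mul h1 n
    · push Not at hreal
      obtain ⟨t, ⟨ht, hti⟩, htmin⟩ := hM.exists_shortest (S := {b | M 1 b ∧ b.im ≠ 0}) hreal
        fun b hb => hb.1
      rcases lt_or_gt_of_ne hti with hlt | hgt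
      · obtain ⟨L, hL1, hL2, hL⟩ := hM.exists_periodPair h1 hmin (t := -t) (hM.neg ht)
          (by simpa using hti) fun b hb hb0 => by
            rw [norm_neg]
            exact htmin b ⟨hb, hb0⟩
        exact Or.inr ⟨L, hL1, by rw [hL2]; simpa using hlt, hL⟩
      · obtain ⟨L, hL1, hL2, hL⟩ := hM.exists_periodPair h1 hmin ht hti fun b hb hb0 =>
          htmin b ⟨hb, hb0⟩
        exact Or.inr ⟨L, hL1, by rw [hL2]; exact hgt, hL⟩
  · exact Or.inr (Or.inl (hM.linear_of_I h1 hmin h))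
  · exact Or.inr (Or.inr (hM.linear_of_cubeRoot h1 hmin h))

end IsEuclidean

/-! ### The group of a quotient of a dilation -/

/-- The coefficients of the elements of a group of affine maps. -/
def Coeff (G : Subgroup (ℂ ≃ᵃ[ℂ] ℂ)) (a b : ℂ) : Prop := ∃ γ ∈ G, ∀ z, γ z = a * z + b

theorem coeff_iff {G : Subgroup (ℂ ≃ᵃ[ℂ] ℂ)} {γ : ℂ ≃ᵃ[ℂ] ℂ} {a b : ℂ}
    (h : ∀ z, γ z = a * z + b) : Coeff G a b ↔ γ ∈ G := by
  refine ⟨?_, fun hγ => ⟨γ, hγ, h⟩⟩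
  rintro ⟨δ, hδ, hδe⟩
  rwa [show γ = δ from AffineEquiv.ext fun z => (h z).trans (hδe z).symm]

namespace IsQuotientOfDilation

variable {R : RatFunc ℂ} {lam : ℂ} {G : Subgroup (ℂ ≃ᵃ[ℂ] ℂ)} {Ψ : ℂ → Sphere}

/-- A discrete group of affine maps is countable, so the plane cannot be a single orbit. -/
theorem nonconst (hQ : IsQuotientOfDilation R lam G Ψ) : ∃ z w, Ψ z ≠ Ψ w := by
  by_contra! h
  have hcount : {p : ℂ × ℂ | Coeff G p.1 p.2}.Countable :=
    (HereditarilyLindelofSpace.isLindelof _).countable_of_isDiscrete hQ.discrete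
  have himg := hcount.image Prod.snd
  have huniv : Prod.snd '' {p : ℂ × ℂ | Coeff G p.1 p.2} = Set.univ := by
    refine Set.eq_univ_of_forall fun w => ?_
    obtain ⟨γ, hγ, he⟩ := (hQ.fibres 0 w).1 (h 0 w)
    obtain ⟨a, b, -, hab⟩ := exists_affine_eq γ
    refine ⟨(a, b), ⟨γ, hγ, hab⟩, ?_⟩
    rw [← he, hab]
    simp
  rw [huniv] at himg
  exact not_countable_complex himg

theorem nonconst_ratFunc (hQ : IsQuotientOfDilation R lam G Ψ) : ¬ ∃ c, R = RatFunc.C c := by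
  rintro ⟨c, rfl⟩
  obtain ⟨z, w, hzw⟩ := hQ.nonconst
  have h : ∀ z, Ψ z = c := by
    intro z
    have := hQ.semiconj (z / lam)
    rwa [mul_div_cancel₀ _ hQ.lam_ne_zero, ratMap_C, eq_comm] at this
  exact hzw ((h z).trans (h w).symm)

theorem invariant (hQ : IsQuotientOfDilation R lam G Ψ) {γ : ℂ ≃ᵃ[ℂ] ℂ} (hγ : γ ∈ G) (z : ℂ) :
    Ψ (γ z) = Ψ z :=
  ((hQ.fibres z (γ z)).2 ⟨γ, hγ, rfl⟩).symm

theorem isEuclidean (hQ : IsQuotientOfDilation R lam G Ψ) : IsEuclidean (Coeff G) where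
  one := ⟨1, G.one_mem, fun z => by simp⟩
  mul {a b c d} := by
    rintro ⟨γ, hγ, h1⟩ ⟨δ, hδ, h2⟩
    refine ⟨γ * δ, G.mul_mem hγ hδ, fun z => ?_⟩
    rw [affine_mul_apply, h1, h2]
    ring
  inv {a b} := by
    rintro ⟨γ, hγ, h⟩
    refine ⟨γ⁻¹, G.inv_mem hγ, fun z => γ.injective ?_⟩
    have ha : a ≠ 0 := by
      rintro rfl
      exact zero_ne_one (γ.injective (by simp [h] : γ 0 = γ 1))
    rw [affine_apply_inv_apply, h]
    field_simp
    ring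
  norm {a b} := by
    rintro ⟨γ, hγ, h⟩
    have ha : a ≠ 0 := by
      rintro rfl
      exact zero_ne_one (γ.injective (by simp [h] : γ 0 = γ 1))
    exact norm_eq_one_of_invariant hQ.holomorphic hQ.nonconst ha fun z => by
      rw [← h, hQ.invariant hγ]
  discrete := by
    have h1 : ((1 : ℂ), (0 : ℂ)) ∈ {p : ℂ × ℂ | ∃ γ ∈ G, ∀ z, γ z = p.1 * z + p.2} :=
      ⟨1, G.one_mem, fun z => by simp⟩
    have h2 := (isDiscrete_iff_nhdsWithin.1 hQ.discrete) _ h1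
    have h3 : ∀ᶠ q in 𝓝[{p : ℂ × ℂ | ∃ γ ∈ G, ∀ z, γ z = p.1 * z + p.2}] ((1 : ℂ), (0 : ℂ)),
        q = (1, 0) := by
      rw [h2]
      exact eventually_pure.2 rfl
    obtain ⟨δ, hδ, h⟩ := Metric.eventually_nhds_iff.1 (eventually_nhdsWithin_iff.1 h3)
    refine ⟨δ, hδ, fun a b hab ha hb => ?_⟩
    have := @h (a, b) (by
      rw [Prod.dist_eq, max_lt_iff, dist_eq_norm, dist_eq_norm, sub_zero]
      exact ⟨ha, hb⟩) hab
    exact Prod.mk.inj this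

end IsQuotientOfDilation

/-! ### Normalization of the group and of the quotient map -/

/-- The possible translation subgroups and orders of rotations. -/
inductive LatticeType (Λ : Set ℂ) (k : ℕ) : Prop
  | trivial (h : Λ = {0})
  | int (h : Λ = Set.range ((↑) : ℤ → ℂ)) (hk : k = 1 ∨ k = 2)
  | lattice (L : PeriodPair) (h : Λ = L.lattice) (h₁ : L.ω₁ = 1)
      (hk : (0 < L.ω₂.im ∧ (k = 1 ∨ k = 2)) ∨ (L.ω₂ = Complex.I ∧ k = 4) ∨
        (L.ω₂ = Complex.exp (2 * Real.pi * Complex.I / 3) ∧ (k = 3 ∨ k = 6)))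

/-- `Φ` presents the sphere as the quotient of `ℂ` by the group of the maps `z ↦ ε z + b` with
`ε ^ k = 1` and `b ∈ Λ`, and `R` is covered by `z ↦ lam * z + (lam - 1) * c`. -/
structure Uniformizes (R : RatFunc ℂ) (lam c : ℂ) (Λ : Set ℂ) (k : ℕ) (Φ : ℂ → Sphere) : Prop where
  lam_ne_zero : lam ≠ 0
  pos : 1 ≤ k
  -- Moving the center of rotation to the origin turns the dilation into `lam * z + (lam - 1) * c`.
  -- Without rotations the origin need not move.
  center : k = 1 → c = 0
  holomorphic : ∀ z, HolAt Φ z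
  nonconst : ∃ z w, Φ z ≠ Φ w
  fibres : ∀ z w, Φ z = Φ w ↔ ∃ ε b, ε ^ k = 1 ∧ b ∈ Λ ∧ w = ε * z + b
  semiconj : ∀ z, ratMap R (Φ z) = Φ (lam * z + (lam - 1) * c)

/-- Scaling by a shortest nonzero translation makes `1` a shortest translation, the situation of
`translation_cases`. -/
theorem IsEuclidean.exists_normalization {M : ℂ → ℂ → Prop} (hM : IsEuclidean M) :
    ∃ (t : ℂ) (Λ : Set ℂ) (k : ℕ), t ≠ 0 ∧ 1 ≤ k ∧ LatticeType Λ k ∧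
      (∀ b, M 1 (t * b) ↔ b ∈ Λ) ∧ ∀ a, Linear M a ↔ a ^ k = 1 := by
  by_cases hT : ∀ b, M 1 b → b = 0
  · obtain ⟨k, hk, hlin⟩ := hM.exists_linear_of_no_translation hT
    refine ⟨1, {0}, k, one_ne_zero, hk, .trivial rfl, fun b => ⟨fun h => ?_, ?_⟩, hlin⟩
    · exact hT _ (by simpa using h)
    · rintro rfl
      simpa using hM.one
  push Not at hT
  obtain ⟨t, ⟨ht, ht0⟩, hmin⟩ := hM.exists_shortest (S := {b | M 1 b ∧ b ≠ 0}) hT fun b hb => hb.1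
  have hM' := hM.scale ht0
  have hlin' : ∀ a, Linear (fun a b => M a (t * b)) a ↔ Linear M a := by
    refine fun a => ⟨fun ⟨b, hb⟩ => ⟨_, hb⟩, fun ⟨b, hb⟩ => ⟨b / t, ?_⟩⟩
    change M a (t * (b / t))
    rwa [mul_div_cancel₀ _ ht0]
  have hmin' : ∀ b, M 1 (t * b) → b ≠ 0 → 1 ≤ ‖b‖ := by
    intro b hb hb0
    have := hmin _ ⟨hb, mul_ne_zero ht0 hb0⟩
    rw [norm_mul] at this
    exact le_of_mul_le_mul_left (by simpa using this) (norm_pos_iff.2 ht0)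
  rcases hM'.translation_cases (by simpa using ht) hmin' with
    ⟨k, hk, hlin, h | ⟨L, hL1, hL2, hL⟩⟩ | ⟨L, hL1, hL2, hL, hlin⟩ | ⟨L, hL1, hL2, hL, hlin⟩
  · exact ⟨t, _, k, ht0, by omega, .int rfl hk, h, fun a => (hlin' a).symm.trans (hlin a)⟩
  · exact ⟨t, _, k, ht0, by omega, .lattice L rfl hL1 (Or.inl ⟨hL2, hk⟩), hL,
      fun a => (hlin' a).symm.trans (hlin a)⟩
  · exact ⟨t, _, 4, ht0, by omega, .lattice L rfl hL1 (Or.inr (Or.inl ⟨hL2, rfl⟩)), hL,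
      fun a => (hlin' a).symm.trans (hlin a)⟩
  · rcases hlin with hlin | hlin
    · exact ⟨t, _, 3, ht0, by omega, .lattice L rfl hL1 (Or.inr (Or.inr ⟨hL2, Or.inl rfl⟩)), hL,
        fun a => (hlin' a).symm.trans (hlin a)⟩
    · exact ⟨t, _, 6, ht0, by omega, .lattice L rfl hL1 (Or.inr (Or.inr ⟨hL2, Or.inr rfl⟩)), hL,
        fun a => (hlin' a).symm.trans (hlin a)⟩

theorem IsRotationTranslationGroup.coeff_iff {G : Subgroup (ℂ ≃ᵃ[ℂ] ℂ)} {Λ : Set ℂ} {k : ℕ}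
    (h : ∀ a b, a ≠ 0 → (Coeff G a b ↔ a ^ k = 1 ∧ b ∈ Λ)) : IsRotationTranslationGroup G Λ k := by
  intro γ
  constructor
  · intro hγ
    obtain ⟨a, b, ha, hab⟩ := exists_affine_eq γ
    obtain ⟨h1, h2⟩ := (h a b ha).1 ⟨γ, hγ, hab⟩
    exact ⟨a, b, h1, h2, hab⟩
  · rintro ⟨a, b, h1, h2, hab⟩
    have ha : a ≠ 0 := by
      rintro rfl
      exact zero_ne_one (γ.injective (by simp [hab] : γ 0 = γ 1))
    exact (DGroupoid.coeff_iff hab).1 ((h a b ha).2 ⟨h1, h2⟩)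

theorem mem_map_conj {G : Subgroup (ℂ ≃ᵃ[ℂ] ℂ)} {A γ : ℂ ≃ᵃ[ℂ] ℂ} :
    γ ∈ G.map (MulAut.conj A⁻¹).toMonoidHom ↔ A * γ * A⁻¹ ∈ G := by
  rw [Subgroup.mem_map]
  constructor
  · rintro ⟨δ, hδ, rfl⟩
    simpa [mul_assoc] using hδ
  · intro h
    exact ⟨_, h, by simp [mul_assoc]⟩

/-- Take `A z = t z + p`, with `t` the scale and `p` the common center of rotation. Conjugating the
dilation by `A` gives the constant `c = p / t`. -/
theorem IsQuotientOfDilation.exists_uniformizes {R : RatFunc ℂ} {lam : ℂ}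
    {G : Subgroup (ℂ ≃ᵃ[ℂ] ℂ)} {Ψ : ℂ → Sphere} (hQ : IsQuotientOfDilation R lam G Ψ) :
    ∃ (A : ℂ ≃ᵃ[ℂ] ℂ) (c : ℂ) (Λ : Set ℂ) (k : ℕ), LatticeType Λ k ∧
      IsRotationTranslationGroup (G.map (MulAut.conj A⁻¹).toMonoidHom) Λ k ∧
      Uniformizes R lam c Λ k (fun z => Ψ (A z)) := by
  have hM := hQ.isEuclidean
  obtain ⟨t, Λ, k, ht, hk, htype, hΛ, hlin⟩ := hM.exists_normalization
  obtain ⟨p, hp, hMp⟩ := hM.exists_center hk hlin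
  have hA : ∀ z, affine t p ht z = t * z + p := affine_apply ht
  set A := affine t p ht
  have hAinv : ∀ w, A⁻¹ w = (w - p) / t := by
    intro w
    apply A.injective
    rw [affine_apply_inv_apply, hA]
    field_simp
    ring
  have hgroup : IsRotationTranslationGroup (G.map (MulAut.conj A⁻¹).toMonoidHom) Λ k := by
    refine IsRotationTranslationGroup.coeff_iff fun a b ha => ?_
    have h1 : ∀ z, (A * affine a b ha * A⁻¹) z = a * z + (t * b - (a - 1) * p) := by
      intro z
      rw [affine_mul_apply, affine_mul_apply, hAinv, affine_apply ha, hA]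
      field_simp
      ring
    rw [DGroupoid.coeff_iff (affine_apply ha), mem_map_conj, ← DGroupoid.coeff_iff h1, hMp,
      sub_add_cancel, hΛ]
  refine ⟨A, p / t, Λ, k, htype, hgroup, hQ.lam_ne_zero, hk, fun h => by simp [hp h],
    fun z => ?_, ?_, fun z w => ?_, fun z => ?_⟩
  · refine HolAt.comp (g := fun z => A z) (hQ.holomorphic _) ?_
    simp only [hA]
    fun_prop
  · obtain ⟨z, w, h⟩ := hQ.nonconst
    exact ⟨A⁻¹ z, A⁻¹ w, by rwa [affine_apply_inv_apply, affine_apply_inv_apply]⟩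
  · rw [hQ.fibres]
    constructor
    · rintro ⟨γ, hγ, he⟩
      obtain ⟨ε, b, h1, h2, h3⟩ := (hgroup (A⁻¹ * γ * A)).1
        (mem_map_conj.2 (by simpa [mul_assoc] using hγ))
      refine ⟨ε, b, h1, h2, ?_⟩
      rw [← h3]
      apply A.injective
      rw [affine_mul_apply, affine_mul_apply, affine_apply_inv_apply, he]
    · rintro ⟨ε, b, h1, h2, rfl⟩
      have hε : ε ≠ 0 := by
        rintro rfl
        simp [show k ≠ 0 by omega] at h1
      refine ⟨A * affine ε b hε * A⁻¹, mem_map_conj.1 ((hgroup _).2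
        ⟨ε, b, h1, h2, affine_apply hε⟩), ?_⟩
      rw [affine_mul_apply, affine_mul_apply, affine_apply hε,
        show A⁻¹ (A z) = z from A.symm_apply_apply z]
  · rw [hQ.semiconj]
    congr 1
    rw [hA, hA]
    field_simp
    ring


/-! ### Injective holomorphic maps of the plane or punctured plane to the sphere -/

/-- The affine coordinate on the sphere, with value `0` at infinity. -/
def coord (x : Sphere) : ℂ := x.elim (0 : ℂ) (fun u => u)

theorem coord_coe (x : ℂ) : coord (x : Sphere) = x := rfl

theorem coe_coord {x : Sphere} (h : x ≠ ∞) : (coord x : Sphere) = x := by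
  induction x using OnePoint.rec with
  | infty => exact (h rfl).elim
  | coe x => rfl

theorem HolAt.analyticAt_coord {f : ℂ → Sphere} {z : ℂ} (hf : HolAt f z) (hz : f z ≠ ∞) :
    AnalyticAt ℂ (fun w => coord (f w)) z ∧ ∀ᶠ w in 𝓝 z, f w = (coord (f w) : Sphere) := by
  obtain ⟨F, hF, he⟩ := hf.exists_coe hz
  refine ⟨hF.congr ?_, ?_⟩
  · filter_upwards [he] with w hw
    rw [hw, coord_coe]
  · filter_upwards [he] with w hw
    rw [hw, coord_coe]

theorem HolAt.of_comp {p : ℂ → ℂ} {f : ℂ → Sphere} {z : ℂ} (hp : AnalyticAt ℂ p z)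
    (hne : ¬ ∀ᶠ w in 𝓝 z, p w = p z) (h : HolAt (fun w => f (p w)) z) : HolAt f (p z) := by
  have key : ∀ (b : ℂ → ℂ) (σ : ℂ → Sphere), AnalyticAt ℂ b z → (∀ᶠ w in 𝓝 z, f (p w) = σ (b w)) →
      (∀ u v, σ u = σ v → u = v) → ∃ B, AnalyticAt ℂ B (p z) ∧ ∀ᶠ u in 𝓝 (p z), f u = σ (B u) := by
    intro b σ hb hfb hσ
    obtain ⟨B, hB, hbB⟩ := exists_local_factor (U := {w | f (p w) = σ (b w)}) hp hb hne hfb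
      fun x hx y hy hxy => hσ _ _ (by
        have hx' : f (p x) = σ (b x) := hx
        have hy' : f (p y) = σ (b y) := hy
        rw [← hx', ← hy', hxy])
    refine ⟨B, hB, ?_⟩
    have : {u | f u = σ (B u)} ∈ map p (𝓝 z) := by
      rw [mem_map]
      filter_upwards [hfb, hbB] with w h1 h2
      change f (p w) = σ (B (p w))
      rw [h1, h2]
    exact nhds_le_map hp hne this
  by_cases hz : f (p z) = ∞
  · obtain ⟨F, hF, -, he⟩ := h.exists_inv hz
    obtain ⟨B, hB, hfB⟩ := key F (fun u => if u = 0 then ∞ else ((u⁻¹ : ℂ) : Sphere)) hF he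
      fun u v huv => by
        by_cases hu : u = 0 <;> by_cases hv : v = 0
        · rw [hu, hv]
        · simp [hu, hv] at huv
        · simp [hu, hv] at huv
        · simpa [hu, hv] using huv
    exact ⟨B, hB, Or.inr hfB⟩
  · obtain ⟨F, hF, he⟩ := h.exists_coe hz
    obtain ⟨B, hB, hfB⟩ := key F (fun u => (u : Sphere)) hF he
      fun u v huv => OnePoint.coe_injective huv
    exact ⟨B, hB, Or.inl hfB⟩

/-- A holomorphic map with the same fibres as an entire function `p` is the composition of `p` and
an injective map. -/
theorem exists_factor {p : ℂ → ℂ} {Φ : ℂ → Sphere} (hp : Differentiable ℂ p)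
    (hΦ : ∀ z, HolAt Φ z) (hne : ∃ z w, Φ z ≠ Φ w) (h : ∀ z w, Φ z = Φ w ↔ p z = p w) :
    ∃ f : ℂ → Sphere, (∀ z, f (p z) = Φ z) ∧ (∀ z, HolAt f (p z)) ∧ Set.InjOn f (Set.range p) := by
  set f : ℂ → Sphere := fun u => Φ (Function.invFun p u)
  have hf : ∀ z, f (p z) = Φ z := fun z => (h _ _).2 (Function.invFun_eq ⟨z, rfl⟩)
  refine ⟨f, hf, fun z => ?_, ?_⟩
  · refine HolAt.of_comp (hp.analyticAt z) (fun hc => ?_) ((hΦ z).congr (.of_forall hf))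
    obtain ⟨w, h1, h2⟩ := ((eventually_ne_of_ne hΦ hne z (Φ z)).and
      (hc.filter_mono nhdsWithin_le_nhds)).exists
    exact h1 ((h _ _).2 h2)
  · rintro _ ⟨z, rfl⟩ _ ⟨w, rfl⟩ hzw
    rw [hf, hf] at hzw
    exact (h _ _).1 hzw

theorem analyticAt_dslope {f : ℂ → ℂ} {z : ℂ} (hf : AnalyticAt ℂ f z) :
    AnalyticAt ℂ (dslope f z) z := by
  obtain ⟨p, hp⟩ := hf
  exact hp.has_fpower_series_dslope_fslope.analyticAt

theorem exists_analytic_of_bounded {e : ℂ → ℂ} {z : ℂ} {C : ℝ}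
    (hd : ∀ᶠ w in 𝓝[≠] z, AnalyticAt ℂ e w) (hb : ∀ᶠ w in 𝓝[≠] z, ‖e w‖ ≤ C) :
    ∃ F : ℂ → ℂ, AnalyticAt ℂ F z ∧ ∀ᶠ w in 𝓝[≠] z, e w = F w := by
  obtain ⟨s, hs, hs'⟩ := eventually_iff_exists_mem.1 (eventually_nhdsWithin_iff.1 (hd.and hb))
  refine ⟨Function.update e z (limUnder (𝓝[≠] z) e), ?_, ?_⟩
  · refine (Complex.differentiableOn_update_limUnder_of_bddAbove hs
      (fun w hw => (hs' w hw.1 hw.2).1.differentiableAt.differentiableWithinAt)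
      ⟨C, ?_⟩).analyticAt hs
    rintro _ ⟨w, hw, rfl⟩
    exact (hs' w hw.1 hw.2).2
  · filter_upwards [self_mem_nhdsWithin] with w hw
    rw [Function.update_of_ne hw]

/-- By openness all values close to infinity are taken near `1`; injectivity forbids taking them
elsewhere. -/
theorem exists_local_bound {f : ℂ → Sphere} {U : Set ℂ} (hU : U ∈ 𝓝 (1 : ℂ)) (hf : HolAt f 1)
    (hinj : Set.InjOn f U) (h1 : f 1 = ∞) {r : ℝ} (hr : 0 < r) :
    ∃ C : ℝ, ∀ z ∈ U, r ≤ ‖z - 1‖ → ‖coord (f z)‖ ≤ C := by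
  obtain ⟨F, hF, hF0, he⟩ := hf.exists_inv h1
  have hne : ¬ ∀ᶠ w in 𝓝 (1 : ℂ), F w = F 1 := by
    intro hc
    obtain ⟨w, ⟨h2, h3, h4⟩, h5⟩ := (((hc.and (he.and hU)).filter_mono nhdsWithin_le_nhds).and
      (self_mem_nhdsWithin : {1}ᶜ ∈ 𝓝[≠] (1 : ℂ))).exists
    refine h5 (hinj h4 (mem_of_mem_nhds hU) ?_)
    rw [h3, h1, h2, hF0, if_pos rfl]
  have himg := nhds_le_map hF hne (image_mem_map
    ((he.and hU).and (Metric.ball_mem_nhds (1 : ℂ) hr)))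
  rw [hF0] at himg
  obtain ⟨ρ, hρ, hsub⟩ := Metric.mem_nhds_iff.1 himg
  refine ⟨1 / ρ, fun z hz hrz => ?_⟩
  by_contra! hlt
  have hc0 : 0 < ‖coord (f z)‖ := lt_trans (by positivity) hlt
  have hmem : (coord (f z))⁻¹ ∈ Metric.ball (0 : ℂ) ρ := by
    rw [mem_ball_zero_iff, norm_inv, inv_lt_comm₀ hc0 hρ]
    simpa using hlt
  obtain ⟨w, ⟨⟨hw1, hw2⟩, hw3⟩, hw4⟩ := hsub hmem
  have hinf : f z ≠ ∞ := by
    intro h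
    rw [h] at hc0
    simp [coord] at hc0
  have hwz : w = z := by
    refine hinj hw2 hz ?_
    rw [hw1, hw4, inv_inv, if_neg (inv_ne_zero (norm_pos_iff.1 hc0)), coe_coord hinf]
  rw [hwz, dist_eq_norm] at hw3
  linarith

/-- A holomorphic injective map from the punctured plane to the sphere is a homography. -/
theorem exists_smul_eq_coe {f : ℂ → Sphere} (hf : ∀ z ≠ 0, HolAt f z)
    (hinj : Set.InjOn f {0}ᶜ) : ∃ h : GL (Fin 2) ℂ, ∀ z ≠ 0, h • f z = (z : Sphere) := by
  -- The value infinity is placed at `1`, away from the puncture, so that the map is bounded near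
  -- `0` and far away.
  obtain ⟨h₁, hh₁⟩ := exists_smul_eq_infty (f 1)
  set g : ℂ → Sphere := fun z => h₁ • f z with hg
  have hgh : ∀ z ≠ 0, HolAt g z := fun z hz => (hf z hz).smul h₁
  have hginj : Set.InjOn g {0}ᶜ := fun x hx y hy hxy => hinj hx hy (MulAction.injective h₁ hxy)
  have hU : ({0}ᶜ : Set ℂ) ∈ 𝓝 (1 : ℂ) := isOpen_compl_singleton.mem_nhds (by simp)
  have hginf : ∀ z, z ≠ 0 → z ≠ 1 → g z ≠ ∞ := fun z hz hz1 h =>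
    hz1 (hginj hz (by simp) (h.trans hh₁.symm))
  obtain ⟨C, hC⟩ := exists_local_bound hU (hgh 1 one_ne_zero) hginj hh₁ (half_pos one_pos)
  -- The pole at `1` is simple by injectivity and the singularity at `0` is removable by
  -- boundedness, so `e` extends to an entire function `E`.
  set e : ℂ → ℂ := fun z => (z - 1) * coord (g z) with he
  have hean : ∀ z, z ≠ 0 → z ≠ 1 → AnalyticAt ℂ e z := fun z hz hz1 => by
    have := ((hgh z hz).analyticAt_coord (hginf z hz hz1)).1
    fun_prop
  have hext : ∀ z, ∃ F : ℂ → ℂ, AnalyticAt ℂ F z ∧ ∀ᶠ w in 𝓝[≠] z, e w = F w := by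
    intro z
    by_cases hz : z = 0
    · subst hz
      refine exists_analytic_of_bounded (C := 3 / 2 * C) ?_ ?_
      · filter_upwards [self_mem_nhdsWithin, (isOpen_ne.eventually_mem
          (zero_ne_one (α := ℂ))).filter_mono nhdsWithin_le_nhds] with w h1 h2
        exact hean w h1 h2
      · filter_upwards [self_mem_nhdsWithin, mem_nhdsWithin_of_mem_nhds
          (Metric.ball_mem_nhds (0 : ℂ) (half_pos one_pos))] with w h1 h2
        have h3 : ‖w‖ < 1 / 2 := by simpa using h2
        have h4 : 1 / 2 ≤ ‖w - 1‖ := by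
          have := norm_sub_norm_le (1 : ℂ) w
          rw [norm_one, norm_sub_rev] at this
          linarith
        have h5 : ‖w - 1‖ ≤ 3 / 2 := by
          have := norm_sub_le w 1
          rw [norm_one] at this
          linarith
        rw [he]
        simp only [norm_mul]
        exact mul_le_mul h5 (hC w h1 h4) (norm_nonneg _) (by norm_num)
    by_cases hz1 : z = 1
    · subst hz1
      obtain ⟨F, hF, hF0, hFe⟩ := (hgh 1 one_ne_zero).exists_inv hh₁
      have hFd : deriv F 1 ≠ 0 := by
        refine deriv_ne_zero_of_injOn hF (hFe.and hU) ?_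
        rintro x ⟨hx1, hx2⟩ y ⟨hy1, hy2⟩ hxy
        exact hginj hx2 hy2 (by rw [hx1, hy1, hxy])
      have hD := analyticAt_dslope hF
      have hD0 : dslope F 1 1 ≠ 0 := by rwa [dslope_same]
      refine ⟨fun w => (dslope F 1 w)⁻¹, hD.fun_inv hD0, ?_⟩
      filter_upwards [hFe.filter_mono nhdsWithin_le_nhds, self_mem_nhdsWithin,
        (hD.continuousAt.eventually_ne hD0).filter_mono nhdsWithin_le_nhds] with w h1 h2 h3
      have h4 : w - 1 ≠ 0 := sub_ne_zero.2 h2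
      have h5 := sub_smul_dslope F 1 w
      rw [hF0, sub_zero, smul_eq_mul] at h5
      have h6 : F w ≠ 0 := h5 ▸ mul_ne_zero h4 h3
      rw [he]
      simp only [h1, if_neg h6, coord_coe]
      rw [← h5]
      field_simp
    · exact ⟨e, hean z hz hz1, .of_forall fun _ => rfl⟩
  obtain ⟨E, hE, hEe, -⟩ := exists_entire_extension hext
  have hEe' : ∀ z, z ≠ 0 → z ≠ 1 → E z = (z - 1) * coord (g z) := fun z hz hz1 =>
    hEe z (hean z hz hz1).continuousAt
  -- The quotient `(E z - E 1) / (z - 1)` is entire and bounded, hence a constant `m`, and `g z = m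
  -- + E 1 / (z - 1)` is a homography.
  have hdiff : Differentiable ℂ (dslope E 1) := fun z => by
    have h1 := (Complex.differentiableOn_dslope (f := E) (s := Set.univ) (c := 1)
      Filter.univ_mem).2 hE.differentiableOn
    exact (h1 z (Set.mem_univ z)).differentiableAt Filter.univ_mem
  obtain ⟨K, hK⟩ := (isCompact_closedBall (1 : ℂ) (1 / 2)).exists_bound_of_continuousOn
    hdiff.continuous.continuousOn
  have hC0 : 0 ≤ C := (norm_nonneg _).trans (hC (-1) (by simp) (by norm_num))
  have hbd : Bornology.IsBounded (Set.range (dslope E 1)) := by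
    refine (Metric.isBounded_closedBall (x := (0 : ℂ))
      (r := max K (max (C + 2 * ‖E 1‖) ‖dslope E 1 0‖))).subset ?_
    rintro _ ⟨z, rfl⟩
    rw [mem_closedBall_zero_iff]
    by_cases hz0 : z = 0
    · rw [hz0]
      exact le_max_of_le_right (le_max_right _ _)
    rcases le_total ‖z - 1‖ (1 / 2) with hz | hz
    · exact (hK z (by rwa [Metric.mem_closedBall, dist_eq_norm])).trans (le_max_left _ _)
    · refine le_max_of_le_right (le_max_of_le_left ?_)
      have hz1 : z ≠ 1 := by
        rintro rfl
        norm_num at hz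
      have hz1' : z - 1 ≠ 0 := sub_ne_zero.2 hz1
      have h2 : dslope E 1 z = coord (g z) - E 1 / (z - 1) := by
        rw [dslope_of_ne _ hz1, slope_def_field, hEe' z hz0 hz1]
        field_simp
      rw [h2]
      refine (norm_sub_le _ _).trans (add_le_add (hC z hz0 hz) ?_)
      rw [norm_div, div_le_iff₀ (by linarith)]
      nlinarith [norm_nonneg (E 1)]
  obtain ⟨m, hm⟩ := hdiff.exists_const_forall_eq_of_bounded hbd
  have hEm : ∀ z, E z = E 1 + (z - 1) * m := by
    intro z
    have := sub_smul_dslope E 1 z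
    rw [hm, smul_eq_mul] at this
    linear_combination -this
  have hgz : ∀ z, z ≠ 0 → z ≠ 1 → g z = ((m + E 1 / (z - 1) : ℂ) : Sphere) := by
    intro z hz hz1
    have hz1' : z - 1 ≠ 0 := sub_ne_zero.2 hz1
    rw [← coe_coord (hginf z hz hz1)]
    congr 1
    have := hEe' z hz hz1
    rw [hEm] at this
    field_simp
    linear_combination -this
  have hE1 : E 1 ≠ 0 := by
    intro h0
    have h2 := hgz 2 (by norm_num) (by norm_num)
    have h3 := hgz 3 (by norm_num) (by norm_num)
    rw [h0, zero_div, add_zero] at h2 h3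
    have := hginj (by simp) (by simp) (h2.trans h3.symm)
    norm_num at this
  have hdet : m * -1 - (E 1 - m) * 1 ≠ 0 := by
    ring_nf
    simpa using hE1
  have hgM : ∀ z, z ≠ 0 → g z = homography m (E 1 - m) 1 (-1) hdet • (z : Sphere) := by
    intro z hz
    rw [← toSphere_one z, homography_smul _ (by simp)]
    by_cases hz1 : z = 1
    · subst hz1
      rw [show (1 : ℂ) * 1 + -1 * 1 = 0 by ring, toSphere_zero]
      exact hh₁
    · have hz1' : z - 1 ≠ 0 := sub_ne_zero.2 hz1
      rw [hgz z hz hz1, toSphere_of_ne (by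
        intro h
        exact hz1' (by linear_combination h))]
      congr 1
      rw [show 1 * z + -1 * 1 = z - 1 by ring]
      field_simp
      ring
  refine ⟨(homography m (E 1 - m) 1 (-1) hdet)⁻¹ * h₁, fun z hz => ?_⟩
  rw [mul_smul, inv_smul_eq_iff]
  exact hgM z hz


/-! ### Identification of quotients by crystallographic groups -/

/-- Periodicity carries removability from the origin to all lattice points; the entire extension is
periodic, hence bounded, and Liouville's theorem applies. -/
theorem const_of_periodic (L : PeriodPair) {D : ℂ → ℂ} (hper : ∀ b ∈ L.lattice, ∀ z, D (z + b) = D z)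
    (han : ∀ z ∉ L.lattice, AnalyticAt ℂ D z)
    (h0 : ∃ F : ℂ → ℂ, AnalyticAt ℂ F 0 ∧ ∀ᶠ w in 𝓝[≠] 0, D w = F w) :
    ∃ d, ∀ z ∉ L.lattice, D z = d := by
  have hext : ∀ z, ∃ F : ℂ → ℂ, AnalyticAt ℂ F z ∧ ∀ᶠ w in 𝓝[≠] z, D w = F w := by
    intro z
    by_cases hz : z ∈ L.lattice
    · obtain ⟨F, hF, he⟩ := h0
      have ht : Tendsto (fun w => w - z) (𝓝[≠] z) (𝓝[≠] 0) := by
        have := tendsto_punctured (f := fun w => w - z) (z := z) (by fun_prop) (by simp)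
        rwa [sub_self] at this
      refine ⟨fun w => F (w - z), ?_, ?_⟩
      · exact AnalyticAt.comp (f := fun w => w - z) (by rwa [sub_self]) (by fun_prop)
      · filter_upwards [ht.eventually he] with w hw
        rw [← hw, ← hper z hz (w - z), sub_add_cancel]
    · exact ⟨D, han z hz, .of_forall fun _ => rfl⟩
  obtain ⟨E, hE, hEe, hEp⟩ := exists_entire_extension hext
  have hper' : ∀ z b, b ∈ L.lattice → E (z + b) = E z := by
    intro z b hb
    have hfe : ∀ᶠ w in 𝓝[≠] z, E (w + b) = E w := by
      have ht : Tendsto (fun w => w + b) (𝓝[≠] z) (𝓝[≠] (z + b)) :=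
        tendsto_punctured (f := fun w => w + b) (z := z) (by fun_prop) (by simp)
      filter_upwards [hEp z, ht.eventually (hEp (z + b))] with w h1 h2
      rw [h1, h2, hper b hb]
    have hc : Continuous fun w => E (w + b) := hE.continuous.comp (by fun_prop)
    exact tendsto_nhds_unique_of_eventuallyEq
      (hc.continuousAt.tendsto.mono_left nhdsWithin_le_nhds)
      (hE.continuous.continuousAt.tendsto.mono_left nhdsWithin_le_nhds) hfe
  obtain ⟨d, hd⟩ := hE.exists_const_forall_eq_of_bounded
    (IsZLattice.isCompact_range_of_periodic L.lattice E hE.continuous hper').isBounded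
  exact ⟨d, fun z hz => by rw [← hEe z (han z hz).continuousAt, hd]⟩

/-- A germ invariant under the rotations of order `k` is a function of `z ^ k`. -/
theorem exists_rotation_factor {F : ℂ → ℂ} {k : ℕ} (hk : 1 ≤ k) (hF : AnalyticAt ℂ F 0)
    (hinv : ∀ ε : ℂ, ε ^ k = 1 → ∀ᶠ z in 𝓝 0, F (ε * z) = F z) :
    ∃ H : ℂ → ℂ, AnalyticAt ℂ H 0 ∧ ∀ᶠ z in 𝓝 0, F z = H (z ^ k) := by
  have hfin : {ε : ℂ | ε ^ k = 1}.Finite := by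
    refine (finite_eval_eq_zero (P := Polynomial.X ^ k - Polynomial.C 1) ?_).subset ?_
    · exact Polynomial.X_pow_sub_C_ne_zero (by omega) 1
    · intro ε hε
      have : ε ^ k = 1 := hε
      simp [this]
  have hall : ∀ᶠ z in 𝓝 0, ∀ ε ∈ {ε : ℂ | ε ^ k = 1}, F (ε * z) = F z :=
    (eventually_all_finite hfin).2 fun ε hε => hinv ε hε
  have hne : ¬ ∀ᶠ w in 𝓝 (0 : ℂ), w ^ k = 0 ^ k := by
    intro h
    obtain ⟨w, h1, h2⟩ := ((h.filter_mono nhdsWithin_le_nhds).and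
      (self_mem_nhdsWithin : {0}ᶜ ∈ 𝓝[≠] (0 : ℂ))).exists
    rw [zero_pow (by omega)] at h1
    exact h2 (pow_eq_zero_iff (by omega) |>.1 h1)
  obtain ⟨H, hH, he⟩ := exists_local_factor (p := fun w : ℂ => w ^ k) (by fun_prop) hF hne hall
    fun x hx y hy hxy => by
      by_cases hx0 : x = 0
      · have : y ^ k = 0 := by
          rw [← hxy, hx0]
          exact zero_pow (by omega)
        rw [hx0, pow_eq_zero_iff (by omega) |>.1 this]
      · rw [← hx (y / x) (by
          change (y / x) ^ k = 1
          rw [div_pow, ← hxy]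
          exact div_self (pow_ne_zero _ hx0)), div_mul_cancel₀ _ hx0]
  refine ⟨H, by simpa [show k ≠ 0 by omega] using hH, he⟩

variable {R : RatFunc ℂ} {lam c : ℂ} {Λ : Set ℂ} {k : ℕ} {Φ : ℂ → Sphere}

namespace Uniformizes

theorem invariant (hU : Uniformizes R lam c Λ k Φ) {ε b : ℂ} (hε : ε ^ k = 1) (hb : b ∈ Λ) (z : ℂ) :
    Φ (ε * z + b) = Φ z :=
  ((hU.fibres z (ε * z + b)).2 ⟨ε, b, hε, hb, rfl⟩).symm

theorem eq_zero_iff (hU : Uniformizes R lam c Λ k Φ) (z : ℂ) : Φ 0 = Φ z ↔ z ∈ Λ := by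
  rw [hU.fibres]
  constructor
  · rintro ⟨ε, b, -, hb, rfl⟩
    simpa using hb
  · exact fun hz => ⟨1, z, one_pow k, hz, by simp⟩

theorem smul_mem (hU : Uniformizes R lam c Λ k Φ) (h0 : (0 : ℂ) ∈ Λ) {ε b : ℂ} (hε : ε ^ k = 1)
    (hb : b ∈ Λ) : ε * b ∈ Λ := by
  rw [← hU.eq_zero_iff]
  have h1 := hU.invariant hε h0 b
  rw [add_zero] at h1
  rw [h1, hU.eq_zero_iff]
  exact hb

theorem nonconst_ratFunc (hU : Uniformizes R lam c Λ k Φ) : ¬ ∃ a, R = RatFunc.C a := by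
  rintro ⟨a, rfl⟩
  obtain ⟨z, w, hzw⟩ := hU.nonconst
  have h : ∀ z, Φ z = a := by
    intro z
    have := hU.semiconj ((z - (lam - 1) * c) / lam)
    rw [ratMap_C, mul_div_cancel₀ _ hU.lam_ne_zero, sub_add_cancel] at this
    exact this.symm
  exact hzw ((h z).trans (h w).symm)

theorem smul {S : RatFunc ℂ} (hU : Uniformizes R lam c Λ k Φ) {h : GL (Fin 2) ℂ}
    (hRS : ∀ x, ratMap S (h • x) = h • ratMap R x) :
    Uniformizes S lam c Λ k (fun z => h • Φ z) where
  lam_ne_zero := hU.lam_ne_zero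
  pos := hU.pos
  center := hU.center
  holomorphic z := (hU.holomorphic z).smul h
  nonconst := by
    obtain ⟨z, w, hzw⟩ := hU.nonconst
    exact ⟨z, w, fun e => hzw (MulAction.injective h e)⟩
  fibres z w := by
    rw [← hU.fibres z w]
    exact (MulAction.injective h).eq_iff
  semiconj z := by rw [hRS, hU.semiconj]

/-- The polar part at the origin of a quotient map sending the origin to infinity. -/
theorem exists_polar (hU : Uniformizes R lam c Λ k Φ) {L : PeriodPair} (hΛ : Λ = L.lattice)
    (h0 : Φ 0 = ∞) : ∃ B : ℂ → ℂ, AnalyticAt ℂ B 0 ∧ B 0 ≠ 0 ∧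
      ∀ᶠ z in 𝓝[≠] 0, coord (Φ z) = B (z ^ k) / z ^ k := by
  have hk : k ≠ 0 := by
    have := hU.pos
    omega
  have hpow : Tendsto (fun z : ℂ => z ^ k) (𝓝 0) (𝓝 0) := by
    have : Continuous fun z : ℂ => z ^ k := by fun_prop
    simpa [hk] using this.tendsto 0
  obtain ⟨F, hF, hF0, hFe⟩ := (hU.holomorphic 0).exists_inv h0
  have hF_inj : ∀ u v : ℂ, (if u = 0 then (∞ : Sphere) else ((u⁻¹ : ℂ) : Sphere)) =
      (if v = 0 then ∞ else ((v⁻¹ : ℂ) : Sphere)) → u = v := by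
    intro u v huv
    by_cases hu : u = 0 <;> by_cases hv : v = 0
    · rw [hu, hv]
    · simp [hu, hv] at huv
    · simp [hu, hv] at huv
    · simpa [hu, hv] using huv
  have h0Λ : (0 : ℂ) ∈ Λ := hΛ ▸ L.lattice.zero_mem
  obtain ⟨H, hH, hFH⟩ := exists_rotation_factor hU.pos hF fun ε hε => by
    have ht : Tendsto (fun z : ℂ => ε * z) (𝓝 0) (𝓝 0) := by
      have : Continuous fun z : ℂ => ε * z := by fun_prop
      simpa using this.tendsto 0
    filter_upwards [hFe, ht.eventually hFe] with z h1 h2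
    have := hU.invariant hε h0Λ z
    rw [add_zero, h1, h2] at this
    exact hF_inj _ _ this
  have hH0 : H 0 = 0 := by
    have := hFH.self_of_nhds
    rw [hF0, zero_pow hk] at this
    exact this.symm
  obtain ⟨r, hr, hrΛ⟩ : ∃ r > 0, ∀ b ∈ Λ, ‖b‖ < r → b = 0 := by
    have := L.compl_lattice_sdiff_singleton_mem_nhds 0
    obtain ⟨r, hr, hrs⟩ := Metric.mem_nhds_iff.1 this
    refine ⟨r, hr, fun b hb hbr => ?_⟩
    by_contra hb0
    exact hrs (mem_ball_zero_iff.2 hbr) ⟨hΛ ▸ hb, hb0⟩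
  have hgood := (hFH.and hFe).and (Metric.ball_mem_nhds (0 : ℂ) (half_pos hr))
  have himg : (fun z : ℂ => z ^ k) '' {z | (F z = H (z ^ k) ∧
      Φ z = if F z = 0 then ∞ else (((F z)⁻¹ : ℂ) : Sphere)) ∧ z ∈ Metric.ball (0 : ℂ) (r / 2)} ∈
      𝓝 (0 : ℂ) := by
    have hpan : AnalyticAt ℂ (fun z : ℂ => z ^ k) 0 := by fun_prop
    have := nhds_le_map hpan (fun h => ?_) (image_mem_map hgood)
    · simpa [hk] using this
    · obtain ⟨w, h1, h2⟩ := ((h.filter_mono nhdsWithin_le_nhds).and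
        (self_mem_nhdsWithin : {0}ᶜ ∈ 𝓝[≠] (0 : ℂ))).exists
      rw [zero_pow hk] at h1
      exact h2 (pow_eq_zero_iff hk |>.1 h1)
  -- `H` is injective: equal values mean `y = ε x + b` with `‖b‖ ≤ ‖x‖ + ‖y‖ < r`, so `b = 0` and `y
  -- ^ k = x ^ k`. Hence the pole is simple in the variable `z ^ k`.
  have hHd : deriv H 0 ≠ 0 := by
    refine deriv_ne_zero_of_injOn hH himg ?_
    rintro _ ⟨x, ⟨⟨hx1, hx2⟩, hx3⟩, rfl⟩ _ ⟨y, ⟨⟨hy1, hy2⟩, hy3⟩, rfl⟩ hxy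
    simp only at hxy ⊢
    rw [← hx1, ← hy1] at hxy
    obtain ⟨ε, b, hε, hb, hyx⟩ := (hU.fibres x y).1 (by rw [hx2, hy2, hxy])
    have hεn : ‖ε‖ = 1 := Complex.norm_eq_one_of_pow_eq_one hε hk
    have hb0 : b = 0 := by
      refine hrΛ b hb ?_
      rw [mem_ball_zero_iff] at hx3 hy3
      calc ‖b‖ = ‖y - ε * x‖ := by rw [hyx]; congr 1; ring
        _ ≤ ‖y‖ + ‖ε * x‖ := norm_sub_le _ _
        _ = ‖y‖ + ‖x‖ := by rw [norm_mul, hεn, one_mul]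
        _ < r := by linarith
    rw [hyx, hb0, add_zero, mul_pow, hε, one_mul]
  have hD := analyticAt_dslope hH
  have hD0 : dslope H 0 0 ≠ 0 := by rwa [dslope_same]
  refine ⟨fun u => (dslope H 0 u)⁻¹, hD.fun_inv hD0, inv_ne_zero hD0, ?_⟩
  filter_upwards [hFH.filter_mono nhdsWithin_le_nhds, hFe.filter_mono nhdsWithin_le_nhds,
    self_mem_nhdsWithin, (hpow.eventually (hD.continuousAt.eventually_ne hD0)).filter_mono
      nhdsWithin_le_nhds] with z h1 h2 h3 h4
  have hzk : z ^ k ≠ 0 := pow_ne_zero _ h3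
  have h5 := sub_smul_dslope H 0 (z ^ k)
  rw [hH0, sub_zero, sub_zero, smul_eq_mul] at h5
  have h6 : F z ≠ 0 := by
    rw [h1, ← h5]
    exact mul_ne_zero hzk h4
  rw [h2, if_neg h6, coord_coe, h1, ← h5]
  field_simp

theorem coord_add (hU : Uniformizes R lam c Λ k Φ) {b : ℂ} (hb : b ∈ Λ) (z : ℂ) :
    coord (Φ (z + b)) = coord (Φ z) := by
  have := hU.invariant (one_pow k) hb z
  rw [one_mul] at this
  rw [this]

/-- Without rotations `Φ` would be an elliptic function with one simple pole. Then `W z + W (-z)`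
has no pole, so it is constant, and `W` agrees at the incongruent half-periods `ω₁ / 2` and `ω₂ /
2`. -/
theorem order_ne_one (hU : Uniformizes R lam c Λ k Φ) {L : PeriodPair} (hΛ : Λ = L.lattice) :
    k ≠ 1 := by
  rintro rfl
  obtain ⟨h, hh⟩ := exists_smul_eq_infty (Φ 0)
  obtain ⟨S, -, -, hRS⟩ := exists_conj R hU.nonconst_ratFunc h
  have hW := hU.smul hRS
  set W : ℂ → Sphere := fun z => h • Φ z
  have hW0 : W 0 = ∞ := hh
  have hinf : ∀ z ∉ L.lattice, W z ≠ ∞ := fun z hz he => by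
    have := (hW.eq_zero_iff z).1 (hW0.trans he.symm)
    exact hz (by simpa [hΛ] using this)
  obtain ⟨B, hB, hB0, hBe⟩ := hW.exists_polar hΛ hW0
  obtain ⟨d, hd⟩ := const_of_periodic L (D := fun z => coord (W z) + coord (W (-z)))
    (fun b hb z => by
      have h1 := hW.coord_add (b := b) (by simpa [hΛ] using hb) z
      have h2 := hW.coord_add (b := -b) (by simpa [hΛ] using hb) (-z)
      rw [show -(z + b) = -z + -b by ring, h1, h2])
    (fun z hz => by
      have h1 := ((hW.holomorphic z).analyticAt_coord (hinf z hz)).1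
      have h2 := ((hW.holomorphic (-z)).analyticAt_coord (hinf (-z) (by simpa using hz))).1
      have h3 : AnalyticAt ℂ (fun z => coord (W (-z))) z :=
        AnalyticAt.comp (g := fun z => coord (W z)) (f := fun z => -z) h2 (by fun_prop)
      exact h1.fun_add h3)
    (by
      have hN : AnalyticAt ℂ (fun z => B z - B (-z)) 0 := by
        have : AnalyticAt ℂ (fun z => B (-z)) 0 :=
          AnalyticAt.comp (f := fun z : ℂ => -z) (by simpa using hB) (by fun_prop)
        exact hB.fun_sub this
      refine ⟨_, analyticAt_dslope hN, ?_⟩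
      have ht : Tendsto (fun z : ℂ => -z) (𝓝[≠] 0) (𝓝[≠] 0) := by
        have := tendsto_punctured (f := fun z : ℂ => -z) (z := 0) (by fun_prop) (by simp)
        simpa using this
      filter_upwards [hBe, ht.eventually hBe, self_mem_nhdsWithin] with z h1 h2 h3
      have h3' : z ≠ 0 := h3
      rw [h1, h2, dslope_of_ne _ h3, slope_def_field]
      simp only [pow_one, neg_zero, sub_self, sub_zero]
      field_simp
      ring)
  have half : ∀ z ∉ L.lattice, 2 * z ∈ L.lattice → 2 * coord (W z) = d := by
    intro z hz hz2
    have h1 := hd z hz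
    have h2 := hW.coord_add (b := 2 * z) (by simpa [hΛ] using hz2) (-z)
    rw [show -z + 2 * z = z by ring] at h2
    simp only [← h2] at h1
    rw [← h1, two_mul]
  have e1 := half _ L.ω₁_div_two_notMem_lattice (by
    rw [mul_div_cancel₀ _ two_ne_zero]
    exact L.ω₁_mem_lattice)
  have e2 := half _ L.ω₂_div_two_notMem_lattice (by
    rw [mul_div_cancel₀ _ two_ne_zero]
    exact L.ω₂_mem_lattice)
  have e3 : W (L.ω₁ / 2) = W (L.ω₂ / 2) := by
    rw [← coe_coord (hinf _ L.ω₁_div_two_notMem_lattice),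
      ← coe_coord (hinf _ L.ω₂_div_two_notMem_lattice)]
    congr 1
    have h2 : (2 : ℂ) ≠ 0 := two_ne_zero
    exact mul_left_cancel₀ h2 (e1.trans e2.symm)
  obtain ⟨ε, b, hε, hb, hbe⟩ := (hW.fibres _ _).1 e3
  rw [pow_one] at hε
  rw [hΛ, hε, one_mul] at *
  have : (-1 / 2 : ℚ) * L.ω₁ + (1 / 2 : ℚ) * L.ω₂ ∈ L.lattice := by
    have : b = (-1 / 2 : ℚ) * L.ω₁ + (1 / 2 : ℚ) * L.ω₂ := by
      push_cast
      linear_combination -hbe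
    rw [← this]
    exact hb
  have := (PeriodPair.mul_ω₁_add_mul_ω₂_mem_lattice.1 this).1
  norm_num at this

/-- A quotient by a crystallographic group is determined, up to homography, by one invariant
function with a pole of order `k` at the origin. -/
theorem exists_smul_eq_withPoles (hU : Uniformizes R lam c Λ k Φ) {L : PeriodPair}
    (hΛ : Λ = L.lattice) {s : ℂ → ℂ} (hs : ∀ z ∉ L.lattice, AnalyticAt ℂ s z)
    (hper : ∀ b ∈ L.lattice, ∀ z, s (z + b) = s z)
    (hrot : ∀ ε z, ε ^ k = 1 → s (ε * z) = s z)
    (hpole : ∃ F : ℂ → ℂ, AnalyticAt ℂ F 0 ∧ F 0 ≠ 0 ∧ ∀ᶠ z in 𝓝[≠] 0, s z = F z / z ^ k) :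
    ∃ h : GL (Fin 2) ℂ, ∀ z, h • Φ z = withPoles L s z := by
  have hk : k ≠ 0 := by
    have := hU.pos
    omega
  obtain ⟨h, hh⟩ := exists_smul_eq_infty (Φ 0)
  obtain ⟨S, -, -, hRS⟩ := exists_conj R hU.nonconst_ratFunc h
  have hW := hU.smul hRS
  set W : ℂ → Sphere := fun z => h • Φ z with hWdef
  have hW0 : W 0 = ∞ := hh
  have hinf : ∀ z, W z = ∞ ↔ z ∈ L.lattice := fun z => by
    have := hW.eq_zero_iff z
    rw [hW0, hΛ] at this
    exact eq_comm.trans this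
  obtain ⟨B, hB, hB0, hBe⟩ := hW.exists_polar hΛ hW0
  obtain ⟨F, hF, hF0, hFe⟩ := hpole
  obtain ⟨H, hH, hFH⟩ := exists_rotation_factor hU.pos hF fun ε hε => by
    have hε0 : ε ≠ 0 := by
      rintro rfl
      simp [hk] at hε
    have ht : Tendsto (fun z : ℂ => ε * z) (𝓝[≠] 0) (𝓝[≠] 0) := by
      have := tendsto_punctured (f := fun z : ℂ => ε * z) (z := 0) (by fun_prop) (by simpa)
      simpa using this
    have hc : AnalyticAt ℂ (fun z => F (ε * z)) 0 :=
      AnalyticAt.comp (f := fun z : ℂ => ε * z) (by simpa using hF) (by fun_prop)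
    refine eventuallyEq_of_punctured hc hF ?_
    filter_upwards [hFe, ht.eventually hFe, self_mem_nhdsWithin] with z h1 h2 h3
    have h3' : z ^ k ≠ 0 := pow_ne_zero _ h3
    have := hrot ε z hε
    rw [h1, h2, mul_pow, hε, one_mul] at this
    field_simp at this
    exact this
  have hH0 : H 0 ≠ 0 := by
    have := hFH.self_of_nhds
    rw [zero_pow hk] at this
    rwa [← this]
  -- Both functions have a simple pole in the variable `z ^ k`, so this single ratio cancels the
  -- whole polar part of `W - q s`.
  set q := B 0 / H 0 with hq
  have hq0 : q ≠ 0 := div_ne_zero hB0 hH0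
  obtain ⟨d, hd⟩ := const_of_periodic L (D := fun z => coord (W z) - q * s z)
    (fun b hb z => by
      have h1 := hW.coord_add (b := b) (by simpa [hΛ] using hb) z
      rw [h1, hper b hb])
    (fun z hz => by
      have h1 := ((hW.holomorphic z).analyticAt_coord fun h => hz ((hinf z).1 h)).1
      exact h1.fun_sub (analyticAt_const.fun_mul (hs z hz)))
    (by
      have hN : AnalyticAt ℂ (fun u => B u - q * H u) 0 := hB.fun_sub (analyticAt_const.fun_mul hH)
      refine ⟨fun z => dslope (fun u => B u - q * H u) 0 (z ^ k), ?_, ?_⟩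
      · exact AnalyticAt.comp (f := fun z : ℂ => z ^ k)
          (by rw [zero_pow hk]; exact analyticAt_dslope hN) (by fun_prop)
      filter_upwards [hBe, hFe, self_mem_nhdsWithin, hFH.filter_mono nhdsWithin_le_nhds]
        with z h1 h2 h3 h4
      have h3' : z ^ k ≠ 0 := pow_ne_zero _ h3
      have h5 : B 0 - q * H 0 = 0 := by
        rw [hq]
        field_simp
        ring
      rw [h1, h2, dslope_of_ne _ h3', slope_def_field, h4, h5]
      field_simp
      ring)
  have hdet : (1 : ℂ) * q - (-d) * 0 ≠ 0 := by simpa using hq0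
  refine ⟨homography 1 (-d) 0 q hdet * h, fun z => ?_⟩
  rw [mul_smul]
  change homography 1 (-d) 0 q hdet • W z = _
  by_cases hz : z ∈ L.lattice
  · rw [(hinf z).2 hz, withPoles, if_pos hz, ← toSphere_zero 1, homography_smul _ (by simp)]
    simp
  · rw [withPoles, if_neg hz, ← coe_coord fun h => hz ((hinf z).1 h), ← toSphere_one,
      homography_smul _ (by simp), toSphere_of_ne (by simpa using hq0)]
    congr 1
    rw [div_eq_iff (by simpa using hq0), ← hd z hz]
    ring

end Uniformizes


/-! ### Solutions of `G₂(μ)` from affine semiconjugacies -/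

/-- The differential equation is needed only over generic values: each exceptional value, and
infinity, is taken on a discrete set. -/
theorem eventually_sol {μ : RatFunc ℂ} {m : ℂ → ℂ} {W : ℂ → Sphere} (hW : ∀ z, HolAt W z)
    (hne : ∃ z w, W z ≠ W w) (hμ : ∀ᶠ x in cofinite, val μ x = m x) {f : ℂ → ℂ}
    (hf : ∀ z, W z ≠ ∞ → ∀ᶠ w in 𝓝 z, W w = (f w : Sphere))
    (hpull : ∀ᶠ x : ℂ in cofinite, ∀ z, W z = (x : Sphere) → deriv f z ≠ 0 ∧
      m x * deriv f z + deriv (deriv f) z / deriv f z = 0) (z : ℂ) :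
    ∀ᶠ w in 𝓝[≠] z, Sol μ 0 W w := by
  have hfin : {x | ¬ (RegularAt μ x ∧ val μ x = m x ∧ ∀ z, W z = (x : Sphere) → deriv f z ≠ 0 ∧
      m x * deriv f z + deriv (deriv f) z / deriv f z = 0)}.Finite :=
    eventually_cofinite.1 ((regularAt_cofinite μ).and (hμ.and hpull))
  filter_upwards [eventually_ne_of_ne hW hne z ∞, (eventually_all_finite hfin).2 fun x _ =>
    eventually_ne_of_ne hW hne z (x : Sphere)] with w h1 h2
  have he := hf w h1
  obtain ⟨h3, h4, h5⟩ := not_not.1 fun h => h2 (f w) h he.self_of_nhds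
  obtain ⟨h6, h7⟩ := h5 w he.self_of_nhds
  refine ⟨f, ?_, he, h6, h3, ?_⟩
  · refine ((hW w).analyticAt_coord h1).1.congr ?_
    filter_upwards [he] with v hv
    rw [hv, coord_coe]
  · rw [pull, h4, h7, Pi.zero_apply]

/-- `W` and its composition with an affine map both pull `μ` back to `0`. Thus `S^* μ` and `μ` have
the same pull-back by `W`, and they agree wherever `W` is a local coordinate. -/
theorem isSolutionG2_of_semiconj {μ S : RatFunc ℂ} (hS : ¬ ∃ c, S = RatFunc.C c) {W : ℂ → Sphere}
    (hW : ∀ z, HolAt W z) (hsol : ∀ z, ∀ᶠ w in 𝓝[≠] z, Sol μ 0 W w) {lam b : ℂ} (hlam : lam ≠ 0)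
    (hsemi : ∀ z, ratMap S (W z) = W (lam * z + b)) : IsSolutionG2 μ S := by
  have hne : ∃ z w, W z ≠ W w := by
    obtain ⟨x, s, hs, hi⟩ := ((hsol 0).mono fun w hw => hw.injOn).exists
    obtain ⟨y, hy, hyx⟩ := ((Filter.Eventually.filter_mono nhdsWithin_le_nhds
      (show ∀ᶠ y in 𝓝 x, y ∈ s from hs)).and (self_mem_nhdsWithin : {x}ᶜ ∈ 𝓝[≠] x)).exists
    exact ⟨y, x, fun h => hyx (hi hy (mem_of_mem_nhds hs) h)⟩
  have hfin : {x | ¬ Allowed μ S x}.Finite := eventually_cofinite.1 (allowed_cofinite μ hS)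
  have ht : Tendsto (fun z => lam * z + b) (𝓝[≠] 0) (𝓝[≠] (lam * 0 + b)) :=
    tendsto_punctured (f := fun z => lam * z + b) (z := 0) (by fun_prop) (by simpa)
  have hgood : ∀ᶠ z in 𝓝[≠] (0 : ℂ), Sol μ 0 W z ∧ Sol μ 0 W (lam * z + b) ∧
      ∀ x ∈ {x | ¬ Allowed μ S x}, W z ≠ (x : Sphere) :=
    (hsol 0).and ((ht.eventually (hsol _)).and ((eventually_all_finite hfin).2 fun x _ =>
      eventually_ne_of_ne hW hne 0 (x : Sphere)))
  obtain ⟨z₀, hz₀, hz₀'⟩ := (hgood.and (eventually_eventually_nhds_punctured hgood)).exists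
  obtain ⟨F, hF, hFe, hFd, hFr, hFp⟩ := hz₀.1
  have hFne : ¬ ∀ᶠ w in 𝓝 z₀, F w = F z₀ := fun h =>
    hFd ((EventuallyEq.deriv_eq h).trans (deriv_const _ _))
  have hx₀ : Allowed μ S (F z₀) := not_not.1 fun h => hz₀.2.2 _ h hFe.self_of_nhds
  refine isSolutionG2_of_eventually hS hx₀ (Eventually.frequently
    (Filter.Eventually.filter_mono nhdsWithin_le_nhds ?_))
  have hloc : ∀ᶠ z in 𝓝 z₀, pull (val μ) (val S) (F z) = val μ (F z) := by
    filter_upwards [hz₀', hFe.eventually_nhds, hF.eventually_analyticAt,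
      hF.deriv.continuousAt.eventually_ne hFd] with z ⟨h1, h2, h3⟩ h4 h5 h6
    have hal : Allowed μ S (F z) := not_not.1 fun h => h3 _ h h4.self_of_nhds
    obtain ⟨F₁, a1, a2, a3, a4, a5⟩ := h1
    have e1 : F =ᶠ[𝓝 z] F₁ := by
      filter_upwards [h4, a2] with w b1 b2
      exact OnePoint.coe_injective (b1.symm.trans b2)
    obtain ⟨F₂, b1, b2, b3, b4, b5⟩ := Sol.comp_affine hlam h2
    have e2 : (fun w => val S (F w)) =ᶠ[𝓝 z] F₂ := by
      filter_upwards [h4, b2, h5.continuousAt.eventually hal.1.eventually] with w c1 c2 c3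
      rw [← hsemi, c1, ratMap_coe_of_regularAt c3] at c2
      exact OnePoint.coe_injective c2
    have e3 : pull (val μ) (fun w => val S (F w)) z = pull (val μ) F z := by
      rw [pull_congr e2, b5, pull_congr e1, a5]
    rw [pull_comp (analyticAt_val hal.1) h5 hal.2.1 h6] at e3
    change pull (val μ) (val S) (F z) * _ + _ = val μ (F z) * _ + _ at e3
    exact mul_right_cancel₀ h6 (add_right_cancel e3)
  have := nhds_le_map hF hFne (image_mem_map hloc)
  filter_upwards [this] with x ⟨z, hz, hzx⟩
  rw [← hzx]
  exact hz

/-- An equation between affine functions that is not an identity has at most one solution, and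
countably many such points cannot fill `ℂ`. -/
theorem exists_of_forall_countable {P : ℂ → ℂ → Prop} (hP : {p : ℂ × ℂ | P p.1 p.2}.Countable)
    {p q r s : ℂ} (h : ∀ z, ∃ ε b, P ε b ∧ p * z + q = ε * (r * z + s) + b) :
    ∃ ε b, P ε b ∧ p = ε * r ∧ q = ε * s + b := by
  by_contra! hno
  have hsub : ∀ x ∈ {x : ℂ × ℂ | P x.1 x.2},
      {z : ℂ | p * z + q = x.1 * (r * z + s) + x.2}.Subsingleton := by
    rintro ⟨ε, b⟩ hx z hz w hw
    have hz' : p * z + q = ε * (r * z + s) + b := hz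
    have hw' : p * w + q = ε * (r * w + s) + b := hw
    by_cases hp : p = ε * r
    · exact (hno ε b hx hp (by linear_combination hz' - z * hp)).elim
    · have : (p - ε * r) * (z - w) = 0 := by linear_combination hz' - hw'
      rcases mul_eq_zero.1 this with h | h
      · exact (hp (sub_eq_zero.1 h)).elim
      · exact sub_eq_zero.1 h
  have hc := hP.biUnion fun x hx => (hsub x hx).countable
  refine not_countable_complex (hc.mono fun z _ => ?_)
  obtain ⟨ε, b, h1, h2⟩ := h z
  exact Set.mem_biUnion (show (ε, b) ∈ {x : ℂ × ℂ | P x.1 x.2} from h1) h2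

namespace Uniformizes

variable {R : RatFunc ℂ} {lam c : ℂ} {Λ : Set ℂ} {k : ℕ} {Φ : ℂ → Sphere}

/-- The covering map conjugates each group element into the group. The fibres give this point by
point, with an element depending on `z`; countability makes the element uniform. -/
theorem mul_add_mem (hU : Uniformizes R lam c Λ k Φ) (hΛ : Λ.Countable) {ε b : ℂ} (hε : ε ^ k = 1)
    (hb : b ∈ Λ) : lam * b + (1 - ε) * ((lam - 1) * c) ∈ Λ := by
  have hk : k ≠ 0 := by
    have := hU.pos
    omega
  have hroots : {ε : ℂ | ε ^ k = 1}.Countable := by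
    refine ((finite_eval_eq_zero (P := Polynomial.X ^ k - Polynomial.C 1)
      (Polynomial.X_pow_sub_C_ne_zero (by omega) 1)).subset fun ε hε => ?_).countable
    have : ε ^ k = 1 := hε
    simp [this]
  obtain ⟨ε', b', ⟨h1, h2⟩, h3, h4⟩ := exists_of_forall_countable
    (P := fun ε b => ε ^ k = 1 ∧ b ∈ Λ) (hroots.prod hΛ) (p := lam * ε)
    (q := lam * b + (lam - 1) * c) (r := lam) (s := (lam - 1) * c) fun z => by
      have := hU.semiconj (ε * z + b)
      rw [hU.invariant hε hb, hU.semiconj, hU.fibres] at this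
      obtain ⟨ε', b', h1, h2, h3⟩ := this
      exact ⟨ε', b', ⟨h1, h2⟩, by rw [← h3]; ring⟩
  have : ε' = ε := mul_right_cancel₀ hU.lam_ne_zero (by rw [← h3, mul_comm])
  rw [this] at h4
  rwa [show lam * b + (1 - ε) * ((lam - 1) * c) = b' by linear_combination h4]

theorem isSolutionG2 (hU : Uniformizes R lam c Λ k Φ) {μ : RatFunc ℂ} {m : ℂ → ℂ}
    (hμ : ∀ᶠ x in cofinite, val μ x = m x) {f : ℂ → ℂ}
    (hf : ∀ z, Φ z ≠ ∞ → ∀ᶠ w in 𝓝 z, Φ w = (f w : Sphere))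
    (hpull : ∀ᶠ x : ℂ in cofinite, ∀ z, Φ z = (x : Sphere) → deriv f z ≠ 0 ∧
      m x * deriv f z + deriv (deriv f) z / deriv f z = 0) : IsSolutionG2 μ R :=
  isSolutionG2_of_semiconj hU.nonconst_ratFunc hU.holomorphic
    (eventually_sol hU.holomorphic hU.nonconst hμ hf hpull) hU.lam_ne_zero hU.semiconj

/-- Translating the variable by `c` moves the fixed point of the covering map to the origin, so that
it becomes `z ↦ lam * z`. -/
theorem isLattes (hU : Uniformizes R lam c Λ k Φ) {L : PeriodPair} (hΛ : Λ = L.lattice) :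
    IsLattes R := by
  have hcount : Λ.Countable := by
    rw [hΛ]
    have : Countable L.lattice := L.latticeEquivProd.toEquiv.countable_iff.2 inferInstance
    exact this.to_set
  refine ⟨L, lam, fun z => Φ (z - c), hU.lam_ne_zero, fun b hb => ?_, fun z => ?_, ?_,
    fun b hb z => ?_, fun z => ?_⟩
  · have := hU.mul_add_mem hcount (one_pow k) (b := b) (by simpa [hΛ] using hb)
    simpa [hΛ] using this
  · exact HolAt.comp (g := fun z => z - c) (hU.holomorphic _) (by fun_prop)
  · obtain ⟨z, w, h⟩ := hU.nonconst
    exact ⟨z + c, w + c, by simpa using h⟩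
  · have := hU.invariant (one_pow k) (b := b) (by simpa [hΛ] using hb) (z - c)
    change Φ (z + b - c) = Φ (z - c)
    rw [← this]
    congr 1
    ring
  · change ratMap R (Φ (z - c)) = Φ (lam * z - c)
    rw [hU.semiconj]
    congr 1
    ring

end Uniformizes


/-! ### Powers and Chebyshev polynomials -/

theorem eq_of_cofinite {R S : RatFunc ℂ} {m : ℂ → ℂ}
    (hR : ∀ᶠ x : ℂ in cofinite, ratMap R (x : Sphere) = (m x : Sphere))
    (hS : ∀ᶠ x in cofinite, val S x = m x) : R = S := by
  refine ratFunc_ext (Set.Infinite.mono ?_ (Set.infinite_univ.sdiff (eventually_cofinite.1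
    (hR.and (hS.and (regularAt_cofinite S))))))
  rintro x ⟨-, hx⟩
  obtain ⟨h1, h2, h3⟩ := not_not.1 hx
  change ratMap R _ = ratMap S _
  rw [h1, ratMap_coe_of_regularAt h3, h2]

theorem val_algebraMap (P : Polynomial ℂ) (x : ℂ) :
    val (algebraMap (Polynomial ℂ) (RatFunc ℂ) P) x = P.eval x := by
  simp [val_eq]

theorem val_zpow_X (n : ℤ) : ∀ᶠ x in cofinite, val (RatFunc.X ^ n) x = x ^ n := by
  obtain ⟨m, rfl | rfl⟩ := n.eq_nat_or_neg
  · filter_upwards [val_pow RatFunc.X m] with x hx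
    rw [zpow_natCast, zpow_natCast, hx, val_X]
  · filter_upwards [val_pow RatFunc.X m, val_inv (RatFunc.X ^ m)] with x hx hx'
    rw [zpow_neg, zpow_neg, zpow_natCast, zpow_natCast, hx', hx, val_X]

/-- A holomorphic map with the fibres of an entire function `p` whose image is the plane or the
punctured plane is the composition of `p` and a homography. -/
theorem exists_smul_eq_of_fibres {p : ℂ → ℂ} {Φ : ℂ → Sphere} (hp : Differentiable ℂ p)
    (hrange : {0}ᶜ ⊆ Set.range p) (hΦ : ∀ z, HolAt Φ z) (hne : ∃ z w, Φ z ≠ Φ w)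
    (h : ∀ z w, Φ z = Φ w ↔ p z = p w) :
    ∃ g : GL (Fin 2) ℂ, ∀ z, g • Φ z = (p z : Sphere) := by
  obtain ⟨f, hf, hfh, hfi⟩ := exists_factor hp hΦ hne h
  obtain ⟨g, hg⟩ := exists_smul_eq_coe (f := f) (fun z hz => by
    obtain ⟨w, rfl⟩ := hrange hz
    exact hfh w) (hfi.mono hrange)
  refine ⟨g, congrFun (eq_of_eventually_eq (z₀ := 0) (fun z => (hΦ z).smul g)
    (fun z => holAt_coe (hp.analyticAt z)) (Eventually.frequently ?_))⟩
  have hn : ∀ᶠ z in 𝓝[≠] (0 : ℂ), p z ≠ 0 := by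
    refine ((hp.analyticAt 0).eventually_eq_zero_or_eventually_ne_zero).resolve_left fun h0 => ?_
    have hz : p = fun _ => 0 := (hp.differentiableOn.analyticOnNhd isOpen_univ).eq_of_eventuallyEq
      (z₀ := 0) (fun _ _ => analyticAt_const) h0
    obtain ⟨z, w, hzw⟩ := hne
    exact hzw ((h z w).2 (by rw [hz]))
  filter_upwards [hn] with z hz
  rw [← hf, hg _ hz]

namespace Uniformizes

variable {R : RatFunc ℂ} {lam c : ℂ} {k : ℕ} {Φ : ℂ → Sphere}

/-- The covering map normalizes the rotations about the origin, so it fixes their only common fixed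
point. -/
theorem mul_center_eq_zero (hU : Uniformizes R lam c {0} k Φ) : (lam - 1) * c = 0 := by
  have hk := hU.pos
  rcases hk.eq_or_lt with h | h
  · rw [hU.center h.symm, mul_zero]
  · have hprim := Complex.isPrimitiveRoot_exp k (by omega)
    have := hU.mul_add_mem (Set.countable_singleton _) hprim.pow_eq_one (b := 0) rfl
    rw [mul_zero, zero_add, Set.mem_singleton_iff] at this
    exact (mul_eq_zero.1 this).resolve_left fun h1 => hprim.ne_one h (sub_eq_zero.1 h1).symm

theorem exists_rotation (hU : Uniformizes R lam c {0} k Φ) :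
    ∃ g : GL (Fin 2) ℂ, ∀ z, g • Φ z = ((z ^ k : ℂ) : Sphere) := by
  have hk : k ≠ 0 := by
    have := hU.pos
    omega
  refine exists_smul_eq_of_fibres (p := fun z => z ^ k) (by fun_prop) (fun u _ => ?_)
    hU.holomorphic hU.nonconst fun z w => ?_
  · obtain ⟨z, hz⟩ := IsAlgClosed.exists_pow_nat_eq u (Nat.pos_of_ne_zero hk)
    exact ⟨z, hz⟩
  · rw [hU.fibres]
    constructor
    · rintro ⟨ε, b, hε, rfl, rfl⟩
      simp [mul_pow, hε]
    · intro h
      by_cases hz : z = 0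
      · refine ⟨1, 0, one_pow k, rfl, ?_⟩
        rw [hz, zero_pow hk] at h
        simpa [hz] using (pow_eq_zero_iff hk).1 h.symm
      · refine ⟨w / z, 0, ?_, rfl, ?_⟩
        · rw [div_pow, ← h]
          exact div_self (pow_ne_zero _ hz)
        · rw [div_mul_cancel₀ _ hz, add_zero]

theorem normalForm_rotation {G : Subgroup (ℂ ≃ᵃ[ℂ] ℂ)} (hG : IsRotationTranslationGroup G {0} k)
    (hU : Uniformizes R lam c {0} k Φ) (hΦ : ∀ z, Φ z = ((z ^ k : ℂ) : Sphere)) :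
    NormalForm R G Φ := by
  have hk : k ≠ 0 := by
    have := hU.pos
    omega
  have ha : lam ^ k ≠ 0 := pow_ne_zero _ hU.lam_ne_zero
  have hval : ∀ x, val (RatFunc.C (lam ^ k) * RatFunc.X) x = lam ^ k * x := by
    intro x
    have : RatFunc.C (lam ^ k) * RatFunc.X = algebraMap (Polynomial ℂ) (RatFunc ℂ)
        (Polynomial.C (lam ^ k) * Polynomial.X) := by simp
    rw [this, val_algebraMap]
    simp
  have hR : R = RatFunc.C (lam ^ k) * RatFunc.X := by
    refine eq_of_cofinite (m := fun x => lam ^ k * x) (.of_forall fun x => ?_) (.of_forall hval)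
    obtain ⟨z, rfl⟩ := IsAlgClosed.exists_pow_nat_eq x (Nat.pos_of_ne_zero hk)
    rw [← hΦ, hU.semiconj, hU.mul_center_eq_zero, add_zero, hΦ, mul_pow]
  refine .rotation k hU.pos hG hΦ ⟨lam ^ k, ha, hR⟩
    (isSolutionG2_of_cofinite hU.nonconst_ratFunc (.of_forall fun x => ?_))
  have h1 : val R = fun x => lam ^ k * x := by
    rw [hR]
    exact funext hval
  have h2 : deriv (val R) = fun _ => lam ^ k := by
    rw [h1]
    funext x
    simp
  have h3 : ∀ x, val 0 x = 0 := fun x => by simp [val]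
  rw [pull, h2, h3, h3]
  simp

theorem exists_exp (hU : Uniformizes R lam c (Set.range ((↑) : ℤ → ℂ)) 1 Φ) :
    ∃ g : GL (Fin 2) ℂ, ∀ z, g • Φ z = (Complex.exp (2 * Real.pi * Complex.I * z) : Sphere) := by
  refine exists_smul_eq_of_fibres (p := fun z => Complex.exp (2 * Real.pi * Complex.I * z))
    (by fun_prop) (fun u hu => ?_) hU.holomorphic hU.nonconst fun z w => ?_
  · refine ⟨Complex.log u / (2 * Real.pi * Complex.I), ?_⟩
    change Complex.exp _ = u
    rw [mul_div_cancel₀ _ Complex.two_pi_I_ne_zero, Complex.exp_log hu]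
  · rw [hU.fibres, eq_comm (b := Complex.exp (2 * Real.pi * Complex.I * w)),
      Complex.exp_eq_exp_iff_exists_int]
    constructor
    · rintro ⟨ε, _, hε, ⟨n, rfl⟩, rfl⟩
      refine ⟨n, ?_⟩
      rw [pow_one] at hε
      rw [hε]
      ring
    · rintro ⟨n, hn⟩
      refine ⟨1, n, one_pow 1, ⟨n, rfl⟩, mul_left_cancel₀ Complex.two_pi_I_ne_zero ?_⟩
      rw [hn]
      ring

theorem exists_int_multiplier {Λ : Set ℂ} (hU : Uniformizes R lam c Λ k Φ)
    (hΛ : Λ = Set.range ((↑) : ℤ → ℂ)) : ∃ n : ℤ, n ≠ 0 ∧ lam = n := by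
  obtain ⟨n, hn⟩ : lam * 1 + (1 - 1) * ((lam - 1) * c) ∈ Set.range ((↑) : ℤ → ℂ) := by
    rw [← hΛ]
    exact hU.mul_add_mem (hΛ ▸ Set.countable_range _) (one_pow k) (by rw [hΛ]; exact ⟨1, by simp⟩)
  rw [sub_self, zero_mul, add_zero, mul_one] at hn
  refine ⟨n, ?_, hn.symm⟩
  rintro rfl
  exact hU.lam_ne_zero (by rw [← hn, Int.cast_zero])

theorem normalForm_exp {G : Subgroup (ℂ ≃ᵃ[ℂ] ℂ)}
    (hG : IsRotationTranslationGroup G (Set.range ((↑) : ℤ → ℂ)) 1)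
    (hU : Uniformizes R lam c (Set.range ((↑) : ℤ → ℂ)) 1 Φ)
    (hΦ : ∀ z, Φ z = (Complex.exp (2 * Real.pi * Complex.I * z) : Sphere)) :
    NormalForm R G Φ := by
  obtain ⟨n, hn, rfl⟩ := hU.exists_int_multiplier rfl
  refine .exp hG hΦ ⟨n, hn, ?_⟩ ?_
  · refine eq_of_cofinite (m := fun x => x ^ n) ?_ (val_zpow_X n)
    filter_upwards [(Set.finite_singleton (0 : ℂ)).compl_mem_cofinite] with x hx
    have hx' : x ≠ 0 := hx
    have e : x = Complex.exp (2 * Real.pi * Complex.I *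
        (Complex.log x / (2 * Real.pi * Complex.I))) := by
      rw [mul_div_cancel₀ _ Complex.two_pi_I_ne_zero, Complex.exp_log hx']
    conv_lhs => rw [e]
    rw [← hΦ, hU.semiconj, hΦ, hU.center rfl, mul_zero, add_zero, ← mul_assoc, mul_comm _ (n : ℂ),
      mul_assoc, Complex.exp_int_mul, ← e]
  · refine hU.isSolutionG2 (m := fun x => -1 / x)
      (f := fun z => Complex.exp (2 * Real.pi * Complex.I * z)) ?_
      (fun z _ => .of_forall hΦ) ?_
    · filter_upwards [val_div (-1) RatFunc.X, val_neg 1] with x h1 h2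
      rw [h1, h2, val_one, val_X]
    · filter_upwards [(Set.finite_singleton (0 : ℂ)).compl_mem_cofinite] with x hx z hz
      have hd : deriv (fun z => Complex.exp (2 * Real.pi * Complex.I * z)) = fun z =>
          2 * Real.pi * Complex.I * Complex.exp (2 * Real.pi * Complex.I * z) := by
        funext z
        have : HasDerivAt (fun z => Complex.exp (2 * Real.pi * Complex.I * z))
            (Complex.exp (2 * Real.pi * Complex.I * z) * (2 * Real.pi * Complex.I * 1)) z :=
          ((hasDerivAt_id z).const_mul _).cexp
        rw [this.deriv]
        ring
      have hd2 : deriv (fun z => 2 * Real.pi * Complex.I * Complex.exp (2 * Real.pi * Complex.I * z))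
          z = 2 * Real.pi * Complex.I * (2 * Real.pi * Complex.I *
            Complex.exp (2 * Real.pi * Complex.I * z)) := by
        rw [deriv_const_mul_field, hd]
      have hxz : Complex.exp (2 * Real.pi * Complex.I * z) = x :=
        OnePoint.coe_injective ((hΦ z).symm.trans hz)
      have hx' : x ≠ 0 := hx
      have h0 := Complex.two_pi_I_ne_zero
      rw [hd, hd2]
      simp only
      rw [hxz]
      generalize 2 * (Real.pi : ℂ) * Complex.I = t at h0
      refine ⟨mul_ne_zero h0 hx', ?_⟩
      field_simp
      ring

theorem exists_cos (hU : Uniformizes R lam c (Set.range ((↑) : ℤ → ℂ)) 2 Φ) :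
    ∃ g : GL (Fin 2) ℂ, ∀ z, g • Φ z = (Complex.cos (2 * Real.pi * z) : Sphere) := by
  have h0 : (2 * Real.pi : ℂ) ≠ 0 := by simp
  refine exists_smul_eq_of_fibres (p := fun z => Complex.cos (2 * Real.pi * z))
    (by fun_prop) (fun u _ => ?_) hU.holomorphic hU.nonconst fun z w => ?_
  · obtain ⟨z, hz⟩ := Complex.cos_surjective u
    refine ⟨z / (2 * Real.pi), ?_⟩
    change Complex.cos _ = u
    rw [mul_div_cancel₀ _ h0, hz]
  · rw [hU.fibres, Complex.cos_eq_cos_iff]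
    constructor
    · rintro ⟨ε, _, hε, ⟨n, rfl⟩, rfl⟩
      refine ⟨n, ?_⟩
      rcases sq_eq_one_iff.1 hε with rfl | rfl
      · left
        ring
      · right
        ring
    · rintro ⟨n, hn | hn⟩
      · exact ⟨1, n, one_pow 2, ⟨n, rfl⟩, mul_left_cancel₀ h0 (by rw [hn]; ring)⟩
      · exact ⟨-1, n, by norm_num, ⟨n, rfl⟩, mul_left_cancel₀ h0 (by rw [hn]; ring)⟩

theorem normalForm_cos {G : Subgroup (ℂ ≃ᵃ[ℂ] ℂ)}
    (hG : IsRotationTranslationGroup G (Set.range ((↑) : ℤ → ℂ)) 2)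
    (hU : Uniformizes R lam c (Set.range ((↑) : ℤ → ℂ)) 2 Φ)
    (hΦ : ∀ z, Φ z = (Complex.cos (2 * Real.pi * z) : Sphere)) :
    NormalForm R G Φ := by
  obtain ⟨n, hn, rfl⟩ := hU.exists_int_multiplier rfl
  have h0 : (2 * Real.pi : ℂ) ≠ 0 := by simp
  have hT : ∀ z, (Polynomial.Chebyshev.T ℂ n.natAbs).eval (Complex.cos (2 * Real.pi * z)) =
      Complex.cos (n * (2 * Real.pi * z)) := by
    intro z
    rw [Polynomial.Chebyshev.T_natAbs, Polynomial.Chebyshev.T_complex_cos]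
  -- Applied to the rotation by `-1`, this gives `2 (lam - 1) c = m`, an integer. The phase in the
  -- cosine is then `m π`, and the parity of `m` decides the sign in front of the Chebyshev
  -- polynomial.
  obtain ⟨m, hm⟩ := hU.mul_add_mem (Set.countable_range _) (ε := -1) (b := 0) (by norm_num)
    ⟨0, by simp⟩
  have hsemi : ∀ z, ratMap R (Complex.cos (2 * Real.pi * z) : Sphere) =
      (Complex.cos (n * (2 * Real.pi * z) + m * Real.pi) : Sphere) := by
    intro z
    rw [← hΦ, hU.semiconj, hΦ, hm]
    congr 2
    ring
  have hsurj : ∀ x : ℂ, ∃ z, Complex.cos (2 * Real.pi * z) = x := by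
    intro x
    obtain ⟨z, hz⟩ := Complex.cos_surjective x
    exact ⟨z / (2 * Real.pi), by rw [mul_div_cancel₀ _ h0, hz]⟩
  refine .cos hG hΦ ⟨n.natAbs, Int.natAbs_pos.2 hn, ?_⟩ ?_
  · rcases Int.even_or_odd m with he | ho
    · left
      refine eq_of_cofinite (.of_forall fun x => ?_) (.of_forall fun x => val_algebraMap _ x)
      obtain ⟨z, rfl⟩ := hsurj x
      rw [hsemi, hT, Complex.cos_antiperiodic.add_int_mul_eq, Int.negOnePow_even m he]
      simp
    · right
      refine eq_of_cofinite
        (m := fun x => -(Polynomial.Chebyshev.T ℂ n.natAbs).eval x) (.of_forall fun x => ?_) ?_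
      · obtain ⟨z, rfl⟩ := hsurj x
        rw [hsemi, hT, Complex.cos_antiperiodic.add_int_mul_eq, Int.negOnePow_odd m ho]
        simp
      · filter_upwards [val_neg (algebraMap (Polynomial ℂ) (RatFunc ℂ)
          (Polynomial.Chebyshev.T ℂ n.natAbs))] with x hx
        rw [hx, val_algebraMap]
  · refine hU.isSolutionG2 (m := fun x => -x / (x ^ 2 - 1))
      (f := fun z => Complex.cos (2 * Real.pi * z)) ?_
      (fun z _ => .of_forall hΦ) ?_
    · filter_upwards [val_div (-RatFunc.X) (RatFunc.X ^ 2 - 1), val_neg RatFunc.X,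
        val_sub (RatFunc.X ^ 2) 1, val_pow RatFunc.X 2] with x h1 h2 h3 h4
      rw [h1, h2, h3, h4, val_one, val_X]
    · filter_upwards [(Set.finite_singleton (1 : ℂ)).compl_mem_cofinite,
        (Set.finite_singleton (-1 : ℂ)).compl_mem_cofinite] with x hx1 hx2 z hz
      have hlin : ∀ z, HasDerivAt (fun z : ℂ => 2 * Real.pi * z) (2 * Real.pi) z := fun z => by
        simpa using (hasDerivAt_id z).const_mul (2 * Real.pi : ℂ)
      have hd : deriv (fun z => Complex.cos (2 * Real.pi * z)) = fun z =>
          -(2 * Real.pi) * Complex.sin (2 * Real.pi * z) := by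
        funext z
        rw [(hlin z).ccos.deriv]
        ring
      have hd2 : deriv (fun z => -(2 * Real.pi) * Complex.sin (2 * Real.pi * z)) z =
          -(2 * Real.pi) * (Complex.cos (2 * Real.pi * z) * (2 * Real.pi)) := by
        rw [deriv_const_mul_field, (hlin z).csin.deriv]
      have hxz : Complex.cos (2 * Real.pi * z) = x :=
        OnePoint.coe_injective ((hΦ z).symm.trans hz)
      have hsin := Complex.sin_sq_add_cos_sq (2 * Real.pi * z)
      have hx : x ^ 2 - 1 ≠ 0 := by
        intro h
        rcases sq_eq_one_iff.1 (sub_eq_zero.1 h) with h | h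
        · exact hx1 h
        · exact hx2 h
      rw [hd, hd2]
      simp only
      rw [hxz] at hsin ⊢
      generalize Complex.sin (2 * Real.pi * z) = s at hsin
      generalize (2 * Real.pi : ℂ) = t at h0
      have hs : s ≠ 0 := by
        rintro rfl
        exact hx (by linear_combination hsin)
      refine ⟨mul_ne_zero (neg_ne_zero.2 h0) hs, ?_⟩
      have hxs : x ^ 2 - 1 = -s ^ 2 := by linear_combination hsin
      rw [hxs]
      field_simp
      ring

end Uniformizes


/-! ### Elliptic functions -/

/-- Reindex the lattice sum by `l ↦ ε l` and use homogeneity of its terms; the same argument serves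
for the derivative and for the Eisenstein sums. -/
theorem weierstrassP_mul {L : PeriodPair} {ε : ℂ} (e : L.lattice ≃ L.lattice)
    (he : ∀ l, (e l : ℂ) = ε * l) (hε : ε ≠ 0) (z : ℂ) :
    ε ^ 2 * L.weierstrassP (ε * z) = L.weierstrassP z := by
  rw [PeriodPair.weierstrassP, PeriodPair.weierstrassP, ← e.tsum_eq, ← tsum_mul_left]
  congr with l
  rw [he, ← mul_sub, mul_pow, mul_pow, one_div, one_div, one_div, one_div, mul_inv, mul_inv]
  field_simp

theorem derivWeierstrassP_mul {L : PeriodPair} {ε : ℂ} (e : L.lattice ≃ L.lattice)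
    (he : ∀ l, (e l : ℂ) = ε * l) (hε : ε ≠ 0) (z : ℂ) :
    ε ^ 3 * L.derivWeierstrassP (ε * z) = L.derivWeierstrassP z := by
  rw [PeriodPair.derivWeierstrassP, PeriodPair.derivWeierstrassP, ← e.tsum_eq, mul_neg,
    ← tsum_mul_left]
  congr with l
  rw [he, ← mul_sub, mul_pow, div_eq_mul_inv, div_eq_mul_inv, mul_inv]
  field_simp

theorem G_mul {L : PeriodPair} {ε : ℂ} (e : L.lattice ≃ L.lattice)
    (he : ∀ l, (e l : ℂ) = ε * l) (hε : ε ≠ 0) (n : ℕ) :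
    ε ^ n * L.G n = L.G n := by
  conv_lhs => rw [PeriodPair.G, ← e.tsum_eq, ← tsum_mul_left]
  rw [PeriodPair.G]
  congr with l
  rw [he, mul_pow, mul_inv]
  field_simp

variable (L : PeriodPair)

theorem eventually_notMem_lattice {z : ℂ} (hz : z ∉ L.lattice) : ∀ᶠ w in 𝓝 z, w ∉ L.lattice :=
  L.isClosed_lattice.isOpen_compl.mem_nhds hz

theorem analyticAt_weierstrassP {z : ℂ} (hz : z ∉ L.lattice) : AnalyticAt ℂ L.weierstrassP z :=
  L.analyticOnNhd_weierstrassP z hz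

theorem analyticAt_derivWeierstrassP {z : ℂ} (hz : z ∉ L.lattice) :
    AnalyticAt ℂ L.derivWeierstrassP z :=
  L.analyticOnNhd_derivWeierstrassP z hz

theorem hasDerivAt_weierstrassP {z : ℂ} (hz : z ∉ L.lattice) :
    HasDerivAt L.weierstrassP (L.derivWeierstrassP z) z := by
  rw [← L.deriv_weierstrassP]
  exact (analyticAt_weierstrassP L hz).differentiableAt.hasDerivAt

/-- Differentiate the cubic relation between `℘` and `℘'` and divide by `2 ℘'`, whence the
nonvanishing condition. -/
theorem hasDerivAt_derivWeierstrassP {z : ℂ} (hz : z ∉ L.lattice)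
    (h : L.derivWeierstrassP z ≠ 0) :
    HasDerivAt L.derivWeierstrassP (6 * L.weierstrassP z ^ 2 - L.g₂ / 2) z := by
  have h1 := hasDerivAt_weierstrassP L hz
  have h2 := (analyticAt_derivWeierstrassP L hz).differentiableAt.hasDerivAt
  have h3 : HasDerivAt (fun w => L.derivWeierstrassP w ^ 2) (2 * L.derivWeierstrassP z ^ (2 - 1) *
      deriv L.derivWeierstrassP z) z := h2.pow 2
  have h4 : HasDerivAt (fun w => 4 * L.weierstrassP w ^ 3 - L.g₂ * L.weierstrassP w - L.g₃)
      (4 * (3 * L.weierstrassP z ^ (3 - 1) * L.derivWeierstrassP z) -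
        L.g₂ * L.derivWeierstrassP z) z :=
    (((h1.pow 3).const_mul 4).sub (h1.const_mul L.g₂)).sub_const _
  have h5 : (fun w => L.derivWeierstrassP w ^ 2) =ᶠ[𝓝 z]
      fun w => 4 * L.weierstrassP w ^ 3 - L.g₂ * L.weierstrassP w - L.g₃ := by
    filter_upwards [eventually_notMem_lattice L hz] with w hw using L.derivWeierstrassP_sq w hw
  have h6 := (h4.congr_of_eventuallyEq h5).unique h3
  refine h2.congr_deriv (mul_left_cancel₀ h ?_)
  norm_num at h6
  linear_combination -h6 / 2

theorem weierstrassP_eventually_eq : ∃ F : ℂ → ℂ, AnalyticAt ℂ F 0 ∧ F 0 = 1 ∧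
    ∀ᶠ z in 𝓝[≠] 0, L.weierstrassP z = F z / z ^ 2 := by
  refine ⟨fun z => z ^ 2 * L.weierstrassPExcept 0 z + 1, ?_, by simp, ?_⟩
  · have := L.analyticAt_weierstrassPExcept 0
    fun_prop
  · filter_upwards [self_mem_nhdsWithin] with z hz
    have hz' : z ≠ 0 := hz
    have := L.weierstrassPExcept_def 0 z
    simp only [ZeroMemClass.coe_zero, sub_zero] at this
    rw [this]
    field_simp
    ring

theorem derivWeierstrassP_eventually_eq : ∃ F : ℂ → ℂ, AnalyticAt ℂ F 0 ∧ F 0 = -2 ∧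
    ∀ᶠ z in 𝓝[≠] 0, L.derivWeierstrassP z = F z / z ^ 3 := by
  refine ⟨fun z => z ^ 3 * L.derivWeierstrassPExcept 0 z - 2, ?_, by simp, ?_⟩
  · have := L.analyticAt_derivWeierstrassPExcept 0
    fun_prop
  · filter_upwards [self_mem_nhdsWithin] with z hz
    have hz' : z ≠ 0 := hz
    have := L.derivWeierstrassPExcept_def 0 z
    simp only [ZeroMemClass.coe_zero, sub_zero] at this
    rw [this]
    field_simp
    ring

theorem cofinite_eval_ne_zero (P : Polynomial ℂ) (n : ℕ) (h : P.coeff n ≠ 0) :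
    ∀ᶠ x in cofinite, P.eval x ≠ 0 := by
  refine eventually_cofinite.2 ?_
  simpa using finite_eval_eq_zero (P := P) (by
    rintro rfl
    simp at h)

namespace Uniformizes

variable {L} {R : RatFunc ℂ} {lam c : ℂ} {k : ℕ} {Φ : ℂ → Sphere} {s : ℂ → ℂ}

theorem exists_rotation_equiv (hU : Uniformizes R lam c L.lattice k Φ) {ε : ℂ} (hε : ε ^ k = 1) :
    ε ≠ 0 ∧ ∃ e : L.lattice ≃ L.lattice, ∀ l, (e l : ℂ) = ε * l := by
  have hk : k ≠ 0 := by
    have := hU.pos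
    omega
  have hε0 : ε ≠ 0 := by
    rintro rfl
    simp [hk] at hε
  have hmem : ∀ ε : ℂ, ε ^ k = 1 → ∀ b ∈ L.lattice, ε * b ∈ L.lattice := fun ε hε b hb =>
    hU.smul_mem L.lattice.zero_mem hε hb
  refine ⟨hε0, ⟨fun l => ⟨ε * l, hmem ε hε l l.2⟩, fun l => ⟨ε⁻¹ * l, hmem ε⁻¹ (by
    rw [inv_pow, hε, inv_one]) l l.2⟩, fun l => ?_, fun l => ?_⟩, fun l => rfl⟩
  · ext
    exact inv_mul_cancel_left₀ hε0 _
  · ext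
    exact mul_inv_cancel_left₀ hε0 _

theorem weierstrassP_rotation (hU : Uniformizes R lam c L.lattice k Φ) {ε : ℂ} (hε : ε ^ k = 1)
    (z : ℂ) : ε ^ 2 * L.weierstrassP (ε * z) = L.weierstrassP z := by
  obtain ⟨h0, e, he⟩ := hU.exists_rotation_equiv hε
  exact weierstrassP_mul e he h0 z

theorem derivWeierstrassP_rotation (hU : Uniformizes R lam c L.lattice k Φ) {ε : ℂ}
    (hε : ε ^ k = 1) (z : ℂ) : ε ^ 3 * L.derivWeierstrassP (ε * z) = L.derivWeierstrassP z := by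
  obtain ⟨h0, e, he⟩ := hU.exists_rotation_equiv hε
  exact derivWeierstrassP_mul e he h0 z

theorem G_eq_zero (hU : Uniformizes R lam c L.lattice k Φ) {ε : ℂ} (hε : ε ^ k = 1) {n : ℕ}
    (hn : ε ^ n ≠ 1) : L.G n = 0 := by
  obtain ⟨h0, e, he⟩ := hU.exists_rotation_equiv hε
  have h : (ε ^ n - 1) * L.G n = 0 := by linear_combination G_mul e he h0 n
  exact (mul_eq_zero.1 h).resolve_left (sub_ne_zero.2 hn)

/-- Multiplied by `s'`, flatness reads `m(s) s' ^ 2 + s'' = 0`. Only generic values matter, so zeros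
of `s'` may be discarded. -/
theorem isSolutionG2_withPoles (hU : Uniformizes R lam c L.lattice k Φ)
    (hΦ : ∀ z, Φ z = withPoles L s z) {μ : RatFunc ℂ} {m : ℂ → ℂ}
    (hμ : ∀ᶠ x in cofinite, val μ x = m x)
    (hpull : ∀ᶠ x : ℂ in cofinite, ∀ z ∉ L.lattice, s z = x →
      ∃ s₁ : ℂ → ℂ, ∃ d : ℂ, (∀ᶠ w in 𝓝 z, HasDerivAt s (s₁ w) w) ∧ HasDerivAt s₁ d z ∧
        s₁ z ≠ 0 ∧ m x * s₁ z ^ 2 + d = 0) : IsSolutionG2 μ R := by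
  have hinf : ∀ z, Φ z ≠ ∞ → z ∉ L.lattice := fun z hz h => hz (by rw [hΦ, withPoles, if_pos h])
  refine hU.isSolutionG2 hμ (f := s) (fun z hz => ?_) ?_
  · filter_upwards [eventually_notMem_lattice L (hinf z hz)] with w hw
    rw [hΦ, withPoles, if_neg hw]
  · filter_upwards [hpull] with x hx z hz
    have hzL := hinf z (by rw [hz]; exact OnePoint.coe_ne_infty x)
    rw [hΦ, withPoles, if_neg hzL] at hz
    obtain ⟨s₁, d, h1, h2, h3, h4⟩ := hx z hzL (OnePoint.coe_injective hz)
    have h5 : deriv s =ᶠ[𝓝 z] s₁ := h1.mono fun w hw => hw.deriv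
    rw [h5.deriv_eq, h2.deriv, h5.eq_of_nhds]
    refine ⟨h3, ?_⟩
    field_simp
    rw [h4, mul_zero]

theorem exists_wp (hU : Uniformizes R lam c L.lattice 2 Φ) :
    ∃ g : GL (Fin 2) ℂ, ∀ z, g • Φ z = withPoles L L.weierstrassP z := by
  refine hU.exists_smul_eq_withPoles rfl (fun z => analyticAt_weierstrassP L)
    (fun b hb z => L.weierstrassP_add_coe z ⟨b, hb⟩) (fun ε z hε => ?_) ?_
  · rw [← hU.weierstrassP_rotation hε z, hε, one_mul]
  · obtain ⟨F, hF, hF0, he⟩ := weierstrassP_eventually_eq L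
    exact ⟨F, hF, by simp [hF0], he⟩

theorem exists_wp_sq (hU : Uniformizes R lam c L.lattice 4 Φ) :
    ∃ g : GL (Fin 2) ℂ, ∀ z, g • Φ z = withPoles L (fun u => L.weierstrassP u ^ 2) z := by
  refine hU.exists_smul_eq_withPoles rfl (fun z hz => (analyticAt_weierstrassP L hz).fun_pow 2)
    (fun b hb z => congrArg (· ^ 2) (L.weierstrassP_add_coe z ⟨b, hb⟩)) (fun ε z hε => ?_) ?_
  · rw [← hU.weierstrassP_rotation hε z]
    linear_combination -L.weierstrassP (ε * z) ^ 2 * hε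
  · obtain ⟨F, hF, hF0, he⟩ := weierstrassP_eventually_eq L
    refine ⟨fun z => F z ^ 2, hF.fun_pow 2, by simp [hF0], ?_⟩
    filter_upwards [he] with z hz
    rw [hz]
    ring

theorem exists_wp_deriv (hU : Uniformizes R lam c L.lattice 3 Φ) :
    ∃ g : GL (Fin 2) ℂ, ∀ z, g • Φ z = withPoles L L.derivWeierstrassP z := by
  refine hU.exists_smul_eq_withPoles rfl (fun z => analyticAt_derivWeierstrassP L)
    (fun b hb z => L.derivWeierstrassP_add_coe z ⟨b, hb⟩) (fun ε z hε => ?_) ?_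
  · rw [← hU.derivWeierstrassP_rotation hε z, hε, one_mul]
  · obtain ⟨F, hF, hF0, he⟩ := derivWeierstrassP_eventually_eq L
    exact ⟨F, hF, by simp [hF0], he⟩

theorem exists_wp_cube (hU : Uniformizes R lam c L.lattice 6 Φ) :
    ∃ g : GL (Fin 2) ℂ, ∀ z, g • Φ z = withPoles L (fun u => L.weierstrassP u ^ 3) z := by
  refine hU.exists_smul_eq_withPoles rfl (fun z hz => (analyticAt_weierstrassP L hz).fun_pow 3)
    (fun b hb z => congrArg (· ^ 3) (L.weierstrassP_add_coe z ⟨b, hb⟩)) (fun ε z hε => ?_) ?_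
  · rw [← hU.weierstrassP_rotation hε z]
    linear_combination -L.weierstrassP (ε * z) ^ 3 * hε
  · obtain ⟨F, hF, hF0, he⟩ := weierstrassP_eventually_eq L
    refine ⟨fun z => F z ^ 3, hF.fun_pow 3, by simp [hF0], ?_⟩
    filter_upwards [he] with z hz
    rw [hz]
    ring

end Uniformizes


/-! ### The elliptic normal forms -/

namespace Uniformizes

variable {L : PeriodPair} {R : RatFunc ℂ} {lam c : ℂ} {Φ : ℂ → Sphere}
  {G : Subgroup (ℂ ≃ᵃ[ℂ] ℂ)}

/-- Here `μ = -℘'' / ℘' ^ 2`; the excluded values are the roots of the cubic, where `℘'` vanishes.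
-/
theorem normalForm_wp (h₁ : L.ω₁ = 1) (h₂ : 0 < L.ω₂.im)
    (hG : IsRotationTranslationGroup G L.lattice 2) (hU : Uniformizes R lam c L.lattice 2 Φ)
    (hΦ : ∀ z, Φ z = withPoles L L.weierstrassP z) : NormalForm R G Φ := by
  refine .wp L h₁ h₂ hG hΦ (hU.isLattes rfl) (hU.isSolutionG2_withPoles hΦ
    (m := fun x => -(6 * x ^ 2 - L.g₂ / 2) / (4 * x ^ 3 - L.g₂ * x - L.g₃)) ?_ ?_)
  · have hN : (-(6 * RatFunc.X ^ 2 - RatFunc.C (L.g₂ / 2)) : RatFunc ℂ) = algebraMap (Polynomial ℂ)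
      (RatFunc ℂ)
        (-(6 * Polynomial.X ^ 2 - Polynomial.C (L.g₂ / 2))) := by
      simp only [map_sub, map_mul, map_neg, map_pow, map_ofNat, RatFunc.algebraMap_X,
          RatFunc.algebraMap_C]
    have hD : (4 * RatFunc.X ^ 3 - RatFunc.C L.g₂ * RatFunc.X - RatFunc.C L.g₃ : RatFunc ℂ) =
        algebraMap (Polynomial ℂ) (RatFunc ℂ) (4 * Polynomial.X ^ 3 - Polynomial.C L.g₂ *
            Polynomial.X -
          Polynomial.C L.g₃) := by
      simp only [map_sub, map_mul, map_pow, map_ofNat, RatFunc.algebraMap_X, RatFunc.algebraMap_C]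
    rw [hN, hD]
    filter_upwards [val_div (algebraMap (Polynomial ℂ) (RatFunc ℂ) (-(6 * Polynomial.X ^ 2 -
      Polynomial.C (L.g₂ / 2)))) (algebraMap (Polynomial ℂ) (RatFunc ℂ) (4 * Polynomial.X ^ 3 -
        Polynomial.C L.g₂ * Polynomial.X - Polynomial.C L.g₃))] with x hx
    rw [hx, val_algebraMap, val_algebraMap]
    simp
  · filter_upwards [cofinite_eval_ne_zero (Polynomial.C 4 * Polynomial.X ^ 3 -
      Polynomial.C L.g₂ * Polynomial.X - Polynomial.C L.g₃) 3 (by simp)] with x hx z hz hzx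
    subst hzx
    have hsq := L.derivWeierstrassP_sq z hz
    simp only [Polynomial.eval_sub, Polynomial.eval_mul, Polynomial.eval_C, Polynomial.eval_pow,
      Polynomial.eval_X] at hx
    have hq : L.derivWeierstrassP z ≠ 0 := by
      intro h
      rw [h] at hsq
      exact hx (by linear_combination -hsq)
    refine ⟨L.derivWeierstrassP, _, ?_, hasDerivAt_derivWeierstrassP L hz hq, hq, ?_⟩
    · filter_upwards [eventually_notMem_lattice L hz] with w hw using hasDerivAt_weierstrassP L hw
    · rw [hsq, div_mul_cancel₀ _ hx]
      ring

/-- `g₃ = 0` because `i ^ 6 ≠ 1`. For `x = ℘ ^ 2` one has `℘' ^ 2 = ℘ (4 x - g₂)`, which makes `-s''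
/ s' ^ 2` rational in `x`. -/
theorem normalForm_wp_sq (h₁ : L.ω₁ = 1) (h₂ : L.ω₂ = Complex.I)
    (hG : IsRotationTranslationGroup G L.lattice 4) (hU : Uniformizes R lam c L.lattice 4 Φ)
    (hΦ : ∀ z, Φ z = withPoles L (fun u => L.weierstrassP u ^ 2) z) : NormalForm R G Φ := by
  have hg : L.g₃ = 0 := by
    rw [PeriodPair.g₃, hU.G_eq_zero (ε := Complex.I) Complex.I_pow_four (by
      rw [show Complex.I ^ 6 = -1 by
        rw [show (6 : ℕ) = 4 + 2 by norm_num, pow_add, Complex.I_pow_four, Complex.I_sq, one_mul]]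
      norm_num), mul_zero]
  refine .wp_sq L h₁ h₂ hg hG hΦ (hU.isLattes rfl) (hU.isSolutionG2_withPoles hΦ
    (m := fun x => -1 / (2 * x) - (6 * x - L.g₂ / 2) / (8 * x ^ 2 - 2 * L.g₂ * x)) ?_ ?_)
  · have e1 : (-1 : RatFunc ℂ) = algebraMap (Polynomial ℂ) (RatFunc ℂ) (-1 : Polynomial ℂ) := by
      simp only [map_neg, map_one]
    have e2 : (2 * RatFunc.X : RatFunc ℂ) = algebraMap (Polynomial ℂ) (RatFunc ℂ) (2 *
        Polynomial.X) := by
      simp only [map_mul, map_ofNat, RatFunc.algebraMap_X]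
    have e3 : (6 * RatFunc.X - RatFunc.C (L.g₂ / 2) : RatFunc ℂ) = algebraMap (Polynomial ℂ)
        (RatFunc ℂ)
        (6 * Polynomial.X - Polynomial.C (L.g₂ / 2)) := by
      simp only [map_sub, map_mul, map_ofNat, RatFunc.algebraMap_X, RatFunc.algebraMap_C]
    have e4 : (8 * RatFunc.X ^ 2 - 2 * RatFunc.C L.g₂ * RatFunc.X : RatFunc ℂ) = algebraMap
        (Polynomial ℂ) (RatFunc ℂ)
        (8 * Polynomial.X ^ 2 - 2 * Polynomial.C L.g₂ *
          Polynomial.X) := by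
      simp only [map_sub, map_mul, map_pow, map_ofNat, RatFunc.algebraMap_X, RatFunc.algebraMap_C]
    rw [e1, e2, e3, e4]
    filter_upwards [val_sub (algebraMap (Polynomial ℂ) (RatFunc ℂ) (-1 : Polynomial ℂ) / algebraMap
        (Polynomial ℂ) (RatFunc ℂ)
      (2 * Polynomial.X)) (algebraMap (Polynomial ℂ) (RatFunc ℂ) (6 * Polynomial.X -
        Polynomial.C (L.g₂ / 2)) / algebraMap (Polynomial ℂ) (RatFunc ℂ) (8 * Polynomial.X ^ 2 -
          2 * Polynomial.C L.g₂ * Polynomial.X)),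
      val_div (algebraMap (Polynomial ℂ) (RatFunc ℂ) (-1 : Polynomial ℂ)) (algebraMap (Polynomial
          ℂ) (RatFunc ℂ)
        (2 * Polynomial.X)),
      val_div (algebraMap (Polynomial ℂ) (RatFunc ℂ) (6 * Polynomial.X - Polynomial.C (L.g₂ / 2)))
        (algebraMap (Polynomial ℂ) (RatFunc ℂ) (8 * Polynomial.X ^ 2 -
          2 * Polynomial.C L.g₂ * Polynomial.X))] with x h1 h2 h3
    rw [h1, h2, h3, val_algebraMap, val_algebraMap, val_algebraMap, val_algebraMap]
    simp
  · filter_upwards [cofinite_eval_ne_zero Polynomial.X 1 (by simp),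
      cofinite_eval_ne_zero (Polynomial.C 4 * Polynomial.X - Polynomial.C L.g₂) 1 (by
        simp [Polynomial.coeff_C])] with x hx0 hx z hz hzx
    simp only [Polynomial.eval_sub, Polynomial.eval_mul, Polynomial.eval_C,
      Polynomial.eval_X] at hx hx0
    have hsq := L.derivWeierstrassP_sq z hz
    rw [hg] at hsq
    have hp : L.weierstrassP z ≠ 0 := by
      intro h
      rw [h] at hzx
      exact hx0 (by rw [← hzx]; simp)
    have hq : L.derivWeierstrassP z ≠ 0 := by
      intro h
      rw [h] at hsq
      refine mul_ne_zero hp hx ?_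
      rw [← hzx]
      linear_combination -hsq
    refine ⟨fun w => 2 * (L.weierstrassP w * L.derivWeierstrassP w), _, ?_,
      ((hasDerivAt_weierstrassP L hz).mul (hasDerivAt_derivWeierstrassP L hz hq)).const_mul 2,
      mul_ne_zero two_ne_zero (mul_ne_zero hp hq), ?_⟩
    · filter_upwards [eventually_notMem_lattice L hz] with w hw
      refine ((hasDerivAt_weierstrassP L hw).pow 2).congr_deriv ?_
      push_cast
      ring
    · rw [show (8 * x ^ 2 - 2 * L.g₂ * x) = 2 * x * (4 * x - L.g₂) by ring]
      have e1 : (2 * (L.weierstrassP z * L.derivWeierstrassP z)) ^ 2 =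
          4 * x * (L.weierstrassP z * (4 * x - L.g₂)) := by
        rw [← hzx]
        linear_combination 4 * L.weierstrassP z ^ 2 * hsq
      have e2 : ∀ N p D : ℂ, D ≠ 0 → (-1 / (2 * x) - N / (2 * x * D)) * (4 * x * (p * D)) =
          -2 * p * D - 2 * p * N := by
        intro N p D hD
        field_simp
        ring
      rw [e1, e2 _ _ _ hx, ← hzx]
      linear_combination 2 * hsq

/-- `g₂ = 0` because `j ^ 4 ≠ 1`. For `x = ℘'` one has `s' = 6 ℘ ^ 2`, `s'' = 12 ℘ x` and `4 ℘ ^ 3 =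
x ^ 2 + g₃`. -/
theorem normalForm_wp_deriv (h₁ : L.ω₁ = 1)
    (h₂ : L.ω₂ = Complex.exp (2 * Real.pi * Complex.I / 3))
    (hG : IsRotationTranslationGroup G L.lattice 3) (hU : Uniformizes R lam c L.lattice 3 Φ)
    (hΦ : ∀ z, Φ z = withPoles L L.derivWeierstrassP z) : NormalForm R G Φ := by
  have hj := IsEuclidean.isPrimitiveRoot_cubeRoot
  have hg : L.g₂ = 0 := by
    rw [PeriodPair.g₂, hU.G_eq_zero hj.pow_eq_one (by
      rw [pow_succ, hj.pow_eq_one, one_mul]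
      exact hj.ne_one (by norm_num)), mul_zero]
  refine .wp_deriv L h₁ h₂ hg hG hΦ (hU.isLattes rfl) (hU.isSolutionG2_withPoles hΦ
    (m := fun x => -(4 * x) / (3 * (x ^ 2 + L.g₃))) ?_ ?_)
  · have hN : (-(4 * RatFunc.X) : RatFunc ℂ) = algebraMap (Polynomial ℂ) (RatFunc ℂ)
        (-(4 * Polynomial.X)) := by
      simp only [map_mul, map_neg, map_ofNat, RatFunc.algebraMap_X]
    have hD : (3 * (RatFunc.X ^ 2 + RatFunc.C L.g₃) : RatFunc ℂ) =
        algebraMap (Polynomial ℂ) (RatFunc ℂ) (3 * (Polynomial.X ^ 2 + Polynomial.C L.g₃)) := by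
      simp only [map_mul, map_add, map_pow, map_ofNat, RatFunc.algebraMap_X, RatFunc.algebraMap_C]
    rw [hN, hD]
    filter_upwards [val_div (algebraMap (Polynomial ℂ) (RatFunc ℂ) (-(4 * Polynomial.X)))
      (algebraMap (Polynomial ℂ) (RatFunc ℂ) (3 * (Polynomial.X ^ 2 + Polynomial.C L.g₃)))] with x
          hx
    rw [hx, val_algebraMap, val_algebraMap]
    simp
  · filter_upwards [cofinite_eval_ne_zero Polynomial.X 1 (by simp),
      cofinite_eval_ne_zero (Polynomial.X ^ 2 + Polynomial.C L.g₃) 2 (by simp)] with x hx0 hx z hz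
          hzx
    simp only [Polynomial.eval_add, Polynomial.eval_pow, Polynomial.eval_C,
      Polynomial.eval_X] at hx hx0
    have hsq := L.derivWeierstrassP_sq z hz
    rw [hg, hzx] at hsq
    have hx4 : x ^ 2 + L.g₃ = 4 * L.weierstrassP z ^ 3 := by linear_combination hsq
    have hp : L.weierstrassP z ≠ 0 := by
      intro h
      rw [h] at hx4
      exact hx (by rw [hx4]; ring)
    have hqe : ∀ᶠ w in 𝓝 z, L.derivWeierstrassP w ≠ 0 :=
      (analyticAt_derivWeierstrassP L hz).continuousAt.eventually_ne (by rwa [hzx])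
    refine ⟨fun w => 6 * L.weierstrassP w ^ 2, _, ?_,
      ((hasDerivAt_weierstrassP L hz).pow 2).const_mul 6,
      mul_ne_zero (by norm_num) (pow_ne_zero _ hp), ?_⟩
    · filter_upwards [eventually_notMem_lattice L hz, hqe] with w hw hw'
      refine (hasDerivAt_derivWeierstrassP L hw hw').congr_deriv ?_
      rw [hg]
      ring
    · simp only [hx4, hzx]
      push_cast
      field_simp
      ring

/-- Again `g₂ = 0`. For `x = ℘ ^ 3` the cubic relation becomes `℘' ^ 2 = 4 x - g₃`. -/
theorem normalForm_wp_cube (h₁ : L.ω₁ = 1)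
    (h₂ : L.ω₂ = Complex.exp (2 * Real.pi * Complex.I / 3))
    (hG : IsRotationTranslationGroup G L.lattice 6) (hU : Uniformizes R lam c L.lattice 6 Φ)
    (hΦ : ∀ z, Φ z = withPoles L (fun u => L.weierstrassP u ^ 3) z) : NormalForm R G Φ := by
  have hj := IsEuclidean.isPrimitiveRoot_cubeRoot
  have hg : L.g₂ = 0 := by
    rw [PeriodPair.g₂, hU.G_eq_zero (ε := IsEuclidean.cubeRoot) (by
      rw [show (6 : ℕ) = 3 * 2 by norm_num, pow_mul, hj.pow_eq_one, one_pow]) (by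
      rw [pow_succ, hj.pow_eq_one, one_mul]
      exact hj.ne_one (by norm_num)), mul_zero]
  refine .wp_cube L h₁ h₂ hg hG hΦ (hU.isLattes rfl) (hU.isSolutionG2_withPoles hΦ
    (m := fun x => -2 / (3 * x) - 1 / (2 * (x - L.g₃ / 4))) ?_ ?_)
  · have e1 : (-2 : RatFunc ℂ) = algebraMap (Polynomial ℂ) (RatFunc ℂ) (-2 : Polynomial ℂ) := by
      simp only [map_neg, map_ofNat]
    have e2 : (3 * RatFunc.X : RatFunc ℂ) = algebraMap (Polynomial ℂ) (RatFunc ℂ) (3 *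
        Polynomial.X) := by
      simp only [map_mul, map_ofNat, RatFunc.algebraMap_X]
    have e3 : (1 : RatFunc ℂ) = algebraMap (Polynomial ℂ) (RatFunc ℂ) (1 : Polynomial ℂ) := by
      simp only [map_one]
    have e4 : (2 * (RatFunc.X - RatFunc.C (L.g₃ / 4)) : RatFunc ℂ) = algebraMap (Polynomial ℂ)
        (RatFunc ℂ)
        (2 * (Polynomial.X - Polynomial.C (L.g₃ / 4))) := by
      simp only [map_sub, map_mul, map_ofNat, RatFunc.algebraMap_X, RatFunc.algebraMap_C]
    rw [e1, e2, e3, e4]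
    filter_upwards [val_sub (algebraMap (Polynomial ℂ) (RatFunc ℂ) (-2 : Polynomial ℂ) / algebraMap
        (Polynomial ℂ) (RatFunc ℂ)
      (3 * Polynomial.X)) (algebraMap (Polynomial ℂ) (RatFunc ℂ) (1 : Polynomial ℂ) / algebraMap
          (Polynomial ℂ) (RatFunc ℂ)
        (2 * (Polynomial.X - Polynomial.C (L.g₃ / 4)))),
      val_div (algebraMap (Polynomial ℂ) (RatFunc ℂ) (-2 : Polynomial ℂ)) (algebraMap (Polynomial
          ℂ) (RatFunc ℂ)
        (3 * Polynomial.X)),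
      val_div (algebraMap (Polynomial ℂ) (RatFunc ℂ) (1 : Polynomial ℂ))
        (algebraMap (Polynomial ℂ) (RatFunc ℂ) (2 * (Polynomial.X - Polynomial.C (L.g₃ / 4))))]
      with x h1 h2 h3
    rw [h1, h2, h3, val_algebraMap, val_algebraMap, val_algebraMap, val_algebraMap]
    simp
  · filter_upwards [cofinite_eval_ne_zero Polynomial.X 1 (by simp),
      cofinite_eval_ne_zero (Polynomial.C 4 * Polynomial.X - Polynomial.C L.g₃) 1 (by
        simp [Polynomial.coeff_C])] with x hx0 hx z hz hzx
    simp only [Polynomial.eval_sub, Polynomial.eval_mul, Polynomial.eval_C,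
      Polynomial.eval_X] at hx hx0
    have hsq := L.derivWeierstrassP_sq z hz
    rw [hg] at hsq
    have hsq' : L.derivWeierstrassP z ^ 2 = 4 * x - L.g₃ := by
      rw [← hzx]
      linear_combination hsq
    have hp : L.weierstrassP z ≠ 0 := by
      intro h
      rw [h] at hzx
      exact hx0 (by rw [← hzx]; simp)
    have hq : L.derivWeierstrassP z ≠ 0 := by
      intro h
      rw [h] at hsq'
      exact hx (by rw [← hsq']; simp)
    refine ⟨fun w => 3 * (L.weierstrassP w ^ 2 * L.derivWeierstrassP w), _, ?_,
      (((hasDerivAt_weierstrassP L hz).pow 2).mul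
        (hasDerivAt_derivWeierstrassP L hz hq)).const_mul 3,
      mul_ne_zero (by norm_num) (mul_ne_zero (pow_ne_zero _ hp) hq), ?_⟩
    · filter_upwards [eventually_notMem_lattice L hz] with w hw
      refine ((hasDerivAt_weierstrassP L hw).pow 3).congr_deriv ?_
      push_cast
      ring
    · have e1 : (3 * (L.weierstrassP z ^ 2 * L.derivWeierstrassP z)) ^ 2 =
          9 * L.weierstrassP z * x * (4 * x - L.g₃) := by
        rw [← hsq', ← hzx]
        ring
      rw [show (2 * (x - L.g₃ / 4)) = (4 * x - L.g₃) / 2 by ring]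
      have e2 : ∀ p D : ℂ, D ≠ 0 → (-2 / (3 * x) - 1 / (D / 2)) * (9 * p * x * D) =
          -6 * p * D - 18 * p * x := by
        intro p D hD
        field_simp
        ring
      rw [e1, e2 _ _ hx, ← hzx, hg, Pi.pow_apply]
      push_cast
      rw [← hzx] at hsq'
      linear_combination 6 * L.weierstrassP z * hsq'

end Uniformizes

/-! ### The classification -/

/-- Every quotient of a dilation has a normal form. -/
theorem IsQuotientOfDilation.exists_normalForm {R : RatFunc ℂ} {lam : ℂ}
    {G : Subgroup (ℂ ≃ᵃ[ℂ] ℂ)} {Ψ : ℂ → Sphere} (hQ : IsQuotientOfDilation R lam G Ψ) :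
    ∃ (A : ℂ ≃ᵃ[ℂ] ℂ) (h : GL (Fin 2) ℂ) (S : RatFunc ℂ),
      (∀ x : Sphere, ratMap S (h • x) = h • ratMap R x) ∧
      NormalForm S (G.map (MulAut.conj A⁻¹).toMonoidHom) (fun z => h • Ψ (A z)) := by
  obtain ⟨A, c, Λ, k, htype, hG, hU⟩ := hQ.exists_uniformizes
  suffices h : ∃ h : GL (Fin 2) ℂ, ∀ S : RatFunc ℂ,
      (∀ x : Sphere, ratMap S (h • x) = h • ratMap R x) →
      NormalForm S (G.map (MulAut.conj A⁻¹).toMonoidHom) (fun z => h • Ψ (A z)) by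
    obtain ⟨h, hh⟩ := h
    obtain ⟨S, -, -, hS⟩ := exists_conj R hU.nonconst_ratFunc h
    exact ⟨A, h, S, hS, hh S hS⟩
  rcases htype with rfl | ⟨rfl, rfl | rfl⟩ |
    ⟨L, rfl, h₁, ⟨h₂, rfl | rfl⟩ | ⟨h₂, rfl⟩ | ⟨h₂, rfl | rfl⟩⟩
  · obtain ⟨h, hh⟩ := hU.exists_rotation
    exact ⟨h, fun S hS => (hU.smul hS).normalForm_rotation hG hh⟩
  · obtain ⟨h, hh⟩ := hU.exists_exp
    exact ⟨h, fun S hS => (hU.smul hS).normalForm_exp hG hh⟩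
  · obtain ⟨h, hh⟩ := hU.exists_cos
    exact ⟨h, fun S hS => (hU.smul hS).normalForm_cos hG hh⟩
  · exact (hU.order_ne_one rfl rfl).elim
  · obtain ⟨h, hh⟩ := hU.exists_wp
    exact ⟨h, fun S hS => (hU.smul hS).normalForm_wp h₁ h₂ hG hh⟩
  · obtain ⟨h, hh⟩ := hU.exists_wp_sq
    exact ⟨h, fun S hS => (hU.smul hS).normalForm_wp_sq h₁ h₂ hG hh⟩
  · obtain ⟨h, hh⟩ := hU.exists_wp_deriv
    exact ⟨h, fun S hS => (hU.smul hS).normalForm_wp_deriv h₁ h₂ hG hh⟩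
  · obtain ⟨h, hh⟩ := hU.exists_wp_cube
    exact ⟨h, fun S hS => (hU.smul hS).normalForm_wp_cube h₁ h₂ hG hh⟩

theorem NormalForm.exists_solution {S : RatFunc ℂ} {G : Subgroup (ℂ ≃ᵃ[ℂ] ℂ)} {Ψ : ℂ → Sphere}
    (h : NormalForm S G Ψ) : ∃ μ, IsSolutionG2 μ S := by
  cases h
  all_goals exact ⟨_, by assumption⟩

end DGroupoid
end

/-! ### The main theorem -/

theorem mainTheorem2 (R : RatFunc ℂ) :
    (DGroupoid.degree R ≠ 1 →
      ((∃ μ : RatFunc ℂ, DGroupoid.IsSolutionG2 μ R) ↔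
        ∃ (lam : ℂ) (G : Subgroup (ℂ ≃ᵃ[ℂ] ℂ)) (Ψ : ℂ → DGroupoid.Sphere),
          DGroupoid.IsQuotientOfDilation R lam G Ψ)) ∧
    (∀ (lam : ℂ) (G : Subgroup (ℂ ≃ᵃ[ℂ] ℂ)) (Ψ : ℂ → DGroupoid.Sphere),
      DGroupoid.IsQuotientOfDilation R lam G Ψ →
        ∃ (A : ℂ ≃ᵃ[ℂ] ℂ) (h : GL (Fin 2) ℂ) (S : RatFunc ℂ),
          (∀ x : DGroupoid.Sphere, DGroupoid.ratMap S (h • x) = h • DGroupoid.ratMap R x) ∧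
          DGroupoid.NormalForm S (G.map (MulAut.conj A⁻¹).toMonoidHom)
            (fun z => h • Ψ (A z))) := by
  refine ⟨fun hd => ⟨?_, ?_⟩, fun lam G Ψ hQ => hQ.exists_normalForm⟩
  · rintro ⟨μ, hμ⟩
    exact DGroupoid.exists_quotient_of_solution hμ hd
  -- The normal form supplies a form for the conjugate `S`, and its pull-back by the homography
  -- serves for `R`.
  · rintro ⟨lam, G, Ψ, hQ⟩
    obtain ⟨A, h, S, hS, hN⟩ := hQ.exists_normalForm
    obtain ⟨μ, hμ⟩ := hN.exists_solution
    exact DGroupoid.exists_solution_of_conj hQ.nonconst_ratFunc hS hμ
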